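/- **Definitions.** All digraphs are finite, without loops or parallel edges (a pair of opposite edges $uv$, $vu$ is allowed). A *path* of a digraph $G$ is a directed path: a nonempty sequence of distinct vertices $v_1,\dots,v_r$ such that $v_iv_{i+1}$ is an edge for $1\le i<r$. It is *minimal* if $j\le i+1$ for every edge $v_iv_j$ of $G$ with $1\le i,j\le r$. For $d\ge 1$, $G$ is *$d$-path-dominant* if for every minimal path $P$ of $G$ with exactly $d$ vertices, every vertex of $G$ belongs to $V(P)$, or has an out-neighbour in $V(P)$, or has an in-neighbour in $V(P)$. A *problem instance* $(G,s_1,t_1,\dots,s_k,t_k)$ consists of a digraph $G$ and (not necessarily distinct) vertices $s_1,t_1,\dots,s_k,t_k$ of $G$. A *linkage* for it is a sequence $(P_1,\dots,P_k)$ of pairwise vertex-disjoint paths of $G$ with $P_i$ from $s_i$ to $t_i$ for $1\le i\le k$. A $k$-tuple of integers $x=(x_1,\dots,x_k)$ is a *quality* of the instance if there is a linkage $(P_1,\dots,P_k)$ for it such that $P_i$ has exactly $x_i$ vertices for $1\le i\le k$. Write $y<x$ if $y\ne x$ and $y_i\le x_i$ for $1\le i\le k$. A quality $x$ is *key* if there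 is no quality $y$ with $y<x$. Algorithms are programs for a random access machine in which each elementary step (access to a register or to an array entry, an arithmetic operation, a comparison or a branch) takes one unit of time, and in which all numbers computed are bounded by a polynomial in $n=|V(G)|$, that is, words have $O(\log n)$ bits. A program does not depend on the input. The input is held in memory, with $G$ given by its adjacency matrix. **Theorem.** For all fixed integers $d\ge 1$ and $k\ge 0$ there is an algorithm which, given as input a problem instance $(G,s_1,t_1,\dots,s_k,t_k)$ such that $G$ is $d$-path-dominant, outputs the set of all key qualities of $(G,s_1,t_1,\dots,s_k,t_k)$ (as a list that contains each of them exactly once). Its running time is $O(n^t)$, where $n=|V(G)|$ and $t=6k^2d(k+d)+13k$; the implied constant depends only on $d$ and $k$. -/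

import Mathlib

namespace DisjointPaths

/-! ### Digraphs, paths, linkages and qualities -/

section Digraphs

variable {V : Type*}

/-- A (directed) path of `G`, given by its sequence of vertices: nonempty, without repetition,
each vertex adjacent to the next one. -/
def IsPath (G : Digraph V) (p : List V) : Prop :=
  p ≠ [] ∧ p.Nodup ∧ p.IsChain G.Adj

/-- A path from `u` to `v`. It is the one-vertex path when `u = v`. -/
def IsPathFromTo (G : Digraph V) (p : List V) (u v : V) : Prop :=
  IsPath G p ∧ p.head? = some u ∧ p.getLast? = some v

/-- A path `v₁, …, vₙ` is minimal if `j ≤ i + 1` for every edge `vᵢ vⱼ` of `G`. -/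
def IsMinimalPath (G : Digraph V) (p : List V) : Prop :=
  IsPath G p ∧ ∀ i j : Fin p.length, G.Adj (p.get i) (p.get j) → (j : ℕ) ≤ (i : ℕ) + 1

/-- `G` is `d`-path-dominant: for every minimal path `P` with `d` vertices, each vertex of `G`
is in `P`, or has an out-neighbour in `P`, or has an in-neighbour in `P`. -/
def IsPathDominant (G : Digraph V) (d : ℕ) : Prop :=
  ∀ p : List V, IsMinimalPath G p → p.length = d →
    ∀ v : V, v ∈ p ∨ (∃ u ∈ p, G.Adj v u) ∨ (∃ u ∈ p, G.Adj u v)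

end Digraphs

/-- A problem instance `(G, s₁, t₁, …, sₖ, tₖ)`, where `G` is a digraph without loops on `n`
vertices (numbered `0, …, n - 1`). The terminals need not be distinct. -/
structure Instance (n k : ℕ) where
  graph : Digraph (Fin n)
  loopless : ∀ v, ¬ graph.Adj v v
  s : Fin k → Fin n
  t : Fin k → Fin n

namespace Instance

variable {n k : ℕ}

/-- `P` is a linkage for the instance: `Pᵢ` is a path from `sᵢ` to `tᵢ`, and the paths are
pairwise vertex-disjoint. -/
def IsLinkage (I : Instance n k) (P : Fin k → List (Fin n)) : Prop :=
  (∀ i, IsPathFromTo I.graph (P i) (I.s i) (I.t i)) ∧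
    ∀ i j, i ≠ j → ∀ v, v ∈ P i → v ∉ P j

/-- `x` is a quality: there is a linkage for the instance whose `i`-th path has `xᵢ` vertices. -/
def IsQuality (I : Instance n k) (x : Fin k → ℕ) : Prop :=
  ∃ P, I.IsLinkage P ∧ ∀ i, (P i).length = x i

/-- A quality `x` is key if there is no quality `y < x` (`y ≤ x` componentwise and `y ≠ x`). -/
def IsKeyQuality (I : Instance n k) (x : Fin k → ℕ) : Prop :=
  I.IsQuality x ∧ ∀ y, I.IsQuality y → ¬ y < x

end Instance

/-! ### The machine model

Algorithms are programs for a random access machine with unit-cost elementary operations.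
A program names finitely many registers and finitely many arrays by constants; array indices are
computed at run time. The parameter `W` bounds every number that is ever computed. -/

/-- A configuration of the memory: the registers and the arrays. -/
structure State where
  reg : ℕ → ℕ
  arr : ℕ → ℕ → ℕ

/-- Elementary operations on words. -/
inductive Op
  | add | sub | mul | div | mod | lt | eq

/-- `sub` is truncated, `div` and `mod` are Euclidean, a comparison gives `1` or `0`. -/
def Op.eval : Op → ℕ → ℕ → ℕ
  | .add, a, b => a + b
  | .sub, a, b => a - b
  | .mul, a, b => a * b
  | .div, a, b => a / b
  | .mod, a, b => a % b
  | .lt, a, b => if a < b then 1 else 0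
  | .eq, a, b => if a = b then 1 else 0

/-- Expressions: a constant, a register, an entry of an array, an elementary operation. -/
inductive Expr
  | const (c : ℕ)
  | reg (r : ℕ)
  | get (a : ℕ) (i : Expr)
  | op (o : Op) (e₁ e₂ : Expr)

namespace Expr

/-- The value of an expression. -/
def eval (σ : State) : Expr → ℕ
  | const c => c
  | reg r => σ.reg r
  | get a i => σ.arr a (i.eval σ)
  | op o e₁ e₂ => o.eval (e₁.eval σ) (e₂.eval σ)

/-- The time to evaluate an expression: one unit for each constant, register access, array access
and elementary operation in it. -/
def cost : Expr → ℕ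
  | const _ => 1
  | reg _ => 1
  | get _ i => i.cost + 1
  | op _ e₁ e₂ => e₁.cost + e₂.cost + 1

/-- All numbers (also addresses) met in the evaluation of the expression are at most `W`. -/
def Fits (W : ℕ) (σ : State) : Expr → Prop
  | const c => c ≤ W
  | reg r => σ.reg r ≤ W
  | get a i => i.Fits W σ ∧ σ.arr a (i.eval σ) ≤ W
  | op o e₁ e₂ => e₁.Fits W σ ∧ e₂.Fits W σ ∧ o.eval (e₁.eval σ) (e₂.eval σ) ≤ W

end Expr

/-- Programs. -/
inductive Program
  | skip
  | assign (r : ℕ) (e : Expr)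
  | store (a : ℕ) (i e : Expr)
  | seq (p q : Program)
  | branch (b : Expr) (p q : Program)
  | loop (b : Expr) (p : Program)

/-- Write `v` into register `r`. -/
def State.setReg (σ : State) (r v : ℕ) : State :=
  { σ with reg := Function.update σ.reg r v }

/-- Write `v` into entry `i` of array `a`. -/
def State.setArr (σ : State) (a i v : ℕ) : State :=
  { σ with arr := Function.update σ.arr a (Function.update (σ.arr a) i v) }

/-- `Exec W p σ σ' T`: the program `p`, started in memory `σ`, halts in memory `σ'` after `T`
steps, and all numbers that it computes on the way are at most `W`.
`branch b p q` runs `p` if `b` is nonzero and `q` otherwise;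
`loop b p` repeats `p` as long as `b` is nonzero. -/
inductive Exec (W : ℕ) : Program → State → State → ℕ → Prop
  | skip (σ : State) : Exec W .skip σ σ 1
  | assign (σ : State) (r : ℕ) (e : Expr) (he : e.Fits W σ) :
      Exec W (.assign r e) σ (σ.setReg r (e.eval σ)) (e.cost + 1)
  | store (σ : State) (a : ℕ) (i e : Expr) (hi : i.Fits W σ) (he : e.Fits W σ) :
      Exec W (.store a i e) σ (σ.setArr a (i.eval σ) (e.eval σ)) (i.cost + e.cost + 1)
  | seq {σ₁ σ₂ σ₃ : State} {p q : Program} {T₁ T₂ : ℕ}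
      (h₁ : Exec W p σ₁ σ₂ T₁) (h₂ : Exec W q σ₂ σ₃ T₂) :
      Exec W (.seq p q) σ₁ σ₃ (T₁ + T₂)
  | branchTrue {σ σ' : State} {b : Expr} {p q : Program} {T : ℕ}
      (hb : b.Fits W σ) (hv : b.eval σ ≠ 0) (h : Exec W p σ σ' T) :
      Exec W (.branch b p q) σ σ' (b.cost + 1 + T)
  | branchFalse {σ σ' : State} {b : Expr} {p q : Program} {T : ℕ}
      (hb : b.Fits W σ) (hv : b.eval σ = 0) (h : Exec W q σ σ' T) :
      Exec W (.branch b p q) σ σ' (b.cost + 1 + T)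
  | loopDone {σ : State} {b : Expr} {p : Program}
      (hb : b.Fits W σ) (hv : b.eval σ = 0) :
      Exec W (.loop b p) σ σ (b.cost + 1)
  | loopStep {σ₁ σ₂ σ₃ : State} {b : Expr} {p : Program} {T₁ T₂ : ℕ}
      (hb : b.Fits W σ₁) (hv : b.eval σ₁ ≠ 0) (h₁ : Exec W p σ₁ σ₂ T₁)
      (h₂ : Exec W (.loop b p) σ₂ σ₃ T₂) :
      Exec W (.loop b p) σ₁ σ₃ (b.cost + 1 + T₁ + T₂)

/-- The machine is deterministic: final memory and running time are determined by the program
and the initial memory. -/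
theorem Exec.deterministic {W : ℕ} {p : Program} {σ σ₁ σ₂ : State} {T₁ T₂ : ℕ}
    (h₁ : Exec W p σ σ₁ T₁) (h₂ : Exec W p σ σ₂ T₂) : σ₁ = σ₂ ∧ T₁ = T₂ := by
  induction h₁ generalizing σ₂ T₂ with
  | skip => cases h₂; exact ⟨rfl, rfl⟩
  | assign => cases h₂; exact ⟨rfl, rfl⟩
  | store => cases h₂; exact ⟨rfl, rfl⟩
  | seq _ _ ih₁ ih₂ =>
    cases h₂ with
    | seq g₁ g₂ =>
      obtain ⟨rfl, rfl⟩ := ih₁ g₁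
      obtain ⟨rfl, rfl⟩ := ih₂ g₂
      exact ⟨rfl, rfl⟩
  | branchTrue _ hv _ ih =>
    cases h₂ with
    | branchTrue _ _ g => obtain ⟨rfl, rfl⟩ := ih g; exact ⟨rfl, rfl⟩
    | branchFalse _ gv _ => exact absurd gv hv
  | branchFalse _ hv _ ih =>
    cases h₂ with
    | branchTrue _ gv _ => exact absurd hv gv
    | branchFalse _ _ g => obtain ⟨rfl, rfl⟩ := ih g; exact ⟨rfl, rfl⟩
  | loopDone _ hv =>
    cases h₂ with
    | loopDone => exact ⟨rfl, rfl⟩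
    | loopStep _ gv _ _ => exact absurd hv gv
  | loopStep _ hv _ _ ih₁ ih₂ =>
    cases h₂ with
    | loopDone _ gv => exact absurd gv hv
    | loopStep _ _ g₁ g₂ =>
      obtain ⟨rfl, rfl⟩ := ih₁ g₁
      obtain ⟨rfl, rfl⟩ := ih₂ g₂
      exact ⟨rfl, rfl⟩

/-! ### Input and output -/

open Classical in
/-- The memory at the start: register `0` holds `n`; array `0` holds the adjacency matrix, row
after row; array `1` holds `s₁, t₁, …, sₖ, tₖ`; everything else is `0`. -/
noncomputable def Instance.initial {n k : ℕ} (I : Instance n k) : State where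
  reg := fun r => if r = 0 then n else 0
  arr := fun a j =>
    if a = 0 then
      (if ∃ u v : Fin n, j = n * (u : ℕ) + v ∧ I.graph.Adj u v then 1 else 0)
    else if a = 1 then
      (if h : j < 2 * k then
        (if j % 2 = 0 then (I.s ⟨j / 2, by omega⟩ : ℕ) else (I.t ⟨j / 2, by omega⟩ : ℕ))
      else 0)
    else 0

/-- In memory `σ` the set `S` of `k`-tuples is listed, each member exactly once: register `1` holds
the number of members, array `2` holds the members one after the other. -/
def State.Lists {k : ℕ} (σ : State) (S : Set (Fin k → ℕ)) : Prop :=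
  Set.BijOn (fun (j : ℕ) (i : Fin k) => σ.arr 2 (k * j + i)) (Set.Iio (σ.reg 1)) S

end DisjointPaths

/-! A key quality is attained by a tight system of disjoint paths: no disjoint walks with the same
ends are at most as long throughout and shorter somewhere (`IsTight`). The algorithm grows all paths
from their sources. It remembers only a window of constant length on each path, the positions of the
windows, and a list of at most `k²d` exceptional vertices. Such a configuration is a number with a
constant number of digits in base `n + 1`, so there are polynomially many of them.

The difficulty is to know which vertices the forgotten parts of the paths have used. In a tight
system every stretch of `d` consecutive vertices is a minimal path, so by dominance every vertex
lies in it or is joined to it (`IsTight.window`). Since forward jumps are impossible, a vertex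
before a window of its own path is adjacent from it, and a vertex well after it is not. Adjacency
from two blocks at the front of a window (`LeftOf`) thus separates past from future on one path. A
vertex in the future of another path may also be left of a window. These vertices are the
exceptions, and `Admissible` confines them to few positions for each pair of paths.

The heart is `IsTight.exists_advance`: from admissible positions, some unfinished window can advance
and leave the positions admissible. Otherwise each unfinished path `i` sends two edges far ahead on
some path `f i`. By `IsTight.not_cross`, edges in the opposite direction cannot occur in two
successive places, so some late zone of `f i` sends no edge to some early zone of `i`. Dominance
then supplies many edges from the early zone to the late one. Following these around a cycle of `f`
shortens all paths of the cycle at once, through the parts that they give up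
(`IsTight.no_cyclic_zones`), against tightness.

Soundness of the search needs neither tightness nor dominance. A move demands that the new vertex is
neither in a window nor past, that the dropped vertex becomes past, and that no vertex ceases to be
past. Hence each reached configuration carries disjoint walks (`IsMove.isSound`), and a final one
yields a tuple that lies above some quality (`IsSound.exists_quality`). Completeness: the windows of
the tight system of a key quality trace a run of at most `n` moves
(`Instance.IsKeyQuality.exists_reach`). So the minimal tuples found are exactly the key qualities
(`Instance.bijOn_minimals`).

The running time comes from `n` rounds, over all configurations, all choices of a new vertex and a
guessed new exception list, and a check over all vertices; `exponent_le` compares the exponents. -/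

namespace DisjointPaths

/-! ### Walks and stretches of vertex sequences. -/

section Walks

variable {V : Type*} {G : Digraph V}

/-- A walk from `u` to `v`, given by its sequence of vertices. -/
def IsWalk (G : Digraph V) (l : List V) (u v : V) : Prop :=
  l.IsChain G.Adj ∧ l.head? = some u ∧ l.getLast? = some v

theorem IsWalk.ne_nil {l : List V} {u v : V} (h : IsWalk G l u v) : l ≠ [] := by
  rintro rfl
  simpa using h.2.1

theorem IsWalk.singleton (u : V) : IsWalk G [u] u u := by simp [IsWalk]

theorem IsWalk.append {l l' : List V} {u v u' v' : V} (h : IsWalk G l u v)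
    (h' : IsWalk G l' u' v') (e : G.Adj v u') : IsWalk G (l ++ l') u v' := by
  obtain ⟨h1, h2, h3⟩ := h
  obtain ⟨h1', h2', h3'⟩ := h'
  refine ⟨List.isChain_append.2 ⟨h1, h1', ?_⟩, by simp [h2], by simp [h3']⟩
  intro x hx y hy
  rw [h3] at hx
  rw [h2'] at hy
  simp only [Option.mem_def, Option.some.injEq] at hx hy
  subst hx hy
  exact e

/-- A walk contains a path with the same ends. -/
theorem IsWalk.exists_path {l : List V} {u v : V} (h : IsWalk G l u v) :
    ∃ q, IsPathFromTo G q u v ∧ q ⊆ l ∧ q.length ≤ l.length := by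
  induction hn : l.length using Nat.strong_induction_on generalizing l u with
  | _ n ih =>
    subst hn
    obtain ⟨hc, hh, hl⟩ := h
    cases l with
    | nil => simp at hh
    | cons a l =>
      simp only [List.head?_cons, Option.some.injEq] at hh
      subst hh
      -- If the walk returns to its first vertex, the closed part is cut out; otherwise a path taken
      -- from the tail cannot meet that vertex.
      by_cases ha : a ∈ l
      · obtain ⟨l₁, l₂, rfl⟩ := List.append_of_mem ha
        have hw : IsWalk G (a :: l₂) a v := by
          refine ⟨?_, rfl, ?_⟩
          · have : (([a] ++ l₁) ++ a :: l₂).IsChain G.Adj := by simpa using hc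
            exact (List.isChain_append.1 this).2.1
          · rw [← hl, show a :: (l₁ ++ a :: l₂) = (a :: l₁) ++ (a :: l₂) by simp,
              List.getLast?_append_of_ne_nil _ (by simp)]
        obtain ⟨q, hq, hs, hlen⟩ := ih _ (by simp) hw rfl
        refine ⟨q, hq, fun x hx => ?_, by simp at hlen ⊢; omega⟩
        have := hs hx
        simp only [List.mem_cons, List.mem_append] at this ⊢
        tauto
      · cases l with
        | nil =>
          refine ⟨[a], ⟨⟨by simp, by simp, by simp⟩, rfl, hl⟩, by simp, by simp⟩
        | cons b l =>
          have hc' := List.isChain_cons_cons.1 hc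
          obtain ⟨q, ⟨⟨hq1, hq2, hq3⟩, hq4, hq5⟩, hs, hlen⟩ :=
            ih (b :: l).length (by simp) (l := b :: l) (u := b)
              ⟨hc'.2, rfl, by simpa using hl⟩ rfl
          have hw : IsWalk G ([a] ++ q) a v := (IsWalk.singleton a).append ⟨hq3, hq4, hq5⟩ hc'.1
          refine ⟨[a] ++ q, ⟨⟨by simp, ?_, hw.1⟩, hw.2.1, hw.2.2⟩, ?_, by simp at hlen ⊢; omega⟩
          · simp only [List.cons_append, List.nil_append, List.nodup_cons]
            exact ⟨fun hx => ha (hs hx), hq2⟩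
          · intro x hx
            simp only [List.cons_append, List.nil_append, List.mem_cons] at hx ⊢
            rcases hx with hx | hx
            · exact Or.inl hx
            · right
              simpa using hs hx

/-- Replacing the middle part of a walk. -/
theorem isWalk_splice {l₁ l₂ mid : List V} {s t u v : V} (h₁ : IsWalk G l₁ s u)
    (hm : (u :: (mid ++ [v])).IsChain G.Adj) (h₂ : IsWalk G l₂ v t) :
    IsWalk G (l₁ ++ (mid ++ l₂)) s t := by
  obtain ⟨c₁, a₁, b₁⟩ := h₁
  obtain ⟨c₂, a₂, b₂⟩ := h₂
  obtain ⟨l₁, rfl⟩ : ∃ l, l₁ = l ++ [u] := List.getLast?_eq_some_iff.1 b₁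
  obtain ⟨l₂, rfl⟩ : ∃ l, l₂ = v :: l := List.head?_eq_some_iff.1 a₂
  refine ⟨?_, by rw [List.head?_append, a₁]; rfl, ?_⟩
  · rw [List.append_assoc, List.singleton_append, List.isChain_split]
    refine ⟨c₁, ?_⟩
    rw [← List.cons_append, List.isChain_split]
    exact ⟨hm, c₂⟩
  · rw [List.getLast?_append_of_ne_nil _ (by simp), List.getLast?_append_of_ne_nil _ (by simp), b₂]

/-- The vertices at the positions `a, …, b` of a sequence. -/
def seg (p : ℕ → V) (a b : ℕ) : List V := (List.range' a (b + 1 - a)).map p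

theorem mem_seg {p : ℕ → V} {a b : ℕ} {v : V} :
    v ∈ seg p a b ↔ ∃ x, a ≤ x ∧ x ≤ b ∧ p x = v := by
  simp only [seg, List.mem_map, List.mem_range'_1]
  constructor
  · rintro ⟨x, hx, rfl⟩
    exact ⟨x, by omega, by omega, rfl⟩
  · rintro ⟨x, hx, hy, rfl⟩
    exact ⟨x, by omega, rfl⟩

@[simp] theorem length_seg {p : ℕ → V} {a b : ℕ} : (seg p a b).length = b + 1 - a := by
  simp [seg]

theorem isWalk_seg {p : ℕ → V} {a b : ℕ} (hab : a ≤ b)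
    (h : ∀ x, a ≤ x → x < b → G.Adj (p x) (p (x + 1))) : IsWalk G (seg p a b) (p a) (p b) := by
  induction b, hab using Nat.le_induction with
  | base => simp [seg, IsWalk]
  | succ b hab ih =>
    have e : seg p a (b + 1) = seg p a b ++ [p (b + 1)] := by
      unfold seg
      rw [show b + 1 + 1 - a = (b + 1 - a) + 1 by omega, List.range'_concat]
      simp only [List.map_append, List.map_cons, List.map_nil]
      congr 3
      omega
    rw [e]
    exact (ih fun x h1 h2 => h x h1 (by omega)).append (IsWalk.singleton _) (h b hab (by omega))

end Walks

/-! ### Tight systems of disjoint paths. -/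

section Tight

variable {V : Type*} {G : Digraph V} {k : ℕ} {len : Fin k → ℕ} {p : Fin k → ℕ → V}

/-- Disjoint paths, the `i`-th one through `p i 1, …, p i (len i)`, such that no disjoint walks
with the same ends are shorter. -/
structure IsTight (G : Digraph V) (len : Fin k → ℕ) (p : Fin k → ℕ → V) : Prop where
  pos : ∀ i, 1 ≤ len i
  adj : ∀ i x, 1 ≤ x → x < len i → G.Adj (p i x) (p i (x + 1))
  inj : ∀ i j x y, 1 ≤ x → x ≤ len i → 1 ≤ y → y ≤ len j → p i x = p j y → i = j ∧ x = y
  tight : ∀ Q : Fin k → List V, (∀ i, IsWalk G (Q i) (p i 1) (p i (len i))) →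
    (∀ i j, i ≠ j → ∀ v, v ∈ Q i → v ∉ Q j) → (∀ i, (Q i).length ≤ len i) →
    ∀ i, (Q i).length = len i

open Classical in
/-- The paths of a tight system cannot be shortened simultaneously by detours `mid i` through
vertices which are off the paths or in the parts that are left out. -/
theorem IsTight.no_detours (h : IsTight G len p) (R : Fin k → Prop) (hR : ∃ i, R i)
    (x y : Fin k → ℕ) (mid : Fin k → List V) (hx : ∀ i, R i → 1 ≤ x i)
    (hy : ∀ i, R i → y i ≤ len i) (hlen : ∀ i, R i → (mid i).length + 1 + x i < y i)
    (hc : ∀ i, R i → (p i (x i) :: (mid i ++ [p i (y i)])).IsChain G.Adj)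
    (hmem : ∀ i, R i → ∀ v ∈ mid i, (∀ j z, 1 ≤ z → z ≤ len j → v ≠ p j z) ∨
      ∃ j z, R j ∧ x j < z ∧ z < y j ∧ v = p j z)
    (hdisj : ∀ i j, R i → R j → i ≠ j → ∀ v ∈ mid i, v ∉ mid j) : False := by
  obtain ⟨i₀, hi₀⟩ := hR
  -- Each path in `R` has its middle replaced by the detour and the others stay. These walks are
  -- what `tight` forbids, once they are seen to be disjoint.
  let Q : Fin k → List V := fun i =>
    if R i then seg (p i) 1 (x i) ++ (mid i ++ seg (p i) (y i) (len i)) else seg (p i) 1 (len i)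
  have hQ : ∀ i v, v ∈ Q i → (∃ z, 1 ≤ z ∧ z ≤ len i ∧ v = p i z ∧ (R i → z ≤ x i ∨ y i ≤ z)) ∨
      (R i ∧ v ∈ mid i) := by
    intro i v hv
    by_cases hRi : R i
    · have hl := hlen i hRi
      have hy' := hy i hRi
      simp only [Q, if_pos hRi, List.mem_append, mem_seg] at hv
      rcases hv with ⟨z, h1, h2, rfl⟩ | hv | ⟨z, h1, h2, rfl⟩
      · exact Or.inl ⟨z, h1, by omega, rfl, fun _ => Or.inl h2⟩
      · exact Or.inr ⟨hRi, hv⟩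
      · exact Or.inl ⟨z, by omega, by omega, rfl, fun _ => Or.inr h1⟩
    · simp only [Q, if_neg hRi, mem_seg] at hv
      obtain ⟨z, h1, h2, rfl⟩ := hv
      exact Or.inl ⟨z, h1, h2, rfl, fun hR => absurd hR hRi⟩
  -- A detour vertex on a path lies strictly inside a part that is given up, so it misses everything
  -- that is kept.
  have key : ∀ i j v, (∃ z, 1 ≤ z ∧ z ≤ len i ∧ v = p i z ∧ (R i → z ≤ x i ∨ y i ≤ z)) →
      R j → v ∈ mid j → False := by
    rintro i j v ⟨z, h1, h2, rfl, h3⟩ hRj hv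
    rcases hmem j hRj _ hv with h4 | ⟨j', z', hR', h4, h5, h6⟩
    · exact h4 i z h1 h2 rfl
    · have := hy j' hR'
      obtain ⟨rfl, rfl⟩ := h.inj _ _ _ _ h1 h2 (by omega) (by omega) h6
      rcases h3 hR' with h7 | h7 <;> omega
  have hfin := h.tight Q ?_ ?_ ?_ i₀
  · have := hlen i₀ hi₀
    have := hy i₀ hi₀
    simp only [Q, if_pos hi₀, List.length_append, length_seg] at hfin
    omega
  · intro i
    by_cases hRi : R i
    · have hl := hlen i hRi
      have hx' := hx i hRi
      have hy' := hy i hRi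
      simp only [Q, if_pos hRi]
      exact isWalk_splice (isWalk_seg hx' fun z h1 h2 => h.adj i z h1 (by omega)) (hc i hRi)
        (isWalk_seg hy' fun z h1 h2 => h.adj i z (by omega) (by omega))
    · simp only [Q, if_neg hRi]
      exact isWalk_seg (h.pos i) fun z h1 h2 => h.adj i z h1 (by omega)
  · intro i j hij v hvi hvj
    rcases hQ i v hvi with hi | ⟨hRi, hi⟩ <;> rcases hQ j v hvj with hj | ⟨hRj, hj⟩
    · obtain ⟨z, h1, h2, rfl, -⟩ := hi
      obtain ⟨z', h1', h2', h3', -⟩ := hj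
      exact hij (h.inj _ _ _ _ h1 h2 h1' h2' h3').1
    · exact key _ _ _ hi hRj hj
    · exact key _ _ _ hj hRi hi
    · exact hdisj i j hRi hRj hij v hi hj
  · intro i
    by_cases hRi : R i
    · have hl := hlen i hRi
      have hy' := hy i hRi
      simp only [Q, if_pos hRi, List.length_append, length_seg]
      omega
    · simp [Q, if_neg hRi]

/-- Each path of a tight system is minimal. -/
theorem IsTight.not_adj (h : IsTight G len p) {i : Fin k} {x y : ℕ} (hx : 1 ≤ x)
    (hxy : x + 2 ≤ y) (hy : y ≤ len i) : ¬ G.Adj (p i x) (p i y) := by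
  intro e
  refine h.no_detours (· = i) ⟨i, rfl⟩ (fun _ => x) (fun _ => y) (fun _ => []) ?_ ?_ ?_ ?_ ?_ ?_
  · exact fun _ _ => hx
  · rintro _ rfl
    exact hy
  · intro _ _
    simp
    omega
  · rintro _ rfl
    simpa using e
  · simp
  · simp

/-- A vertex off the paths of a tight system does not jump forward on one of them. -/
theorem IsTight.not_jump (h : IsTight G len p) {i : Fin k} {x y : ℕ} (hx : 1 ≤ x)
    (hxy : x + 3 ≤ y) (hy : y ≤ len i) {v : V} (hv : ∀ j z, 1 ≤ z → z ≤ len j → v ≠ p j z)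
    (e : G.Adj (p i x) v) : ¬ G.Adj v (p i y) := by
  intro e'
  -- The single vertex `v` would replace at least two vertices; this is where a jump of `3` is
  -- needed.
  refine h.no_detours (· = i) ⟨i, rfl⟩ (fun _ => x) (fun _ => y) (fun _ => [v]) ?_ ?_ ?_ ?_ ?_ ?_
  · exact fun _ _ => hx
  · rintro _ rfl
    exact hy
  · intro _ _
    simp
    omega
  · rintro _ rfl
    simpa using ⟨e, e'⟩
  · intro _ _ w hw
    simp only [List.mem_singleton] at hw
    subst hw
    exact Or.inl hv
  · rintro _ _ rfl rfl hij
    exact absurd rfl hij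

variable {d : ℕ}

/-- Each vertex is in, or is adjacent to, or is adjacent from, each window of `d` consecutive
vertices of a path of a tight system. -/
theorem IsTight.window (h : IsTight G len p) (hd : IsPathDominant G d) (hd1 : 1 ≤ d) {i : Fin k}
    {a : ℕ} (ha : 1 ≤ a) (hal : a + d ≤ len i + 1) (v : V) :
    (∃ x, a ≤ x ∧ x < a + d ∧ v = p i x) ∨ (∃ x, a ≤ x ∧ x < a + d ∧ G.Adj v (p i x)) ∨
      ∃ x, a ≤ x ∧ x < a + d ∧ G.Adj (p i x) v := by
  have hw : IsWalk G (seg (p i) a (a + d - 1)) (p i a) (p i (a + d - 1)) :=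
    isWalk_seg (by omega) fun x h1 h2 => h.adj i x (by omega) (by omega)
  have hget : ∀ (m : ℕ) (hm : m < (seg (p i) a (a + d - 1)).length),
      (seg (p i) a (a + d - 1))[m] = p i (a + m) := by
    intro m hm
    simp [seg]
  -- By `IsTight.not_adj` any stretch of a tight path is minimal, so dominance applies to it.
  have hmin : IsMinimalPath G (seg (p i) a (a + d - 1)) := by
    refine ⟨⟨hw.ne_nil, ?_, hw.1⟩, ?_⟩
    · unfold seg
      rw [List.nodup_map_iff_inj_on List.nodup_range']
      intro x hx y hy hxy
      simp only [List.mem_range'_1] at hx hy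
      exact (h.inj _ _ _ _ (by omega) (by omega) (by omega) (by omega) hxy).2
    · rintro ⟨m, hm⟩ ⟨m', hm'⟩ e
      simp only [List.get_eq_getElem, hget] at e
      simp only [length_seg] at hm hm'
      by_contra hlt
      simp only at hlt
      exact h.not_adj (by omega) (by omega) (by omega) e
  rcases hd _ hmin (by simp; omega) v with hv | ⟨u, hu, e⟩ | ⟨u, hu, e⟩
  · obtain ⟨x, h1, h2, rfl⟩ := mem_seg.1 hv
    exact Or.inl ⟨x, h1, by omega, rfl⟩
  · obtain ⟨x, h1, h2, rfl⟩ := mem_seg.1 hu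
    exact Or.inr (Or.inl ⟨x, h1, by omega, e⟩)
  · obtain ⟨x, h1, h2, rfl⟩ := mem_seg.1 hu
    exact Or.inr (Or.inr ⟨x, h1, by omega, e⟩)

/-- A vertex of a path of a tight system is adjacent to each earlier window of its path. -/
theorem IsTight.adj_window (h : IsTight G len p) (hd : IsPathDominant G d) (hd1 : 1 ≤ d)
    {i : Fin k} {a y : ℕ} (ha : 1 ≤ a) (hay : a + d + 1 ≤ y) (hy : y ≤ len i) :
    ∃ x, a ≤ x ∧ x < a + d ∧ G.Adj (p i y) (p i x) := by
  rcases h.window hd hd1 (i := i) ha (by omega) (p i y) with ⟨x, h1, h2, e⟩ | ⟨x, h1, h2, e⟩ | ⟨x, h1, h2, e⟩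
  · have := (h.inj _ _ _ _ (by omega) (by omega) (by omega) (by omega) e).2
    omega
  · exact ⟨x, h1, h2, e⟩
  · exact absurd e (h.not_adj (i := i) (by omega) (by omega) hy)

/-- A vertex of a path of a tight system is adjacent from each later window of its path. -/
theorem IsTight.window_adj (h : IsTight G len p) (hd : IsPathDominant G d) (hd1 : 1 ≤ d)
    {i : Fin k} {a y : ℕ} (hy : 1 ≤ y) (hya : y + 2 ≤ a) (ha : a + d ≤ len i + 1) :
    ∃ x, a ≤ x ∧ x < a + d ∧ G.Adj (p i x) (p i y) := by
  rcases h.window hd hd1 (by omega) ha (p i y) with ⟨x, h1, h2, e⟩ | ⟨x, h1, h2, e⟩ | ⟨x, h1, h2, e⟩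
  · have := (h.inj _ _ _ _ (by omega) (by omega) (by omega) (by omega) e).2
    omega
  · exact absurd e (h.not_adj (i := i) (by omega) (by omega) (by omega))
  · exact ⟨x, h1, h2, e⟩

/-- Two paths of a tight system do not cross in both directions at the same place. -/
theorem IsTight.not_cross (h : IsTight G len p) (hd : IsPathDominant G d) (hd1 : 1 ≤ d)
    {i l : Fin k} (hil : i ≠ l) {w₁ w₂ z₁ z₂ j₁ j₂ v₁ v₂ : ℕ} (hw₁ : 1 ≤ w₁) (hw : w₁ < w₂)
    (hwz : w₂ + 2 ≤ z₁) (hz : z₁ + d ≤ z₂) (hz₂ : z₂ ≤ len i) (hj₁ : 1 ≤ j₁) (hj : j₁ < j₂)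
    (hjv : j₂ + 2 ≤ v₁) (hv : v₁ + d ≤ v₂) (hv₂ : v₂ ≤ len l)
    (e₁ : G.Adj (p i w₁) (p l v₁)) (e₂ : G.Adj (p i w₂) (p l v₂))
    (f₁ : G.Adj (p l j₁) (p i z₁)) (f₂ : G.Adj (p l j₂) (p i z₂)) : False := by
  -- Each path has backward edges: some vertex `y` soon after `v₁` leads back to `j₂`, and some `u`
  -- soon after `z₁` leads back to `w₂`.
  obtain ⟨y, hy1, hy2, ey⟩ := h.window_adj hd hd1 (i := l) (a := v₁) (y := j₂) (by omega) hjv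
    (by omega)
  obtain ⟨u, hu1, hu2, eu⟩ := h.window_adj hd hd1 (i := i) (a := z₁) (y := w₂) (by omega) hwz
    (by omega)
  have chain : ∀ (a b : V) (m : Fin k) (s t q : ℕ), s ≤ t → 1 ≤ s → t ≤ len m →
      G.Adj a (p m s) → G.Adj (p m t) (p m q) → G.Adj (p m q) b →
      (a :: (seg (p m) s t ++ [p m q] ++ [b])).IsChain G.Adj := by
    intro a b m s t q hst hs ht ea eq eb
    have h1 : IsWalk G (seg (p m) s t) (p m s) (p m t) :=
      isWalk_seg hst fun x h1 h2 => h.adj m x (by omega) (by omega)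
    have h2 := (h1.append (IsWalk.singleton (p m q)) eq).append (IsWalk.singleton b) eb
    exact ((IsWalk.singleton a).append h2 ea).1
  have hmem : ∀ (m : Fin k) (s t q : ℕ) (v : V), v ∈ seg (p m) s t ++ [p m q] →
      ∃ z, (s ≤ z ∧ z ≤ t ∨ z = q) ∧ v = p m z := by
    intro m s t q v hv
    rcases List.mem_append.1 hv with hv | hv
    · obtain ⟨z, h1, h2, rfl⟩ := mem_seg.1 hv
      exact ⟨z, Or.inl ⟨h1, h2⟩, rfl⟩
    · exact ⟨q, Or.inr rfl, List.mem_singleton.1 hv⟩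
  have hdis : ∀ v, v ∈ seg (p l) v₁ y ++ [p l j₂] → v ∈ seg (p i) z₁ u ++ [p i w₂] → False := by
    intro v h1 h2
    obtain ⟨z, hz, rfl⟩ := hmem _ _ _ _ _ h1
    obtain ⟨z', hz', e⟩ := hmem _ _ _ _ _ h2
    exact hil (h.inj _ _ _ _ (by omega) (by omega) (by omega) (by omega) e).1.symm
  have hli : l ≠ i := hil.symm
  -- The two paths exchange their middles: `i` uses `w₁ → v₁ … y → j₂ → z₂`, and `l` uses `j₁ → z₁ …
  -- u → w₂ → v₂`. Each detour has at most `d + 1` inner vertices and replaces at least `d + 2`.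
  refine h.no_detours (fun m => m = i ∨ m = l) ⟨i, Or.inl rfl⟩
    (fun m => if m = i then w₁ else j₁) (fun m => if m = i then z₂ else v₂)
    (fun m => if m = i then seg (p l) v₁ y ++ [p l j₂] else seg (p i) z₁ u ++ [p i w₂])
    ?_ ?_ ?_ ?_ ?_ ?_
  · rintro m (rfl | rfl) <;> simp [hli] <;> omega
  · rintro m (rfl | rfl) <;> simp [hli] <;> omega
  · rintro m (rfl | rfl) <;> simp [hli] <;> omega
  · rintro m (rfl | rfl)
    · simp only [if_true]
      exact chain _ _ _ _ _ _ hy1 (by omega) (by omega) e₁ ey f₂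
    · simp only [if_neg hli]
      exact chain _ _ _ _ _ _ hu1 (by omega) (by omega) f₁ eu e₂
  · rintro m (rfl | rfl) v hv
    · simp only [if_true] at hv
      obtain ⟨z, hz, rfl⟩ := hmem _ _ _ _ _ hv
      refine Or.inr ⟨l, z, Or.inr rfl, ?_, ?_, rfl⟩ <;> simp [hli] <;> omega
    · simp only [if_neg hli] at hv
      obtain ⟨z, hz, rfl⟩ := hmem _ _ _ _ _ hv
      refine Or.inr ⟨i, z, Or.inl rfl, ?_, ?_, rfl⟩ <;> simp <;> omega
  · rintro m m' (rfl | rfl) (rfl | rfl) hmm v h1 h2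
    · exact hmm rfl
    · simp only [if_true, if_neg hli] at h1 h2
      exact hdis v h1 h2
    · simp only [if_true, if_neg hli] at h1 h2
      exact hdis v h2 h1
    · exact hmm rfl

end Tight

end DisjointPaths

namespace DisjointPaths

/-! ### Some window can always advance. -/

section Deadlock

variable {V : Type*} {G : Digraph V} {k : ℕ} {len : Fin k → ℕ} {p : Fin k → ℕ → V} {d : ℕ}

open Function in
/-- There is no function `f` on a nonempty set of paths such that from each path `i` of the set
one can get from a zone of path `i` to a later zone of path `f i`. -/
theorem IsTight.no_cyclic_zones (h : IsTight G len p) (hd : IsPathDominant G d) (hd1 : 1 ≤ d)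
    (S : Fin k → Prop) (hS : ∃ i, S i) (f : Fin k → Fin k) (hf : ∀ i, S i → S (f i))
    (ζ η : Fin k → ℕ) (hζ : ∀ i, S i → 1 ≤ ζ i)
    (hζη : ∀ i, S i → ζ (f i) + k * d + 1 ≤ η i) (hη : ∀ i, S i → η i + k * d ≤ len (f i) + 1)
    (hE : ∀ i, S i → ∀ z, ζ i ≤ z → z < ζ i + k * d → ∀ w, η i ≤ w → w + d ≤ η i + k * d →
      ∃ y, w ≤ y ∧ y < w + d ∧ G.Adj (p i z) (p (f i) y)) : False := by
  have hwin : ∀ m, m < k → m * d + d ≤ k * d := fun m hm => by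
    calc m * d + d = (m + 1) * d := by ring
      _ ≤ k * d := Nat.mul_le_mul_right d hm
  -- The early zone of `i` starts at `ζ i`, the late zone of `f i` at `η i`, and each consists of
  -- `k` blocks of length `d`. `hop` leads from the early zone of `i` to a prescribed late block of
  -- `f i`, and `back` from the late zone to a prescribed early block of the same path. The value
  -- `0` only makes the choices total.
  have hop : ∀ i z m, ∃ y, S i → ζ i ≤ z → z < ζ i + k * d → m < k →
      η i + m * d ≤ y ∧ y < η i + m * d + d ∧ G.Adj (p i z) (p (f i) y) := by
    intro i z m
    by_cases hc : S i ∧ ζ i ≤ z ∧ z < ζ i + k * d ∧ m < k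
    · obtain ⟨h1, h2, h3, h4⟩ := hc
      obtain ⟨y, hy⟩ := hE i h1 z h2 h3 (η i + m * d) (by omega) (by have := hwin m h4; omega)
      exact ⟨y, fun _ _ _ _ => hy⟩
    · exact ⟨0, fun h1 h2 h3 h4 => absurd ⟨h1, h2, h3, h4⟩ hc⟩
  have back : ∀ i y m, ∃ z, S i → η i ≤ y → y < η i + k * d → m < k →
      ζ (f i) + m * d ≤ z ∧ z < ζ (f i) + m * d + d ∧ G.Adj (p (f i) y) (p (f i) z) := by
    intro i y m
    by_cases hc : S i ∧ η i ≤ y ∧ y < η i + k * d ∧ m < k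
    · obtain ⟨h1, h2, h3, h4⟩ := hc
      have a1 := hwin m h4
      have a2 := hζη i h1
      have a3 := hη i h1
      have a4 := hζ _ (hf i h1)
      obtain ⟨z, hz⟩ := h.adj_window hd hd1 (i := f i) (a := ζ (f i) + m * d) (y := y) (by omega)
        (by omega) (by omega)
      exact ⟨z, fun _ _ _ _ => hz⟩
    · exact ⟨0, fun h1 h2 h3 h4 => absurd ⟨h1, h2, h3, h4⟩ hc⟩
  choose Y hY using hop
  choose Z hZ using back
  -- The walk from `i` visits `i, f i, f² i, …` and uses block `m` of the zones at step `m`. This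
  -- staggering keeps walks from different starting paths apart.
  let zs : Fin k → ℕ → ℕ := fun i m =>
    Nat.rec (ζ i) (fun m z => Z (f^[m] i) (Y (f^[m] i) z m) (m + 1)) m
  let ys : Fin k → ℕ → ℕ := fun i m => Y (f^[m] i) (zs i m) m
  have hSit : ∀ m i, S i → S (f^[m] i) := by
    intro m
    induction m with
    | zero => exact fun i hi => hi
    | succ m ih => exact fun i hi => ih _ (hf i hi)
  have hzs : ∀ i, S i → ∀ m, m < k → ζ (f^[m] i) + m * d ≤ zs i m ∧
      zs i m < ζ (f^[m] i) + m * d + d ∧ η (f^[m] i) + m * d ≤ ys i m ∧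
      ys i m < η (f^[m] i) + m * d + d ∧ G.Adj (p (f^[m] i) (zs i m)) (p (f^[m + 1] i) (ys i m)) ∧
      (m + 1 < k → G.Adj (p (f^[m + 1] i) (ys i m)) (p (f^[m + 1] i) (zs i (m + 1)))) := by
    intro i hi m hm
    have hz : ζ (f^[m] i) + m * d ≤ zs i m ∧ zs i m < ζ (f^[m] i) + m * d + d := by
      induction m with
      | zero => exact ⟨by simp [zs], by simp [zs]; omega⟩
      | succ m ih =>
        obtain ⟨h1, h2⟩ := ih (by omega)
        have hw := hwin m (by omega)
        have hy := hY (f^[m] i) (zs i m) m (hSit m i hi) (by omega) (by omega) (by omega)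
        have hz := hZ (f^[m] i) (ys i m) (m + 1) (hSit m i hi) (by grind) (by grind) hm
        rw [iterate_succ_apply']
        exact ⟨hz.1, hz.2.1⟩
    have hw := hwin m hm
    have hy := hY (f^[m] i) (zs i m) m (hSit m i hi) (by omega) (by omega) hm
    refine ⟨hz.1, hz.2, hy.1, hy.2.1, ?_, fun hm' => ?_⟩
    · rw [iterate_succ_apply']
      exact hy.2.2
    · have hz := hZ (f^[m] i) (ys i m) (m + 1) (hSit m i hi) (by grind) (by grind) hm'
      rw [iterate_succ_apply']
      exact hz.2.2
  let L : Fin k → ℕ → List V := fun i m =>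
    Nat.rec [] (fun m l => l ++ [p (f^[m + 1] i) (ys i m), p (f^[m + 1] i) (zs i (m + 1))]) m
  have hLs : ∀ i m, L i (m + 1) =
      L i m ++ [p (f^[m + 1] i) (ys i m), p (f^[m + 1] i) (zs i (m + 1))] := fun i m => rfl
  have hLlen : ∀ i m, (L i m).length = 2 * m := by
    intro i m
    induction m with
    | zero => rfl
    | succ m ih =>
      rw [hLs, List.length_append, ih]
      simp
      ring
  have hLmem : ∀ i m v, v ∈ L i m → ∃ q, q < m ∧ (v = p (f^[q + 1] i) (ys i q) ∨
      v = p (f^[q + 1] i) (zs i (q + 1))) := by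
    intro i m v hv
    induction m with
    | zero => exact absurd hv List.not_mem_nil
    | succ m ih =>
      rw [hLs, List.mem_append] at hv
      rcases hv with hv | hv
      · obtain ⟨q, hq, e⟩ := ih hv
        exact ⟨q, by omega, e⟩
      · exact ⟨m, by omega, by simpa using hv⟩
  have hLw : ∀ i, S i → ∀ m, m < k →
      IsWalk G (p i (ζ i) :: L i m) (p i (ζ i)) (p (f^[m] i) (zs i m)) := by
    intro i hi m hm
    induction m with
    | zero => exact IsWalk.singleton _
    | succ m ih =>
      obtain ⟨-, -, -, -, e1, e2⟩ := hzs i hi m (by omega)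
      have := (ih (by omega)).append ((IsWalk.singleton (p (f^[m + 1] i) (ys i m))).append
        (IsWalk.singleton (p (f^[m + 1] i) (zs i (m + 1)))) (e2 hm)) e1
      simpa [hLs] using this
  -- the paths on the cycles of `f`
  have hper : ∃ i, S i ∧ i ∈ periodicPts f := by
    obtain ⟨i, hi⟩ := hS
    obtain ⟨a, b, hab, e⟩ := Finite.exists_ne_map_eq_of_infinite (fun m : ℕ => f^[m] i)
    wlog hlt : a < b generalizing a b
    · exact this b a hab.symm e.symm (by omega)
    refine ⟨f^[a] i, hSit a i hi, mk_mem_periodicPts (n := b - a) (by omega) ?_⟩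
    rw [IsPeriodicPt, IsFixedPt, ← iterate_add_apply, Nat.sub_add_cancel hlt.le, e]
  -- On the cycles `f` is injective, so each path has one predecessor there and hence one relevant
  -- late zone.
  have hinj : ∀ i j, i ∈ periodicPts f → j ∈ periodicPts f → f i = f j → i = j :=
    fun i j hi hj e => (bijOn_periodicPts f).injOn hi hj e
  have hmap : ∀ m i, i ∈ periodicPts f → f^[m] i ∈ periodicPts f := by
    intro m
    induction m with
    | zero => exact fun i hi => hi
    | succ m ih => exact fun i hi => ih _ ((bijOn_periodicPts f).mapsTo hi)
  have hinjit : ∀ m i j, i ∈ periodicPts f → j ∈ periodicPts f → f^[m] i = f^[m] j → i = j := by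
    intro m
    induction m with
    | zero => exact fun i j _ _ e => e
    | succ m ih =>
      exact fun i j hi hj e => hinj _ _ hi hj (ih _ _ (hmap 1 i hi) (hmap 1 j hj) e)
  let r : Fin k → ℕ := minimalPeriod f
  have hr1 : ∀ i, i ∈ periodicPts f → 1 ≤ r i := fun i hi => minimalPeriod_pos_of_mem_periodicPts hi
  have hrk : ∀ i, r i ≤ k := fun i => by
    simpa using minimalPeriod_le_card (f := f) (x := i)
  have hpred : ∀ i, i ∈ periodicPts f → f (f^[r i - 1] i) = i := by
    intro i hi
    rw [← iterate_succ_apply' f, Nat.succ_eq_add_one, Nat.sub_add_cancel (hr1 i hi)]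
    exact isPeriodicPt_minimalPeriod f i
  have hdpos : ∀ a b : ℕ, a < b → a * d + d ≤ b * d := fun a b hab => by
    calc a * d + d = (a + 1) * d := by ring
      _ ≤ b * d := Nat.mul_le_mul_right d hab
  have hsep : ∀ m m' b a : ℕ, b + m * d ≤ a → a < b + m * d + d → b + m' * d ≤ a →
      a < b + m' * d + d → m = m' := by
    intro m m' b a h1 h2 h3 h4
    rcases Nat.lt_trichotomy m m' with hlt | heq | hlt
    · have := hdpos _ _ hlt
      omega
    · exact heq
    · have := hdpos _ _ hlt
      omega
  have hend : ∀ i, S i → i ∈ periodicPts f → ζ i + k * d + 1 ≤ η (f^[r i - 1] i) ∧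
      η (f^[r i - 1] i) + k * d ≤ len i + 1 ∧ η (f^[r i - 1] i) + (r i - 1) * d ≤ ys i (r i - 1) ∧
      ys i (r i - 1) < η (f^[r i - 1] i) + (r i - 1) * d + d := by
    intro i hi hip
    have h1 := hζη _ (hSit (r i - 1) i hi)
    have h2 := hη _ (hSit (r i - 1) i hi)
    have h3 := hzs i hi (r i - 1) (by have := hr1 i hip; have := hrk i; omega)
    rw [hpred i hip] at h1 h2
    exact ⟨h1, h2, h3.2.2.1, h3.2.2.2.1⟩
  have hpos : ∀ i, S i → i ∈ periodicPts f → ∀ q, q < r i - 1 → S (f^[q + 1] i) ∧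
      f^[q + 1] i ∈ periodicPts f ∧ f^[r i - 1] (f^[q + 1] i) = f^[q] i ∧ r (f^[q + 1] i) = r i := by
    intro i hi hip q hq
    have hr : r (f^[q + 1] i) = r i := minimalPeriod_apply_iterate hip _
    have hp := hmap (q + 1) i hip
    refine ⟨hSit _ i hi, hp, hinj _ _ (hmap _ _ hp) (hmap _ _ hip) ?_, hr⟩
    have := hpred _ hp
    rw [hr] at this
    rw [this, iterate_succ_apply' f]
  have hq : ∀ i, S i → i ∈ periodicPts f → ∀ q, q < r i - 1 →
      η (f^[q] i) + q * d ≤ ys i q ∧ ys i q < η (f^[q] i) + q * d + d ∧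
      ζ (f^[q + 1] i) + (q + 1) * d ≤ zs i (q + 1) ∧
      zs i (q + 1) < ζ (f^[q + 1] i) + (q + 1) * d + d ∧
      ζ (f^[q + 1] i) + k * d + 1 ≤ η (f^[q] i) ∧ η (f^[q] i) + k * d ≤ len (f^[q + 1] i) + 1 ∧
      1 ≤ ζ (f^[q + 1] i) ∧ q * d + d ≤ (r i - 1) * d ∧ (r i - 1) * d + d ≤ k * d ∧
      d ≤ (q + 1) * d ∧ (q + 1) * d ≤ (r i - 1) * d := by
    intro i hi hip q hq
    have hk := hrk i
    have h1 := hzs i hi q (by omega)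
    have h2 := hzs i hi (q + 1) (by omega)
    have h3 := hζη _ (hSit q i hi)
    have h4 := hη _ (hSit q i hi)
    rw [← iterate_succ_apply' f] at h3 h4
    exact ⟨h1.2.2.1, h1.2.2.2.1, h2.1, h2.2.1, h3, h4, hζ _ (hSit (q + 1) i hi), hdpos _ _ hq,
      hdpos _ _ (by omega), Nat.le_mul_of_pos_left d (by omega), Nat.mul_le_mul_right d hq⟩
  -- After one turn around its cycle a walk re-enters its own path in late block `r i - 1`, having
  -- used `2 * (r i - 1)` inner vertices. These lie in earlier late blocks or in early blocks other
  -- than block `0`, hence in parts that are given up.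
  refine h.no_detours (fun i => S i ∧ i ∈ periodicPts f) hper ζ (fun i => ys i (r i - 1))
    (fun i => L i (r i - 1)) (fun i hi => hζ i hi.1) ?_ ?_ ?_ ?_ ?_
  · rintro i ⟨hi, hip⟩
    obtain ⟨h1, h2, h3, h4⟩ := hend i hi hip
    have := hwin (r i - 1) (by have := hr1 i hip; have := hrk i; omega)
    show ys i (r i - 1) ≤ len i
    omega
  · rintro i ⟨hi, hip⟩
    obtain ⟨h1, h2, h3, h4⟩ := hend i hi hip
    have := hwin (r i - 1) (by have := hr1 i hip; have := hrk i; omega)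
    have : r i - 1 ≤ (r i - 1) * d := Nat.le_mul_of_pos_right _ hd1
    show (L i (r i - 1)).length + 1 + ζ i < ys i (r i - 1)
    rw [hLlen]
    omega
  · rintro i ⟨hi, hip⟩
    have hk : r i - 1 < k := by have := hr1 i hip; have := hrk i; omega
    have h1 := hLw i hi (r i - 1) hk
    obtain ⟨-, -, -, -, e, -⟩ := hzs i hi (r i - 1) hk
    rw [iterate_succ_apply' f, hpred i hip] at e
    simpa using (h1.append (IsWalk.singleton _) e).1
  · rintro i ⟨hi, hip⟩ v hv
    obtain ⟨q, hqr, e⟩ := hLmem _ _ _ hv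
    obtain ⟨g1, g2, g3, g4⟩ := hpos i hi hip q hqr
    obtain ⟨a1, a2, a3, a4⟩ := hend _ g1 g2
    obtain ⟨b1, b2, b3, b4, b5, b6, b7, b8, b9, b10, b11⟩ := hq i hi hip q hqr
    rw [g4, g3] at a1 a2 a3 a4
    right
    rcases e with e | e
    · refine ⟨_, _, ⟨g1, g2⟩, ?_, ?_, e⟩
      · omega
      · simp only [g4]
        omega
    · refine ⟨_, _, ⟨g1, g2⟩, ?_, ?_, e⟩
      · omega
      · simp only [g4]
        omega
  -- A common vertex has one path and one block, which forces equal steps of the two walks and then,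
  -- by injectivity on the cycles, equal starting paths.
  · rintro i j ⟨hi, hip⟩ ⟨hj, hjp⟩ hij v hvi hvj
    obtain ⟨q, hqr, e⟩ := hLmem _ _ _ hvi
    obtain ⟨q', hqr', e'⟩ := hLmem _ _ _ hvj
    obtain ⟨b1, b2, b3, b4, b5, b6, b7, b8, b9, b10, b11⟩ := hq i hi hip q hqr
    obtain ⟨c1, c2, c3, c4, c5, c6, c7, c8, c9, c10, c11⟩ := hq j hj hjp q' hqr'
    have hpq : f^[q + 1] i = f^[q' + 1] j → f^[q] i = f^[q'] j := by
      intro e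
      rw [iterate_succ_apply' f, iterate_succ_apply' f] at e
      exact hinj _ _ (hmap _ _ hip) (hmap _ _ hjp) e
    have hfin : f^[q + 1] i = f^[q' + 1] j → q ≠ q' := by
      rintro e rfl
      exact hij (hinjit _ _ _ hip hjp e)
    rcases e with e | e <;> rcases e' with e' | e' <;>
    · obtain ⟨e1, e2⟩ := h.inj _ _ _ _ (by omega) (by omega) (by omega) (by omega) (e.symm.trans e')
      have e3 := hpq e1
      refine hfin e1 ?_
      rw [← e1] at c3 c4 c5
      rw [← e3] at c1 c2 c5
      first
        | exact hsep q q' _ _ b1 b2 (e2 ▸ c1) (e2 ▸ c2)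
        | exact Nat.succ_injective (hsep (q + 1) (q' + 1) _ _ b3 b4 (e2 ▸ c3) (e2 ▸ c4))
        | omega

/-- The length of the windows in the states of the algorithm. -/
def winLen (d k : ℕ) : ℕ := 4 * (k * d) + 3 * d + 8

/-- The vertex `v` is adjacent from two blocks at the beginning of the window at `a` of a path. -/
def LeftOf (G : Digraph V) (d k len : ℕ) (p : ℕ → V) (a : ℕ) (v : V) : Prop :=
  (1 ≤ a ∧ a + winLen d k ≤ len + 1) ∧ (∃ x, a ≤ x ∧ x < a + d + 2 ∧ G.Adj (p x) v) ∧
    ∃ x, a + d + 2 ≤ x ∧ x < a + 2 * d + 4 ∧ G.Adj (p x) v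

/-- For each two paths, the vertices of the second one which lie after its window but are adjacent
from the window of the first one are close together. -/
def Admissible (G : Digraph V) (d : ℕ) (len : Fin k → ℕ) (p : Fin k → ℕ → V)
    (a : Fin k → ℕ) : Prop :=
  ∀ i l, i ≠ l → ∀ x y, a l + winLen d k ≤ x → x + d ≤ y → y ≤ len l →
    LeftOf G d k (len i) (p i) (a i) (p l x) → ¬ LeftOf G d k (len i) (p i) (a i) (p l y)

/-- Some window can be moved. -/
theorem IsTight.exists_advance (h : IsTight G len p) (hd : IsPathDominant G d) (hd1 : 1 ≤ d)
    {a : Fin k → ℕ} (ha : Admissible G d len p a) (hex : ∃ i, a i + winLen d k ≤ len i) :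
    ∃ i, a i + winLen d k ≤ len i ∧ Admissible G d len p (Function.update a i (a i + 1)) := by
  by_contra hcon
  push Not at hcon
  -- A violation after moving window `i` must concern vertices left of that window. For every other
  -- pair the relation `LeftOf` is unchanged and the future of path `i` only shrinks.
  have hbad : ∀ i, ∃ l x y, a i + winLen d k ≤ len i → i ≠ l ∧ a l + winLen d k ≤ x ∧ x + d ≤ y ∧
      y ≤ len l ∧ LeftOf G d k (len i) (p i) (a i + 1) (p l x) ∧
      LeftOf G d k (len i) (p i) (a i + 1) (p l y) := by
    intro i
    by_cases hi : a i + winLen d k ≤ len i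
    · have h1 := hcon i hi
      unfold Admissible at h1
      push Not at h1
      obtain ⟨i', l, hne, x, y, hx, hxy, hy, hlx, hly⟩ := h1
      have hax : a l + winLen d k ≤ x := by
        by_cases hl : l = i
        · subst hl
          rw [Function.update_self] at hx
          omega
        · rwa [Function.update_of_ne hl] at hx
      by_cases hi' : i' = i
      · subst hi'
        rw [Function.update_self] at hlx hly
        exact ⟨l, x, y, fun _ => ⟨hne, hax, hxy, hy, hlx, hly⟩⟩
      · rw [Function.update_of_ne hi'] at hlx hly
        exact absurd hly (ha i' l hne x y hax hxy hy hlx)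
    · exact ⟨i, 0, 0, fun h' => absurd h' hi⟩
  choose f v₁ v₂ hf using hbad
  -- There are two candidate pairs of zones; edges back in both pairs would contradict `not_cross`.
  -- As `w₂ ≤ a i + 2 * d + 4`, the first early zone may start at `a i + 2 * d + 6`, and a gap of
  -- `d` precedes the second. The late zones come after the early zones of `f i`, and the last one
  -- ends two positions before `a (f i) + winLen d k`, where the future begins. These requirements
  -- add up to `winLen`.
  have hzone : ∀ i, ∃ ζ η, a i + winLen d k ≤ len i →
      (ζ = a i + 2 * d + 6 ∨ ζ = a i + 3 * d + 6 + k * d) ∧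
      (η = a (f i) + 3 * d + 7 + 2 * (k * d) ∨ η = a (f i) + 3 * d + 7 + 3 * (k * d)) ∧
      ∀ z, ζ ≤ z → z < ζ + k * d → ∀ y, η ≤ y → y < η + k * d →
        ¬ G.Adj (p (f i) y) (p i z) := by
    intro i
    by_cases hi : a i + winLen d k ≤ len i
    · by_cases h1 : ∀ z, a i + 2 * d + 6 ≤ z → z < a i + 2 * d + 6 + k * d →
          ∀ y, a (f i) + 3 * d + 7 + 2 * (k * d) ≤ y →
            y < a (f i) + 3 * d + 7 + 2 * (k * d) + k * d → ¬ G.Adj (p (f i) y) (p i z)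
      · exact ⟨_, _, fun _ => ⟨Or.inl rfl, Or.inl rfl, h1⟩⟩
      · refine ⟨_, _, fun _ => ⟨Or.inr rfl, Or.inr rfl, ?_⟩⟩
        push Not at h1
        obtain ⟨z₁, hz1, hz2, j₁, hj1, hj2, e₁⟩ := h1
        intro z₂ hz3 hz4 j₂ hj3 hj4 e₂
        obtain ⟨g1, g2, g3, g4, ⟨-, ⟨w₁, hw1, hw2, ew₁⟩, -⟩, -, -, ⟨w₂, hw3, hw4, ew₂⟩⟩ := hf i hi
        unfold winLen at hi g2
        exact h.not_cross hd hd1 g1 (w₁ := w₁) (w₂ := w₂) (z₁ := z₁) (z₂ := z₂) (j₁ := j₁)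
          (j₂ := j₂) (v₁ := v₁ i) (v₂ := v₂ i) (by omega) (by omega) (by omega) (by omega)
          (by omega) (by omega) (by omega) (by omega) (by omega) (by omega) ew₁ ew₂ e₁ e₂
    · exact ⟨0, 0, fun h' => absurd h' hi⟩
  choose ζ η hZ using hzone
  have hfl : ∀ i, a i + winLen d k ≤ len i → a (f i) + winLen d k ≤ len (f i) := by
    intro i hi
    have := hf i hi
    omega
  refine h.no_cyclic_zones hd hd1 (fun i => a i + winLen d k ≤ len i) hex f hfl ζ η ?_ ?_ ?_ ?_
  · intro i hi
    have := (hZ i hi).1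
    omega
  · intro i hi
    have h1 := (hZ i hi).2.1
    have h2 := (hZ _ (hfl i hi)).1
    omega
  · intro i hi
    have h1 := (hZ i hi).2.1
    have h2 := hfl i hi
    unfold winLen at h2
    omega
  · intro i hi z hz1 hz2 w hw1 hw2
    obtain ⟨h1, h2, h3⟩ := hZ i hi
    have h4 := hfl i hi
    have hi' := hi
    unfold winLen at h4 hi'
    -- No edge leads back between the chosen zones, so dominance leaves only an edge into each block
    -- of the late zone.
    rcases h.window hd hd1 (i := f i) (a := w) (by omega) (by omega) (p i z) with
      ⟨y, hy1, hy2, e⟩ | e | ⟨y, hy1, hy2, e⟩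
    · exact absurd (h.inj _ _ _ _ (by omega) (by omega) (by omega) (by omega) e).1 (hf i hi).1
    · exact e
    · exact absurd e (h3 z hz1 hz2 y (by omega) (by omega))

/-- A vertex off the paths that is left of a window remains so. -/
theorem IsTight.leftOf_succ (h : IsTight G len p) (hd : IsPathDominant G d) (hd1 : 1 ≤ d)
    {i : Fin k} {a : ℕ} (ha : a + winLen d k ≤ len i) {v : V}
    (hv : ∀ j z, 1 ≤ z → z ≤ len j → v ≠ p j z) (hl : LeftOf G d k (len i) (p i) a v) :
    LeftOf G d k (len i) (p i) (a + 1) v := by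
  -- If the in-neighbour at `b` drops out, consider the `d` vertices from `b + 3` on. An edge from
  -- `v` to one of them would be a jump, so one of them is adjacent to `v`. They fit into the
  -- shifted block because blocks have `d + 2` positions.
  have key : ∀ b, 1 ≤ b → b + d + 3 ≤ len i + 1 → (∃ x, b ≤ x ∧ x < b + d + 2 ∧ G.Adj (p i x) v) →
      ∃ x, b + 1 ≤ x ∧ x < b + 1 + d + 2 ∧ G.Adj (p i x) v := by
    rintro b hb hbl ⟨x, hx1, hx2, e⟩
    by_cases hx : b + 1 ≤ x
    · exact ⟨x, hx, by omega, e⟩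
    · have hxb : x = b := by omega
      subst hxb
      rcases h.window hd hd1 (i := i) (a := x + 3) (by omega) (by omega) v with
        ⟨y, hy1, hy2, e'⟩ | ⟨y, hy1, hy2, e'⟩ | ⟨y, hy1, hy2, e'⟩
      · exact absurd e' (hv i y (by omega) (by omega))
      · exact absurd e' (h.not_jump hb hy1 (by omega) hv e)
      · exact ⟨y, by omega, by omega, e'⟩
  obtain ⟨⟨h1, h2⟩, h3, ⟨x, hx1, hx2, e⟩⟩ := hl
  have hB : winLen d k = 4 * (k * d) + 3 * d + 8 := rfl
  refine ⟨⟨by omega, by omega⟩, key a h1 (by omega) h3, ?_⟩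
  obtain ⟨y, hy1, hy2, e'⟩ := key (a + d + 2) (by omega) (by omega) ⟨x, hx1, by omega, e⟩
  exact ⟨y, by omega, by omega, e'⟩

/-- A vertex of a path is left of each later window of its path. -/
theorem IsTight.leftOf_self (h : IsTight G len p) (hd : IsPathDominant G d) (hd1 : 1 ≤ d)
    {i : Fin k} {a x : ℕ} (hx : 1 ≤ x) (hxa : x < a) (ha : a + winLen d k ≤ len i + 1) :
    LeftOf G d k (len i) (p i) a (p i x) := by
  have hB : winLen d k = 4 * (k * d) + 3 * d + 8 := rfl
  obtain ⟨y, hy1, hy2, e⟩ := h.window_adj hd hd1 (i := i) (a := a + 1) hx (by omega) (by omega)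
  obtain ⟨z, hz1, hz2, e'⟩ :=
    h.window_adj hd hd1 (i := i) (a := a + d + 2) hx (by omega) (by omega)
  exact ⟨⟨by omega, ha⟩, ⟨y, by omega, by omega, e⟩, ⟨z, by omega, by omega, e'⟩⟩

/-- A vertex of a path is not left of an earlier window of its path. -/
theorem IsTight.not_leftOf_self (h : IsTight G len p) {i : Fin k} {a x : ℕ}
    (hxa : a + winLen d k ≤ x) (hx : x ≤ len i) : ¬ LeftOf G d k (len i) (p i) a (p i x) := by
  rintro ⟨⟨h1, -⟩, ⟨y, hy1, hy2, e⟩, -⟩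
  unfold winLen at hxa
  exact h.not_adj (by omega) (by omega) hx e

end Deadlock

end DisjointPaths

namespace DisjointPaths

/-! ### Configurations of the search -/

section Config

/-- The number of entries of the list of exceptions in a configuration. -/
def excLen (d k : ℕ) : ℕ := k * (k * d)

/-- The number of digits of a configuration: `k` windows, `k` counters, a list of exceptions. -/
def confLen (d k : ℕ) : ℕ := k * winLen d k + k + excLen d k

/-- The `j`-th entry of the `i`-th window. -/
def win (d k : ℕ) (D : ℕ → ℕ) (i j : ℕ) : ℕ := D (i * winLen d k + j)

/-- The starting position of the `i`-th window. -/
def cnt (d k : ℕ) (D : ℕ → ℕ) (i : ℕ) : ℕ := D (k * winLen d k + i)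

/-- The `m`-th entry of the list of exceptions. -/
def exc (d k : ℕ) (D : ℕ → ℕ) (m : ℕ) : ℕ := D (k * winLen d k + k + m)

/-- The window `i` moves by one, the new entry being `u`; the new exceptions are given by `Y`. -/
def shift (d k i : ℕ) (D : ℕ → ℕ) (u : ℕ) (Y : ℕ → ℕ) (x : ℕ) : ℕ :=
  if k * winLen d k + k ≤ x then Y (x - (k * winLen d k + k))
  else if x = k * winLen d k + i then D x + 1
  else if i * winLen d k ≤ x ∧ x + 1 < i * winLen d k + winLen d k then D (x + 1)
  else if x + 1 = i * winLen d k + winLen d k then u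
  else D x

variable (n k d : ℕ) (A : ℕ → ℕ → Prop)

/-- `v` is adjacent from two blocks of a window. -/
def Seen (D : ℕ → ℕ) (v : ℕ) : Prop :=
  ∃ i < k, (win d k D i 0 < n ∧ win d k D i (winLen d k - 1) < n) ∧
    (∃ j < d + 2, A (win d k D i j) v) ∧ ∃ j < d + 2, A (win d k D i (d + 2 + j)) v

/-- `v` is in one of the windows. -/
def InBag (D : ℕ → ℕ) (v : ℕ) : Prop := ∃ i < k, ∃ j < winLen d k, win d k D i j = v

/-- `v` is in the list of exceptions. -/
def IsExc (D : ℕ → ℕ) (v : ℕ) : Prop := ∃ m < excLen d k, exc d k D m = v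

/-- The vertices that a configuration regards as already passed. -/
def Past (D : ℕ → ℕ) (v : ℕ) : Prop := Seen n k d A D v ∧ ¬ InBag k d D v ∧ ¬ IsExc k d D v

/-- The windows of two different paths are disjoint; `n` stands for a blank. -/
def WinDisjoint (D : ℕ → ℕ) : Prop :=
  ∀ i < k, ∀ i' < k, i ≠ i' → ∀ j < winLen d k, ∀ j' < winLen d k,
    win d k D i j = win d k D i' j' → win d k D i j = n

/-- Configurations at the start. -/
def IsInit (s : ℕ → ℕ) (D : ℕ → ℕ) : Prop :=
  (∀ i < k, (cnt d k D i = 0 ∧ win d k D i 0 = n ∧ win d k D i 1 = s i) ∧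
    ∀ j < winLen d k - 2, win d k D i (j + 2) = n ∨
      A (win d k D i (j + 1)) (win d k D i (j + 2))) ∧ WinDisjoint n k d D

/-- The window `i` may be moved. -/
def IsMove (i : ℕ) (D : ℕ → ℕ) (u : ℕ) (Y : ℕ → ℕ) : Prop :=
  ((cnt d k D i < n ∧ A (win d k D i (winLen d k - 1)) u) ∧ (¬ InBag k d D u ∧ ¬ Past n k d A D u) ∧
    (win d k D i 0 = n ∨ Past n k d A (shift d k i D u Y) (win d k D i 0))) ∧
    ∀ v < n, Past n k d A D v → Past n k d A (shift d k i D u Y) v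

/-- A configuration in which each path has arrived, after `x i` vertices. -/
def IsFinal (t : ℕ → ℕ) (D x : ℕ → ℕ) : Prop :=
  ∀ i < k, ∃ j < winLen d k, win d k D i j = t i ∧ x i = cnt d k D i + j

variable {n k d A}

theorem winLen_ge (d k : ℕ) : 3 * d + 8 ≤ winLen d k := by
  unfold winLen
  omega

theorem win_index_lt {i j : ℕ} (hi : i < k) (hj : j < winLen d k) :
    i * winLen d k + j < k * winLen d k := by
  calc i * winLen d k + j < i * winLen d k + winLen d k := by omega
    _ = (i + 1) * winLen d k := by ring
    _ ≤ k * winLen d k := Nat.mul_le_mul_right _ hi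

/-- A configuration is a function on all of `ℕ`, but only its first `confLen d k` values matter. The
congruence lemmas allow passing between a configuration and the digits of its code. -/
theorem win_congr {D E : ℕ → ℕ} (h : ∀ x < confLen d k, D x = E x) {i j : ℕ} (hi : i < k)
    (hj : j < winLen d k) : win d k D i j = win d k E i j :=
  h _ (by have := win_index_lt hi hj; unfold confLen; omega)

theorem cnt_congr {D E : ℕ → ℕ} (h : ∀ x < confLen d k, D x = E x) {i : ℕ} (hi : i < k) :
    cnt d k D i = cnt d k E i :=
  h _ (by unfold confLen; omega)

theorem exc_congr {D E : ℕ → ℕ} (h : ∀ x < confLen d k, D x = E x) {m : ℕ} (hm : m < excLen d k) :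
    exc d k D m = exc d k E m :=
  h _ (by unfold confLen; omega)

theorem InBag.congr {D E : ℕ → ℕ} (h : ∀ x < confLen d k, D x = E x) {v : ℕ}
    (hv : InBag k d D v) : InBag k d E v := by
  obtain ⟨i, hi, j, hj, e⟩ := hv
  exact ⟨i, hi, j, hj, (win_congr h hi hj).symm.trans e⟩

theorem IsExc.congr {D E : ℕ → ℕ} (h : ∀ x < confLen d k, D x = E x) {v : ℕ}
    (hv : IsExc k d D v) : IsExc k d E v := by
  obtain ⟨m, hm, e⟩ := hv
  exact ⟨m, hm, (exc_congr h hm).symm.trans e⟩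

theorem Seen.congr {D E : ℕ → ℕ} (h : ∀ x < confLen d k, D x = E x) {v : ℕ}
    (hv : Seen n k d A D v) : Seen n k d A E v := by
  have hw := winLen_ge d k
  obtain ⟨i, hi, ⟨h0, h1⟩, ⟨j, hj, e⟩, ⟨j', hj', e'⟩⟩ := hv
  rw [win_congr h hi (by omega)] at h0 h1 e e'
  exact ⟨i, hi, ⟨h0, h1⟩, ⟨j, hj, e⟩, ⟨j', hj', e'⟩⟩

theorem Past.congr {D E : ℕ → ℕ} (h : ∀ x < confLen d k, D x = E x) {v : ℕ}
    (hv : Past n k d A D v) : Past n k d A E v :=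
  have h' : ∀ x < confLen d k, E x = D x := fun x hx => (h x hx).symm
  ⟨hv.1.congr h, fun hb => hv.2.1 (hb.congr h'), fun hb => hv.2.2 (hb.congr h')⟩

theorem IsInit.congr {D E : ℕ → ℕ} (h : ∀ x < confLen d k, D x = E x) {s : ℕ → ℕ}
    (hv : IsInit n k d A s D) : IsInit n k d A s E := by
  have hw := winLen_ge d k
  refine ⟨fun i hi => ?_, fun i hi i' hi' hne j hj j' hj' e => ?_⟩
  · obtain ⟨⟨h1, h2, h3⟩, h4⟩ := hv.1 i hi
    rw [cnt_congr h hi] at h1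
    rw [win_congr h hi (by omega)] at h2 h3
    refine ⟨⟨h1, h2, h3⟩, fun j hj => ?_⟩
    have := h4 j hj
    rwa [win_congr h hi (by omega), win_congr h hi (by omega)] at this
  · rw [← win_congr h hi hj] at e ⊢
    rw [← win_congr h hi' hj'] at e
    exact hv.2 i hi i' hi' hne j hj j' hj' e

theorem shift_congr {D E : ℕ → ℕ} (h : ∀ x < confLen d k, D x = E x) {i u : ℕ} (hi : i < k)
    {Y : ℕ → ℕ} : ∀ x < confLen d k, shift d k i D u Y x = shift d k i E u Y x := by
  intro x hx
  have hk : i * winLen d k + winLen d k ≤ k * winLen d k := by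
    calc i * winLen d k + winLen d k = (i + 1) * winLen d k := by ring
      _ ≤ k * winLen d k := Nat.mul_le_mul_right _ hi
  unfold shift
  split_ifs with h1 h2 h3 h4
  · rfl
  · rw [h x hx]
  · exact h _ (by unfold confLen; omega)
  · rfl
  · exact h x hx

theorem shift_congr_exc {D : ℕ → ℕ} {i u : ℕ} {Y Z : ℕ → ℕ}
    (h : ∀ m < excLen d k, Y m = Z m) :
    ∀ x < confLen d k, shift d k i D u Y x = shift d k i D u Z x := by
  intro x hx
  unfold shift
  split_ifs with h1 h2 h3 h4
  · exact h _ (by unfold confLen at hx; omega)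
  all_goals rfl

theorem IsMove.congr {D E : ℕ → ℕ} (h : ∀ x < confLen d k, D x = E x) {i u : ℕ} {Y Z : ℕ → ℕ}
    (hi : i < k) (hY : ∀ m < excLen d k, Y m = Z m)
    (hv : IsMove n k d A i D u Y) : IsMove n k d A i E u Z := by
  have hw := winLen_ge d k
  have h' : ∀ x < confLen d k, E x = D x := fun x hx => (h x hx).symm
  have hs : ∀ x < confLen d k, shift d k i D u Y x = shift d k i E u Z x := fun x hx =>
    (shift_congr h hi x hx).trans (shift_congr_exc hY x hx)
  obtain ⟨⟨⟨h1, h2⟩, ⟨h3, h4⟩, h5⟩, h6⟩ := hv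
  rw [cnt_congr h hi] at h1
  rw [win_congr h hi (by omega)] at h2 h5
  exact ⟨⟨⟨h1, h2⟩, ⟨fun hb => h3 (hb.congr h'), fun hb => h4 (hb.congr h')⟩,
    h5.imp id fun hp => hp.congr hs⟩, fun v hv hp => (h6 v hv (hp.congr h')).congr hs⟩

theorem win_shift {D Y : ℕ → ℕ} {i u i' j : ℕ} (hi : i < k) (hi' : i' < k) (hj : j < winLen d k) :
    win d k (shift d k i D u Y) i' j =
      if i' = i then (if j + 1 < winLen d k then win d k D i (j + 1) else u)
      else win d k D i' j := by
  have h1 := win_index_lt hi' hj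
  have h2 : i * winLen d k + winLen d k ≤ k * winLen d k := by
    calc i * winLen d k + winLen d k = (i + 1) * winLen d k := by ring
      _ ≤ k * winLen d k := Nat.mul_le_mul_right _ hi
  unfold win shift
  rw [if_neg (by omega), if_neg (by omega)]
  rcases Nat.lt_trichotomy i' i with hlt | rfl | hlt
  · have : i' * winLen d k + winLen d k ≤ i * winLen d k := by
      calc i' * winLen d k + winLen d k = (i' + 1) * winLen d k := by ring
        _ ≤ i * winLen d k := Nat.mul_le_mul_right _ hlt
    rw [if_neg (by omega), if_neg (by omega), if_neg (by omega)]
  · rw [if_pos rfl]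
    by_cases hjw : j + 1 < winLen d k
    · rw [if_pos (by omega), if_pos hjw]
      rfl
    · rw [if_neg (by omega), if_pos (by omega), if_neg hjw]
  · have : i * winLen d k + winLen d k ≤ i' * winLen d k := by
      calc i * winLen d k + winLen d k = (i + 1) * winLen d k := by ring
        _ ≤ i' * winLen d k := Nat.mul_le_mul_right _ hlt
    rw [if_neg (by omega), if_neg (by omega), if_neg (by omega)]

theorem cnt_shift {D Y : ℕ → ℕ} {i u i' : ℕ} (hi : i < k) (hi' : i' < k) :
    cnt d k (shift d k i D u Y) i' = if i' = i then cnt d k D i + 1 else cnt d k D i' := by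
  have h2 : i * winLen d k + winLen d k ≤ k * winLen d k := by
    calc i * winLen d k + winLen d k = (i + 1) * winLen d k := by ring
      _ ≤ k * winLen d k := Nat.mul_le_mul_right _ hi
  unfold cnt shift
  rw [if_neg (by omega)]
  by_cases h : i' = i
  · rw [if_pos (by omega), if_pos h, h]
  · rw [if_neg (by omega), if_neg (by omega), if_neg (by omega), if_neg h]

theorem exc_shift {D Y : ℕ → ℕ} {i u m : ℕ} : exc d k (shift d k i D u Y) m = Y m := by
  unfold exc shift
  rw [if_pos (by omega)]
  congr 1
  omega

/-! ### Soundness of the search -/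

variable (n k d A) in
/-- The windows of the configuration are the last parts of disjoint walks, whose earlier vertices
are regarded as passed. -/
def IsSound (s : ℕ → ℕ) (D : ℕ → ℕ) : Prop :=
  ∃ p : ℕ → ℕ → ℕ,
    (∀ i < k, p i 0 = n ∧ p i 1 = s i ∧ (∀ j < winLen d k, win d k D i j = p i (cnt d k D i + j)) ∧
      (∀ x, 1 ≤ x → x + 1 < cnt d k D i + winLen d k → p i (x + 1) = n ∨ A (p i x) (p i (x + 1))) ∧
      ∀ x, 1 ≤ x → x < cnt d k D i → Past n k d A D (p i x)) ∧
    ∀ i < k, ∀ i' < k, i ≠ i' → ∀ x < cnt d k D i + winLen d k, ∀ y < cnt d k D i' + winLen d k,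
      p i x = p i' y → p i x = n

theorem IsSound.congr {D E : ℕ → ℕ} (h : ∀ x < confLen d k, D x = E x) {s : ℕ → ℕ}
    (hs : IsSound n k d A s D) : IsSound n k d A s E := by
  obtain ⟨p, h1, h2⟩ := hs
  refine ⟨p, fun i hi => ?_, fun i hi i' hi' => ?_⟩
  · obtain ⟨a1, a2, a3, a4, a5⟩ := h1 i hi
    rw [cnt_congr h hi] at a3 a4 a5
    exact ⟨a1, a2, fun j hj => (win_congr h hi hj).symm.trans (a3 j hj), a4,
      fun x hx hx' => (a5 x hx hx').congr h⟩
  · have := h2 i hi i' hi'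
    rwa [cnt_congr h hi, cnt_congr h hi'] at this

/-- The windows themselves serve as the walks; all counters are `0`, so there is no earlier vertex
to account for. -/
theorem IsInit.isSound {D s : ℕ → ℕ} (h : IsInit n k d A s D) : IsSound n k d A s D := by
  have hw := winLen_ge d k
  refine ⟨fun i x => if x < winLen d k then win d k D i x else n, fun i hi => ?_, ?_⟩
  · obtain ⟨⟨h1, h2, h3⟩, h4⟩ := h.1 i hi
    rw [h1]
    beta_reduce
    refine ⟨?_, ?_, ?_, ?_, ?_⟩
    · rwa [if_pos (by omega)]
    · rwa [if_pos (by omega)]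
    · intro j hj
      rw [zero_add, if_pos hj]
    · intro x hx hx'
      rw [if_pos (by omega), if_pos (by omega)]
      have := h4 (x - 1) (by omega)
      rwa [show x - 1 + 2 = x + 1 by omega, show x - 1 + 1 = x by omega] at this
    · intro x hx hx'
      omega
  · intro i hi i' hi' hne x hx y hy e
    rw [(h.1 i hi).1.1, zero_add] at hx
    rw [(h.1 i' hi').1.1, zero_add] at hy
    beta_reduce at e ⊢
    rw [if_pos hx] at e ⊢
    rw [if_pos hy] at e
    exact h.2 i hi i' hi' hne x hx y hy e

/-- Every nonblank entry of every walk is in a window or past, and a move excludes both for `u`, so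
`u` is new. The invariant is restored because the vertex leaving the window becomes past and past
vertices stay past. Nothing depends on how the exceptions `Y` were guessed. -/
theorem IsMove.isSound (hA : ∀ u v, A u v → u < n ∧ v < n) {D s Y : ℕ → ℕ} {i u : ℕ} (hi : i < k)
    (hs : IsSound n k d A s D) (h : IsMove n k d A i D u Y) :
    IsSound n k d A s (shift d k i D u Y) := by
  have hw := winLen_ge d k
  obtain ⟨⟨⟨hcn, hadj⟩, ⟨hbag, hpast⟩, hdrop⟩, hmono⟩ := h
  obtain ⟨p, h1, h2⟩ := hs
  have hu := (hA _ _ hadj).2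
  have hlast := (hA _ _ hadj).1
  obtain ⟨q1, q2, q3, q4, q5⟩ := h1 i hi
  rw [q3 _ (by omega)] at hlast hadj
  -- The last entry has an out-neighbour, so it is not blank. After position `0` no vertex follows a
  -- blank, hence there are no blanks before it either.
  have hlt : ∀ m, ∀ x, x + m = cnt d k D i + (winLen d k - 1) → 1 ≤ x → p i x < n := by
    intro m
    induction m with
    | zero =>
      intro x hx _
      rw [show x = cnt d k D i + (winLen d k - 1) by omega]
      exact hlast
    | succ m ih =>
      intro x hx hx1
      have := ih (x + 1) (by omega) (by omega)
      rcases q4 x hx1 (by omega) with e | e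
      · omega
      · exact (hA _ _ e).1
  have hdrop' : 1 ≤ cnt d k D i → Past n k d A (shift d k i D u Y) (p i (cnt d k D i)) := by
    intro hc
    have := hlt (winLen d k - 1) (cnt d k D i) rfl hc
    rw [q3 0 (by omega), add_zero] at hdrop
    rcases hdrop with e | e
    · omega
    · exact e
  have hfresh : ∀ i' < k, ∀ x < cnt d k D i' + winLen d k, p i' x ≠ u := by
    intro i' hi' x hx e
    obtain ⟨r1, r2, r3, r4, r5⟩ := h1 i' hi'
    by_cases hxc : cnt d k D i' ≤ x
    · refine hbag ⟨i', hi', x - cnt d k D i', by omega, ?_⟩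
      rw [r3 _ (by omega), ← e]
      congr 1
      omega
    · rcases Nat.eq_zero_or_pos x with rfl | hx0
      · omega
      · exact hpast (e ▸ r5 x hx0 (by omega))
  have hpn : ∀ i' < k, ∀ x, 1 ≤ x → x < cnt d k D i' → p i' x < n := by
    intro i' hi' x hx hxc
    obtain ⟨⟨_, _, _, ⟨_, _, e⟩, _⟩, _⟩ := (h1 i' hi').2.2.2.2 x hx hxc
    exact (hA _ _ e).2
  refine ⟨fun i' x => if i' = i ∧ x = cnt d k D i + winLen d k then u else p i' x,
    fun i' hi' => ?_, ?_⟩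
  · obtain ⟨r1, r2, r3, r4, r5⟩ := h1 i' hi'
    rw [cnt_shift hi hi']
    by_cases hii : i' = i
    · subst hii
      simp only [if_true, true_and]
      refine ⟨?_, ?_, ?_, ?_, ?_⟩
      · rwa [if_neg (by omega)]
      · rwa [if_neg (by omega)]
      · intro j hj
        rw [win_shift hi hi hj, if_pos rfl]
        by_cases hjw : j + 1 < winLen d k
        · rw [if_pos hjw, if_neg (by omega), q3 _ hjw]
          congr 1
          omega
        · rw [if_neg hjw, if_pos (by omega)]
      · intro x hx hx'
        rw [if_neg (by omega : ¬ x = _)]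
        by_cases hxe : x + 1 = cnt d k D i' + winLen d k
        · rw [if_pos hxe]
          right
          rwa [show x = cnt d k D i' + (winLen d k - 1) by omega]
        · rw [if_neg hxe]
          exact q4 x hx (by omega)
      · intro x hx hx'
        rw [if_neg (by omega)]
        by_cases hxc : x = cnt d k D i'
        · subst hxc
          exact hdrop' hx
        · exact hmono _ (hpn _ hi _ hx (by omega)) (q5 x hx (by omega))
    · simp only [hii, false_and, if_false]
      refine ⟨r1, r2, fun j hj => ?_, r4, fun x hx hx' =>
        hmono _ (hpn _ hi' _ hx hx') (r5 x hx hx')⟩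
      rw [win_shift hi hi' hj, if_neg hii, r3 j hj]
  · intro a ha b hb hab x hx y hy e
    rw [cnt_shift hi ha] at hx
    rw [cnt_shift hi hb] at hy
    beta_reduce at e ⊢
    by_cases hax : a = i ∧ x = cnt d k D i + winLen d k
    · rw [if_pos hax] at e
      obtain ⟨rfl, -⟩ := hax
      rw [if_neg (fun h => hab h.1.symm)] at e
      rw [if_neg hab.symm] at hy
      exact absurd e.symm (hfresh b hb y hy)
    · rw [if_neg hax] at e ⊢
      have hx' : x < cnt d k D a + winLen d k := by
        split_ifs at hx with hai
        · subst hai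
          simp only [true_and] at hax
          omega
        · exact hx
      by_cases hby : b = i ∧ y = cnt d k D i + winLen d k
      · rw [if_pos hby] at e
        exact absurd e (hfresh a ha x hx')
      · rw [if_neg hby] at e
        refine h2 a ha b hb hab x hx' y ?_ e
        split_ifs at hy with hbi
        · subst hbi
          simp only [true_and] at hby
          omega
        · exact hy

end Config

end DisjointPaths

namespace DisjointPaths

/-! ### From configurations to qualities, and from key qualities to tight systems. -/

section Search

variable {n k d : ℕ}

/-- The adjacency of an instance, as a relation between numbers. -/
def Instance.adj (I : Instance n k) (u v : ℕ) : Prop :=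
  ∃ (hu : u < n) (hv : v < n), I.graph.Adj ⟨u, hu⟩ ⟨v, hv⟩

theorem Instance.adj_lt (I : Instance n k) (u v : ℕ) (h : I.adj u v) : u < n ∧ v < n :=
  ⟨h.1, h.2.1⟩

/-- The number of the `i`-th source. -/
def Instance.src (I : Instance n k) (i : ℕ) : ℕ := if h : i < k then I.s ⟨i, h⟩ else 0

/-- The number of the `i`-th sink. -/
def Instance.tgt (I : Instance n k) (i : ℕ) : ℕ := if h : i < k then I.t ⟨i, h⟩ else 0

/-- Disjoint walks give a quality. -/
theorem Instance.exists_quality_of_walks (I : Instance n k) (Q : Fin k → List (Fin n))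
    (hQ : ∀ i, IsWalk I.graph (Q i) (I.s i) (I.t i))
    (hdisj : ∀ i j, i ≠ j → ∀ v, v ∈ Q i → v ∉ Q j) :
    ∃ y, I.IsQuality y ∧ ∀ i, y i ≤ (Q i).length := by
  choose P hP hsub hlen using fun i => (hQ i).exists_path
  exact ⟨fun i => (P i).length, ⟨P, ⟨hP, fun i j hij v hi hj =>
    hdisj i j hij v (hsub i hi) (hsub j hj)⟩, fun _ => rfl⟩, hlen⟩

/-- A sound configuration in which all paths have arrived gives a quality. -/
theorem IsSound.exists_quality {I : Instance n k} {D x : ℕ → ℕ}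
    (h : IsSound n k d I.adj I.src D) (hf : IsFinal k d I.tgt D x) :
    ∃ y, I.IsQuality y ∧ ∀ i : Fin k, y i ≤ x i := by
  obtain ⟨p, h1, h2⟩ := h
  have hx : ∀ i : Fin k, x i < cnt d k D i + winLen d k ∧ p i (x i) = I.t i ∧ 1 ≤ x i := by
    intro i
    obtain ⟨j, hj, e1, e2⟩ := hf i i.2
    obtain ⟨q1, q2, q3, q4, q5⟩ := h1 i i.2
    have e3 : p i (x i) = I.t i := by
      rw [e2, ← q3 j hj, e1]
      simp [Instance.tgt]
    refine ⟨by omega, e3, ?_⟩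
    -- Position `0` carries the blank, which is not a sink.
    rcases Nat.eq_zero_or_pos (x i) with h0 | h0
    · rw [h0, q1] at e3
      have := (I.t i).2
      omega
    · exact h0
  have hlt : ∀ i : Fin k, ∀ m z, z + m = x i → 1 ≤ z → p i z < n := by
    intro i m
    induction m with
    | zero =>
      intro z hz _
      rw [show z = x i by omega, (hx i).2.1]
      exact (I.t i).2
    | succ m ih =>
      intro z hz hz1
      have := ih (z + 1) (by omega) (by omega)
      rcases (h1 i i.2).2.2.2.1 z hz1 (by have := (hx i).1; omega) with e | e
      · omega
      · exact e.1
  let q : Fin k → ℕ → Fin n := fun i z => if h : p i z < n then ⟨p i z, h⟩ else I.s i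
  have hq : ∀ i : Fin k, ∀ z, 1 ≤ z → z ≤ x i → (q i z : ℕ) = p i z := by
    intro i z hz hzx
    simp only [q]
    rw [dif_pos (hlt i (x i - z) z (by omega) hz)]
  suffices h : (∀ i, IsWalk I.graph (seg (q i) 1 (x i)) (I.s i) (I.t i)) ∧
      ∀ i j, i ≠ j → ∀ v, v ∈ seg (q i) 1 (x i) → v ∉ seg (q j) 1 (x j) by
    obtain ⟨y, hy, hyx⟩ := I.exists_quality_of_walks (fun i => seg (q i) 1 (x i)) h.1 h.2
    refine ⟨y, hy, fun i => ?_⟩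
    have := hyx i
    rwa [length_seg, Nat.add_sub_cancel] at this
  constructor
  · intro i
    have hs : q i 1 = I.s i := by
      apply Fin.ext
      rw [hq i 1 le_rfl (hx i).2.2, (h1 i i.2).2.1]
      simp [Instance.src]
    have ht : q i (x i) = I.t i := by
      apply Fin.ext
      rw [hq i _ (hx i).2.2 le_rfl, (hx i).2.1]
    rw [← hs, ← ht]
    refine isWalk_seg (hx i).2.2 fun z hz hzx => ?_
    rcases (h1 i i.2).2.2.2.1 z hz (by have := (hx i).1; omega) with e | ⟨e1, e2, e⟩
    · have := hlt i (x i - (z + 1)) (z + 1) (by omega) (by omega)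
      omega
    · convert e using 1
      · exact Fin.ext (hq i z hz hzx.le)
      · exact Fin.ext (hq i (z + 1) (by omega) hzx)
  · intro i j hij v hvi hvj
    obtain ⟨a, ha1, ha2, rfl⟩ := mem_seg.1 hvi
    obtain ⟨b, hb1, hb2, e⟩ := mem_seg.1 hvj
    have e' : p i a = p j b := by rw [← hq i a ha1 ha2, ← hq j b hb1 hb2, e]
    have h3 := h2 i i.2 j j.2 (fun h => hij (Fin.ext h)) a (by have := (hx i).1; omega) b
      (by have := (hx j).1; omega) e'
    have h4 := hlt i (x i - a) a (by omega) ha1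
    omega

/-- A key quality comes from a tight system of paths. -/
theorem Instance.IsKeyQuality.exists_tight {I : Instance n k} {x : Fin k → ℕ}
    (h : I.IsKeyQuality x) :
    ∃ p, IsTight I.graph x p ∧ ∀ i, p i 1 = I.s i ∧ p i (x i) = I.t i := by
  obtain ⟨⟨P, ⟨hP, hdisj⟩, hlen⟩, hkey⟩ := h
  -- Positions count from `1`, which leaves position `0` for a blank; the default value is
  -- irrelevant.
  let p : Fin k → ℕ → Fin n := fun i y => (P i).getD (y - 1) (I.s i)
  have hget : ∀ i y (h : y < (P i).length), p i (y + 1) = (P i)[y] := by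
    intro i y h
    simp [p, List.getD_eq_getElem?_getD, List.getElem?_eq_getElem h]
  have hpos : ∀ i, 1 ≤ x i := fun i => by
    rw [← hlen i]
    exact List.length_pos_iff.2 (hP i).1.1
  have hs : ∀ i, p i 1 = I.s i := by
    intro i
    have hl : 0 < (P i).length := by rw [hlen]; exact hpos i
    have := (hP i).2.1
    rw [List.head?_eq_getElem?, List.getElem?_eq_getElem hl] at this
    rw [hget i 0 hl]
    exact Option.some.inj this
  have ht : ∀ i, p i (x i) = I.t i := by
    intro i
    have hl : x i - 1 < (P i).length := by rw [hlen]; have := hpos i; omega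
    have := (hP i).2.2
    rw [List.getLast?_eq_getElem?, hlen, List.getElem?_eq_getElem hl] at this
    have e := hget i _ hl
    rw [Nat.sub_add_cancel (hpos i)] at e
    rw [e]
    exact Option.some.inj this
  have hget' : ∀ i y, 1 ≤ y → y ≤ x i → ∃ h : y - 1 < (P i).length, p i y = (P i)[y - 1] := by
    intro i y h1 h2
    have hl : y - 1 < (P i).length := by rw [hlen]; omega
    have e := hget i _ hl
    rw [Nat.sub_add_cancel h1] at e
    exact ⟨hl, e⟩
  refine ⟨p, ⟨hpos, ?_, ?_, ?_⟩, fun i => ⟨hs i, ht i⟩⟩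
  · intro i y h1 h2
    have hl : y < (P i).length := by rw [hlen]; exact h2
    obtain ⟨y, rfl⟩ : ∃ z, y = z + 1 := ⟨y - 1, by omega⟩
    rw [hget i y (by omega), hget i (y + 1) hl]
    exact List.isChain_iff_getElem.1 (hP i).1.2.2 y hl
  · intro i j y z h1 h2 h3 h4 e
    obtain ⟨hy, ey⟩ := hget' i y h1 h2
    obtain ⟨hz, ez⟩ := hget' j z h3 h4
    by_cases hij : i = j
    · subst hij
      rw [ey, ez, (hP i).1.2.1.getElem_inj_iff] at e
      exact ⟨rfl, by omega⟩
    · refine absurd (List.getElem_mem hz) ?_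
      rw [← ez, ← e, ey]
      exact hdisj i j hij _ (List.getElem_mem hy)
  -- Shorter disjoint walks contain disjoint paths, whose lengths would form a quality below the key
  -- one.
  · intro Q hQ hQd hQl
    obtain ⟨y, hy, hyl⟩ := I.exists_quality_of_walks Q
      (fun i => by rw [← hs i, ← ht i]; exact hQ i) hQd
    have hyx : y ≤ x := fun i => (hyl i).trans (hQl i)
    have : y = x := by
      by_contra hne
      exact hkey y hy (lt_of_le_of_ne hyx hne)
    intro i
    have := hyl i
    have := hQl i
    have : y i = x i := by rw [‹y = x›]
    omega

/-- `Reach m D`: the configuration `D` is reached from the start by `m` moves. -/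
inductive Reach (d : ℕ) (I : Instance n k) : ℕ → (ℕ → ℕ) → Prop
  | init {D : ℕ → ℕ} (hD : ∀ x, D x ≤ n) (h : IsInit n k d I.adj I.src D) : Reach d I 0 D
  | step {m : ℕ} {D Y : ℕ → ℕ} {i u : ℕ} (hr : Reach d I m D) (hi : i < k) (hu : u < n)
      (hY : ∀ x, Y x ≤ n) (h : IsMove n k d I.adj i D u Y) : Reach d I (m + 1) (shift d k i D u Y)

/-! ### Completeness of the search -/

variable {I : Instance n k} {len : Fin k → ℕ} {p : Fin k → ℕ → Fin n}

/-- A path, continued by blanks on both sides. -/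
def ext (len : ℕ) (p : ℕ → Fin n) (x : ℕ) : ℕ := if 1 ≤ x ∧ x ≤ len then p x else n

theorem ext_le {l : ℕ} {q : ℕ → Fin n} (x : ℕ) : ext l q x ≤ n := by
  unfold ext
  split_ifs
  · exact (q x).2.le
  · exact le_rfl

theorem ext_lt {l : ℕ} {q : ℕ → Fin n} {x : ℕ} : ext l q x < n ↔ 1 ≤ x ∧ x ≤ l := by
  unfold ext
  split_ifs with h
  · exact ⟨fun _ => h, fun _ => (q x).2⟩
  · exact ⟨fun h' => absurd h' (lt_irrefl _), fun h' => absurd h' h⟩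

theorem ext_of_mem {l : ℕ} {q : ℕ → Fin n} {x : ℕ} (h1 : 1 ≤ x) (h2 : x ≤ l) :
    ext l q x = q x := if_pos ⟨h1, h2⟩

theorem adj_ext {l : ℕ} {q : ℕ → Fin n} {x : ℕ} {v : Fin n} :
    I.adj (ext l q x) v ↔ (1 ≤ x ∧ x ≤ l) ∧ I.graph.Adj (q x) v := by
  constructor
  · rintro ⟨h1, h2, h3⟩
    have hx := ext_lt.1 h1
    refine ⟨hx, ?_⟩
    convert h3 using 1
    exact Fin.ext (ext_of_mem hx.1 hx.2).symm
  · rintro ⟨⟨h1, h2⟩, h3⟩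
    rw [ext_of_mem h1 h2]
    exact ⟨(q x).2, v.2, h3⟩

variable (d len p) in
/-- The vertices after the window of their path that are left of a window of another path. -/
def excSet (G : Digraph (Fin n)) (a : Fin k → ℕ) : Set (Fin n) :=
  {v | ∃ l x, a l + winLen d k ≤ x ∧ x ≤ len l ∧ v = p l x ∧
    ∃ i, LeftOf G d k (len i) (p i) (a i) v}

-- For each ordered pair of distinct paths, admissibility confines the exceptions to `d` consecutive
-- positions, so the list has room for all of them. Its remaining entries are blanks.
open Classical in
theorem IsTight.exists_exc (h : IsTight I.graph len p) {a : Fin k → ℕ}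
    (ha : Admissible I.graph d len p a) :
    ∃ Y : ℕ → ℕ, (∀ x, Y x ≤ n) ∧
      ∀ v : Fin n, (∃ m < excLen d k, Y m = v) ↔ v ∈ excSet d len p I.graph a := by
  let T : Fin k × Fin k → Finset ℕ := fun q => (Finset.range (len q.2 + 1)).filter fun x =>
    q.1 ≠ q.2 ∧ a q.2 + winLen d k ≤ x ∧
      LeftOf I.graph d k (len q.1) (p q.1) (a q.1) (p q.2 x)
  have hT : ∀ q, (T q).card ≤ d := by
    intro q
    rcases (T q).eq_empty_or_nonempty with he | hne
    · simp [he]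
    · have hsub : T q ⊆ Finset.Ico ((T q).min' hne) ((T q).min' hne + d) := by
        intro y hy
        have hmin := (T q).min'_mem hne
        refine Finset.mem_Ico.2 ⟨(T q).min'_le y hy, ?_⟩
        by_contra hlt
        generalize (T q).min' hne = c at hmin hlt
        simp only [T, Finset.mem_filter, Finset.mem_range] at hy hmin
        exact ha q.1 q.2 hy.2.1 _ y hmin.2.2.1 (by omega) (by omega) hmin.2.2.2 hy.2.2.2
      simpa using Finset.card_le_card hsub
  let E : Finset (Fin n) := Finset.univ.biUnion fun q => (T q).image (p q.2)
  have hE : E.card ≤ excLen d k := by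
    calc E.card ≤ (Finset.univ : Finset (Fin k × Fin k)).card * d :=
          Finset.card_biUnion_le_card_mul _ _ _ fun q _ => Finset.card_image_le.trans (hT q)
      _ = excLen d k := by simp [excLen, mul_assoc]
  have hmem : ∀ v, v ∈ E ↔ v ∈ excSet d len p I.graph a := by
    intro v
    simp only [E, T, Finset.mem_biUnion, Finset.mem_univ, true_and, Finset.mem_image,
      Finset.mem_filter, Finset.mem_range, Prod.exists, excSet, Set.mem_ofPred_eq]
    constructor
    · rintro ⟨i, l, x, ⟨h1, h2, h3, h4⟩, rfl⟩
      exact ⟨l, x, h3, by omega, rfl, i, h4⟩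
    · rintro ⟨l, x, h1, h2, rfl, i, h3⟩
      refine ⟨i, l, x, ⟨by omega, ?_, h1, h3⟩, rfl⟩
      rintro rfl
      exact h.not_leftOf_self h1 h2 h3
  refine ⟨fun m => ((E.toList.map Fin.val)[m]?).getD n, fun x => ?_, fun v => ?_⟩
  · beta_reduce
    rw [List.getElem?_map]
    cases E.toList[x]? with
    | none => simp
    | some w => simp [w.2.le]
  · rw [← hmem, ← Finset.mem_toList, List.mem_iff_getElem?]
    constructor
    · rintro ⟨m, -, e⟩
      beta_reduce at e
      rw [List.getElem?_map] at e
      refine ⟨m, ?_⟩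
      cases hw : E.toList[m]? with
      | none =>
        rw [hw] at e
        have := v.2
        simp at e
        omega
      | some w =>
        rw [hw] at e
        simp at e
        rw [Fin.ext e]
    · rintro ⟨m, e⟩
      refine ⟨m, ?_, ?_⟩
      · have := (List.getElem?_eq_some_iff.1 e).1
        rw [Finset.length_toList] at this
        omega
      · beta_reduce
        rw [List.getElem?_map, e]
        rfl

variable (d I len p) in
/-- `D` describes the windows of the paths at `a`, and their exceptions. -/
structure IsConf (a : Fin k → ℕ) (D : ℕ → ℕ) : Prop where
  le : ∀ x, D x ≤ n
  win_eq : ∀ i : Fin k, ∀ j < winLen d k, win d k D i j = ext (len i) (p i) (a i + j)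
  cnt_eq : ∀ i : Fin k, cnt d k D i = a i
  exc_iff : ∀ v : Fin n, IsExc k d D v ↔ v ∈ excSet d len p I.graph a

/-- That the first and last entries of a window are not blank means exactly that the window lies
within its path, as `LeftOf` demands. -/
theorem IsConf.seen_iff {a : Fin k → ℕ} {D : ℕ → ℕ} (h : IsConf d I len p a D) (v : Fin n) :
    Seen n k d I.adj D v ↔ ∃ i, LeftOf I.graph d k (len i) (p i) (a i) v := by
  have hw := winLen_ge d k
  unfold Seen LeftOf
  constructor
  · rintro ⟨i, hi, ⟨h0, h1⟩, ⟨j, hj, e⟩, ⟨j', hj', e'⟩⟩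
    rw [h.win_eq ⟨i, hi⟩ _ (by omega)] at h0 h1 e e'
    have h0 := ext_lt.1 h0
    have h1 := ext_lt.1 h1
    exact ⟨⟨i, hi⟩, ⟨by omega, by omega⟩, ⟨_, by omega, by omega, (adj_ext.1 e).2⟩,
      ⟨_, by omega, by omega, (adj_ext.1 e').2⟩⟩
  · rintro ⟨i, ⟨h0, h1⟩, ⟨x, hx1, hx2, e⟩, ⟨y, hy1, hy2, e'⟩⟩
    refine ⟨i, i.2, ⟨?_, ?_⟩, ⟨x - a i, by omega, ?_⟩, ⟨y - (a i + d + 2), by omega, ?_⟩⟩ <;>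
      rw [h.win_eq i _ (by omega)]
    · exact ext_lt.2 (by omega)
    · exact ext_lt.2 (by omega)
    · rw [show a i + (x - a i) = x by omega]
      exact adj_ext.2 ⟨by omega, e⟩
    · rw [show a i + (d + 2 + (y - (a i + d + 2))) = y by omega]
      exact adj_ext.2 ⟨by omega, e'⟩

theorem IsConf.inBag_iff {a : Fin k → ℕ} {D : ℕ → ℕ} (h : IsConf d I len p a D) (v : Fin n) :
    InBag k d D v ↔ ∃ i x, (1 ≤ x ∧ x ≤ len i) ∧ (a i ≤ x ∧ x < a i + winLen d k) ∧ v = p i x := by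
  constructor
  · rintro ⟨i, hi, j, hj, e⟩
    rw [h.win_eq ⟨i, hi⟩ _ hj] at e
    have hx := ext_lt.1 (e ▸ v.2)
    refine ⟨⟨i, hi⟩, _, hx, by omega, Fin.ext ?_⟩
    rw [← e, ext_of_mem hx.1 hx.2]
  · rintro ⟨i, x, ⟨hx1, hx2⟩, ⟨hx3, hx4⟩, rfl⟩
    refine ⟨i, i.2, x - a i, by omega, ?_⟩
    rw [h.win_eq i _ (by omega), show a i + (x - a i) = x by omega, ext_of_mem hx1 hx2]

/-- On the paths, the vertices regarded as passed are those before the windows. -/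
theorem IsConf.past_path (ht : IsTight I.graph len p) (hd : IsPathDominant I.graph d)
    (hd1 : 1 ≤ d) {a : Fin k → ℕ} {D : ℕ → ℕ} (h : IsConf d I len p a D)
    (ha : ∀ i, a i = 0 ∨ a i + winLen d k ≤ len i + 1) {l : Fin k} {x : ℕ} (hx : 1 ≤ x)
    (hxl : x ≤ len l) : Past n k d I.adj D (p l x) ↔ x < a l := by
  unfold Past
  rw [h.seen_iff, h.inBag_iff, h.exc_iff]
  -- A vertex in its window is excluded by `InBag`, and a later one that is seen is an exception by
  -- definition. An earlier one is left of its own window, which fits into the path because its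
  -- position is not `0`.
  constructor
  · rintro ⟨h1, h2, h3⟩
    by_contra hlt
    by_cases hb : x < a l + winLen d k
    · exact h2 ⟨l, x, ⟨hx, hxl⟩, ⟨by omega, hb⟩, rfl⟩
    · exact h3 ⟨l, x, by omega, hxl, rfl, h1⟩
  · intro hlt
    refine ⟨⟨l, ht.leftOf_self hd hd1 hx hlt (by have := ha l; omega)⟩, ?_, ?_⟩
    · rintro ⟨i, y, ⟨h1, h2⟩, ⟨h3, h4⟩, e⟩
      obtain ⟨rfl, rfl⟩ := ht.inj _ _ _ _ hx hxl h1 h2 e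
      omega
    · rintro ⟨i, y, h1, h2, e, -⟩
      have := winLen_ge d k
      obtain ⟨rfl, rfl⟩ := ht.inj _ _ _ _ hx hxl (by omega) h2 e
      omega

/-- Off the paths, the vertices regarded as passed are those left of some window. -/
theorem IsConf.past_off {a : Fin k → ℕ} {D : ℕ → ℕ} (h : IsConf d I len p a D)
    {v : Fin n} (hv : ∀ j z, 1 ≤ z → z ≤ len j → v ≠ p j z) :
    Past n k d I.adj D v ↔ ∃ i, LeftOf I.graph d k (len i) (p i) (a i) v := by
  unfold Past
  rw [h.seen_iff, h.inBag_iff, h.exc_iff]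
  refine ⟨fun h' => h'.1, fun h' => ⟨h', ?_, ?_⟩⟩
  · rintro ⟨i, y, ⟨h1, h2⟩, -, e⟩
    exact hv i y h1 h2 e
  · rintro ⟨i, y, h1, h2, e, -⟩
    have := winLen_ge d k
    exact hv i y (by omega) h2 e

/-- Moving a window corresponds to a move of configurations. -/
theorem IsConf.exists_move (ht : IsTight I.graph len p) (hd : IsPathDominant I.graph d)
    (hd1 : 1 ≤ d) (hlen : ∀ i, len i ≤ n) {a : Fin k → ℕ} {D : ℕ → ℕ} (h : IsConf d I len p a D)
    (ha : ∀ i, a i = 0 ∨ a i + winLen d k ≤ len i + 1) {i : Fin k}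
    (hi : a i + winLen d k ≤ len i)
    (hadm : Admissible I.graph d len p (Function.update a i (a i + 1))) :
    ∃ (u : ℕ) (Y : ℕ → ℕ), u < n ∧ (∀ x, Y x ≤ n) ∧ IsMove n k d I.adj i D u Y ∧
      IsConf d I len p (Function.update a i (a i + 1)) (shift d k i D u Y) := by
  have hw := winLen_ge d k
  -- The new exception list is not derived from the old one; admissibility of the new positions
  -- guarantees that a list of the allowed length exists.
  obtain ⟨Y, hYn, hY⟩ := ht.exists_exc hadm
  have hconf : IsConf d I len p (Function.update a i (a i + 1))
      (shift d k i D (p i (a i + winLen d k)) Y) := by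
    refine ⟨fun x => ?_, fun i' j hj => ?_, fun i' => ?_, fun v => ?_⟩
    · unfold shift
      have := h.cnt_eq i
      have := hlen i
      unfold cnt at *
      split_ifs with h1 h2 h3 h4
      · exact hYn _
      · rw [h2]
        omega
      · exact h.le _
      · exact (p i _).2.le
      · exact h.le _
    · rw [win_shift i.2 i'.2 hj]
      by_cases hii : i' = i
      · subst hii
        rw [if_pos rfl, Function.update_self]
        by_cases hjw : j + 1 < winLen d k
        · rw [if_pos hjw, h.win_eq _ _ hjw]
          congr 1
          omega
        · rw [if_neg hjw, show a i' + 1 + j = a i' + winLen d k by omega,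
            ext_of_mem (by omega) hi]
      · rw [if_neg (fun e => hii (Fin.ext e)), Function.update_of_ne hii, h.win_eq _ _ hj]
    · rw [cnt_shift i.2 i'.2]
      by_cases hii : i' = i
      · subst hii
        rw [if_pos rfl, Function.update_self, h.cnt_eq]
      · rw [if_neg (fun e => hii (Fin.ext e)), Function.update_of_ne hii, h.cnt_eq]
    · rw [← hY v]
      unfold IsExc
      simp only [exc_shift]
  have ha' : ∀ l, Function.update a i (a i + 1) l = 0 ∨
      Function.update a i (a i + 1) l + winLen d k ≤ len l + 1 := by
    intro l
    by_cases hl : l = i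
    · subst hl
      rw [Function.update_self]
      omega
    · rw [Function.update_of_ne hl]
      exact ha l
  have hle : ∀ l, a l ≤ Function.update a i (a i + 1) l := by
    intro l
    by_cases hl : l = i
    · subst hl
      rw [Function.update_self]
      omega
    · rw [Function.update_of_ne hl]
  refine ⟨p i (a i + winLen d k), Y, (p i _).2, hYn, ⟨⟨⟨?_, ?_⟩, ⟨?_, ?_⟩, ?_⟩, ?_⟩, hconf⟩
  · rw [h.cnt_eq]
    have := hlen i
    omega
  · rw [h.win_eq _ _ (by omega)]
    refine adj_ext.2 ⟨by omega, ?_⟩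
    rw [show a i + winLen d k = a i + (winLen d k - 1) + 1 by omega]
    exact ht.adj i _ (by omega) (by omega)
  · rw [h.inBag_iff]
    rintro ⟨l, x, ⟨h1, h2⟩, h3, e⟩
    obtain ⟨rfl, rfl⟩ := ht.inj _ _ _ _ (by omega) hi h1 h2 e
    omega
  · rw [h.past_path ht hd hd1 ha (by omega) hi]
    omega
  · rw [h.win_eq _ _ (by omega), add_zero]
    rcases Nat.eq_zero_or_pos (a i) with h0 | h0
    · left
      rw [h0]
      exact if_neg (by omega)
    · right
      rw [ext_of_mem h0 (by omega), hconf.past_path ht hd hd1 ha' h0 (by omega),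
        Function.update_self]
      omega
  -- Off the paths, `leftOf_succ` preserves being past; on the paths, being past means lying before
  -- the window, and windows only advance.
  · intro v hv hp
    lift v to Fin n using hv
    by_cases hoff : ∀ j z, 1 ≤ z → z ≤ len j → v ≠ p j z
    · rw [h.past_off hoff] at hp
      rw [hconf.past_off hoff]
      obtain ⟨l, hl⟩ := hp
      refine ⟨l, ?_⟩
      by_cases hli : l = i
      · subst hli
        rw [Function.update_self]
        exact ht.leftOf_succ hd hd1 hi hoff hl
      · rwa [Function.update_of_ne hli]
    · push Not at hoff
      obtain ⟨l, x, h1, h2, rfl⟩ := hoff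
      rw [h.past_path ht hd hd1 ha h1 h2] at hp
      rw [hconf.past_path ht hd hd1 ha' h1 h2]
      exact hp.trans_le (hle l)

/-- The initial configuration of a tight system. -/
theorem IsTight.exists_init (ht : IsTight I.graph len p) (hs : ∀ i, p i 1 = I.s i) :
    ∃ D, IsConf d I len p (fun _ => 0) D ∧ IsInit n k d I.adj I.src D ∧
      Admissible I.graph d len p (fun _ => 0) := by
  have hw := winLen_ge d k
  let D : ℕ → ℕ := fun x =>
    if h : x / winLen d k < k then ext (len ⟨_, h⟩) (p ⟨_, h⟩) (x % winLen d k)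
    else if x < k * winLen d k + k then 0 else n
  have hwin : ∀ i : Fin k, ∀ j < winLen d k, win d k D i j = ext (len i) (p i) (0 + j) := by
    intro i j hj
    have h1 : (i * winLen d k + j) / winLen d k = i := by
      rw [mul_comm, Nat.mul_add_div (by omega), Nat.div_eq_of_lt hj, add_zero]
    have h2 : (i * winLen d k + j) % winLen d k = j := by
      rw [mul_comm, Nat.mul_add_mod, Nat.mod_eq_of_lt hj]
    have h3 : ∀ (y : ℕ) (hy : y = i) (h : y < k) (z : ℕ), ext (len ⟨y, h⟩) (p ⟨y, h⟩) z =
        ext (len i) (p i) z := by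
      rintro y rfl h z
      rfl
    show D _ = _
    simp only [D]
    rw [dif_pos (lt_of_eq_of_lt h1 i.2), h2, zero_add, h3 _ h1]
  have hbig : ∀ x, k * winLen d k ≤ x → ¬ x / winLen d k < k := by
    intro x hx
    rw [not_lt, Nat.le_div_iff_mul_le (by omega)]
    exact hx
  -- A window at position `0` begins with a blank, so nothing is left of it. Hence there are no
  -- exceptions at the start, and admissibility is automatic.
  have hnot : ∀ i v, ¬ LeftOf I.graph d k (len i) (p i) 0 v := by
    rintro i v ⟨⟨h, -⟩, -⟩
    omega
  have hcnt : ∀ i : Fin k, cnt d k D i = 0 := by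
    intro i
    show D _ = _
    simp only [D]
    rw [dif_neg (hbig _ (by omega)), if_pos (by omega)]
  refine ⟨D, ⟨fun x => ?_, hwin, hcnt, fun v => ?_⟩, ⟨fun i hi => ⟨⟨?_, ?_, ?_⟩, ?_⟩, ?_⟩, ?_⟩
  · simp only [D]
    split_ifs
    · exact ext_le _
    · omega
    · exact le_rfl
  · constructor
    · rintro ⟨m, hm, e⟩
      have : D (k * winLen d k + k + m) = n := by
        simp only [D]
        rw [dif_neg (hbig _ (by omega)), if_neg (by omega)]
      have := v.2
      unfold exc at e
      omega
    · rintro ⟨l, x, -, -, -, i, hl⟩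
      exact absurd hl (hnot i v)
  · exact hcnt ⟨i, hi⟩
  · exact (hwin ⟨i, hi⟩ 0 (by omega)).trans (if_neg (by omega))
  · rw [hwin ⟨i, hi⟩ 1 (by omega), zero_add, ext_of_mem le_rfl (ht.pos _), hs]
    simp [Instance.src, hi]
  · intro j hj
    rw [hwin ⟨i, hi⟩ _ (by omega), hwin ⟨i, hi⟩ _ (by omega), zero_add, zero_add]
    by_cases hjl : j + 2 ≤ len ⟨i, hi⟩
    · right
      rw [ext_of_mem (x := j + 2) (by omega) hjl]
      exact adj_ext.2 ⟨by omega, ht.adj _ _ (by omega) (by omega)⟩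
    · left
      exact if_neg (by omega)
  · intro i hi i' hi' hne j hj j' hj' e
    rw [hwin ⟨i, hi⟩ _ hj, hwin ⟨i', hi'⟩ _ hj', zero_add, zero_add] at e
    rw [hwin ⟨i, hi⟩ _ hj, zero_add]
    by_contra hn
    have h1 := lt_of_le_of_ne (ext_le _) hn
    have h2 := ext_lt.1 h1
    rw [e] at h1
    have h3 := ext_lt.1 h1
    rw [ext_of_mem h2.1 h2.2, ext_of_mem h3.1 h3.2] at e
    exact hne (congrArg Fin.val (ht.inj _ _ _ _ h2.1 h2.2 h3.1 h3.2 (Fin.ext e)).1)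
  · exact fun i l _ x y _ _ _ hl => absurd hl (hnot i _)

/-- Each key quality is found by the search. -/
theorem Instance.IsKeyQuality.exists_reach (hd : IsPathDominant I.graph d) (hd1 : 1 ≤ d)
    {x : Fin k → ℕ} (hx : I.IsKeyQuality x) :
    (∀ i, x i ≤ n) ∧ ∃ m ≤ n, ∃ D : ℕ → ℕ, Reach d I m D ∧ (∀ y, D y ≤ n) ∧
      IsFinal k d I.tgt D (fun i => if h : i < k then x ⟨i, h⟩ else 0) := by
  have hw := winLen_ge d k
  obtain ⟨p, ht, hp⟩ := hx.exists_tight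
  -- Disjointness bounds the total length of the paths, and with it the number of moves.
  have hsum : ∑ i, x i ≤ n := by
    have hinj : Function.Injective (fun q : (i : Fin k) × Fin (x i) => p q.1 (q.2 + 1)) := by
      rintro ⟨i, y⟩ ⟨j, z⟩ e
      obtain ⟨rfl, h⟩ := ht.inj i j (y + 1) (z + 1) (by omega) y.2 (by omega) z.2 e
      congr
      exact Fin.ext (by omega)
    simpa using Fintype.card_le_of_injective _ hinj
  have hle : ∀ i, x i ≤ n := fun i =>
    (Finset.single_le_sum (fun _ _ => Nat.zero_le _) (Finset.mem_univ i)).trans hsum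
  refine ⟨hle, ?_⟩
  have hlea : ∀ a : Fin k → ℕ, (∀ i, a i = 0 ∨ a i + winLen d k ≤ x i + 1) → ∀ i, a i ≤ x i := by
    intro a ha i
    have := ha i
    omega
  have harrived : ∀ (a : Fin k → ℕ) (D : ℕ → ℕ), (∀ i, a i = 0 ∨ a i + winLen d k ≤ x i + 1) →
      (∀ i, x i < a i + winLen d k) → IsConf d I x p a D → Reach d I (∑ i, a i) D →
      ∃ m ≤ n, ∃ D : ℕ → ℕ, Reach d I m D ∧ (∀ y, D y ≤ n) ∧
        IsFinal k d I.tgt D (fun i => if h : i < k then x ⟨i, h⟩ else 0) := by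
    intro a D ha hend hc hr
    refine ⟨_, (Finset.sum_le_sum fun i _ => hlea a ha i).trans hsum, D, hr, hc.le,
      fun i hi => ⟨x ⟨i, hi⟩ - a ⟨i, hi⟩, ?_, ?_, ?_⟩⟩
    · have := hend ⟨i, hi⟩
      omega
    · have h1 := hend ⟨i, hi⟩
      have h2 := hlea a ha ⟨i, hi⟩
      rw [hc.win_eq ⟨i, hi⟩ _ (by omega), Nat.add_sub_cancel' h2, ext_of_mem (ht.pos _) le_rfl,
        (hp _).2]
      simp [Instance.tgt, hi]
    · have h2 := hlea a ha ⟨i, hi⟩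
      beta_reduce
      rw [hc.cnt_eq ⟨i, hi⟩, dif_pos hi, Nat.add_sub_cancel' h2]
  -- Each move raises `∑ i, a i` by one, and a window stops when it covers the end of its path; `r`
  -- bounds the moves that remain.
  have main : ∀ (r : ℕ) (a : Fin k → ℕ) (D : ℕ → ℕ), ∑ i, x i ≤ r + ∑ i, a i →
      (∀ i, a i = 0 ∨ a i + winLen d k ≤ x i + 1) → Admissible I.graph d x p a →
      IsConf d I x p a D → Reach d I (∑ i, a i) D → ∃ m ≤ n, ∃ D : ℕ → ℕ, Reach d I m D ∧
        (∀ y, D y ≤ n) ∧ IsFinal k d I.tgt D (fun i => if h : i < k then x ⟨i, h⟩ else 0) := by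
    intro r
    induction r with
    | zero =>
      intro a D hr ha hadm hc hD
      refine harrived a D ha (fun i => ?_) hc hD
      by_contra hlt
      have : ∑ i, a i < ∑ i, x i :=
        Finset.sum_lt_sum (fun i _ => hlea a ha i) ⟨i, Finset.mem_univ i, by omega⟩
      omega
    | succ r ih =>
      intro a D hr ha hadm hc hD
      by_cases hex : ∃ i, a i + winLen d k ≤ x i
      · obtain ⟨i, hi, hadm'⟩ := ht.exists_advance hd hd1 hadm hex
        obtain ⟨u, Y, hu, hY, hmove, hc'⟩ := hc.exists_move ht hd hd1 hle ha hi hadm'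
        have hs : ∑ l, Function.update a i (a i + 1) l = ∑ l, a l + 1 := by
          rw [Finset.sum_update_of_mem (Finset.mem_univ i),
            ← Finset.add_sum_erase _ _ (Finset.mem_univ i), Finset.sdiff_singleton_eq_erase]
          ring
        refine ih _ _ (by omega) (fun l => ?_) hadm' hc' ?_
        · by_cases hl : l = i
          · subst hl
            rw [Function.update_self]
            omega
          · rw [Function.update_of_ne hl]
            exact ha l
        · rw [hs]
          exact hD.step i.2 hu hY hmove
      · push Not at hex
        exact harrived a D ha hex hc hD
  obtain ⟨D, hc, hi, hadm⟩ := ht.exists_init (d := d) fun i => (hp i).1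
  refine main (∑ i, x i) _ D (by simp) (fun _ => Or.inl rfl) hadm hc ?_
  simpa using Reach.init hc.le hi

end Search

end DisjointPaths

namespace DisjointPaths

/-! ### Building expressions -/

namespace Expr

/-- Conjunction. -/
def and (a b : Expr) : Expr := op .mul a b

/-- Disjunction. -/
def or (a b : Expr) : Expr := op .add a b

/-- Equality test. -/
def eq (a b : Expr) : Expr := op .eq a b

/-- Comparison. -/
def lt (a b : Expr) : Expr := op .lt a b

/-- Negation. -/
def not (a : Expr) : Expr := op .eq a (const 0)

/-- Conjunction of `f 0, …, f (N - 1)`. -/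
def all (N : ℕ) (f : ℕ → Expr) : Expr := N.rec (const 1) fun i e => and e (f i)

/-- Disjunction of `f 0, …, f (N - 1)`. -/
def any (N : ℕ) (f : ℕ → Expr) : Expr := N.rec (const 0) fun i e => or e (f i)

/-- Truth of the value of an expression. -/
def Holds (σ : State) (e : Expr) : Prop := e.eval σ ≠ 0

variable {σ : State} {a b : Expr}

@[simp] theorem eval_const (c : ℕ) : (const c).eval σ = c := rfl

@[simp] theorem eval_reg (r : ℕ) : (reg r).eval σ = σ.reg r := rfl

@[simp] theorem eval_get (r : ℕ) : (get r a).eval σ = σ.arr r (a.eval σ) := rfl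

@[simp] theorem eval_op (o : Op) : (op o a b).eval σ = o.eval (a.eval σ) (b.eval σ) := rfl

@[simp] theorem holds_and : (and a b).Holds σ ↔ a.Holds σ ∧ b.Holds σ := by
  simp [Holds, and, Op.eval]

@[simp] theorem holds_or : (or a b).Holds σ ↔ a.Holds σ ∨ b.Holds σ := by
  simp [Holds, or, Op.eval]
  tauto

@[simp] theorem holds_eq : (eq a b).Holds σ ↔ a.eval σ = b.eval σ := by
  simp [Holds, eq, Op.eval]

@[simp] theorem holds_lt : (lt a b).Holds σ ↔ a.eval σ < b.eval σ := by
  simp [Holds, lt, Op.eval]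

@[simp] theorem holds_not : (not a).Holds σ ↔ ¬ a.Holds σ := by
  by_cases h : a.eval σ = 0 <;> simp [Holds, not, Op.eval, h]

@[simp] theorem holds_one : (const 1).Holds σ := by simp [Holds]

@[simp] theorem holds_all {N : ℕ} {f : ℕ → Expr} :
    (all N f).Holds σ ↔ ∀ i < N, (f i).Holds σ := by
  induction N with
  | zero => simp [all]
  | succ N ih =>
    show (and (all N f) (f N)).Holds σ ↔ _
    rw [holds_and, ih]
    simp only [Nat.lt_succ_iff_lt_or_eq, or_imp, forall_and, forall_eq]

@[simp] theorem holds_any {N : ℕ} {f : ℕ → Expr} :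
    (any N f).Holds σ ↔ ∃ i < N, (f i).Holds σ := by
  induction N with
  | zero => simp [any, Holds]
  | succ N ih =>
    show (or (any N f) (f N)).Holds σ ↔ _
    rw [holds_or, ih]
    simp only [Nat.lt_succ_iff_lt_or_eq, or_and_right, exists_or, exists_eq_left]

/-- A measure of the size of the values of an expression. -/
def wt : Expr → ℕ
  | const c => c + 2
  | reg _ => 1
  | get _ i => i.wt + 1
  | op _ e₁ e₂ => e₁.wt + e₂.wt

end Expr

/-- All numbers in the memory are at most `R`. -/
def State.Bdd (R : ℕ) (σ : State) : Prop := (∀ r, σ.reg r ≤ R) ∧ ∀ a i, σ.arr a i ≤ R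

theorem State.Bdd.setReg {R : ℕ} {σ : State} (h : σ.Bdd R) {r v : ℕ} (hv : v ≤ R) :
    (σ.setReg r v).Bdd R := by
  refine ⟨fun r' => ?_, h.2⟩
  unfold State.setReg
  by_cases hr : r' = r
  · subst hr
    simpa using hv
  · simpa [Function.update_of_ne hr] using h.1 r'

theorem State.Bdd.setArr {R : ℕ} {σ : State} (h : σ.Bdd R) {a i v : ℕ} (hv : v ≤ R) :
    (σ.setArr a i v).Bdd R := by
  refine ⟨h.1, fun a' i' => ?_⟩
  unfold State.setArr
  by_cases ha : a' = a
  · subst ha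
    by_cases hi : i' = i
    · subst hi
      simpa using hv
    · simpa [Function.update_of_ne hi] using h.2 a' i'
  · simpa [Function.update_of_ne ha] using h.2 a' i'

/-- With `2` added to all values, every operation is bounded by the product, so the value of an
expression is bounded by a power of `R + 2` with additive exponent `wt`. -/
theorem Op.eval_add_two_le (o : Op) (a b : ℕ) : o.eval a b + 2 ≤ (a + 2) * (b + 2) := by
  have h1 := Nat.div_le_self a b
  have h2 := Nat.mod_le a b
  have h3 : a + b + 4 ≤ (a + 2) * (b + 2) := by nlinarith
  cases o <;> simp only [Op.eval]
  · omega
  · omega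
  · nlinarith
  · omega
  · omega
  · split_ifs <;> omega
  · split_ifs <;> omega

theorem Expr.eval_le {R : ℕ} {σ : State} (h : σ.Bdd R) (e : Expr) :
    e.eval σ + 2 ≤ (R + 2) ^ e.wt := by
  induction e with
  | const c =>
    calc c + 2 ≤ 2 ^ (c + 2) := Nat.lt_two_pow_self.le
      _ ≤ (R + 2) ^ (c + 2) := Nat.pow_le_pow_left (by omega) _
  | reg r => simpa [Expr.wt] using h.1 r
  | get a i =>
    calc σ.arr a (i.eval σ) + 2 ≤ R + 2 := by have := h.2 a (i.eval σ); omega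
      _ ≤ (R + 2) ^ (i.wt + 1) := Nat.le_self_pow (by omega) _
  | op o e₁ e₂ h₁ h₂ =>
    calc o.eval (e₁.eval σ) (e₂.eval σ) + 2 ≤ (e₁.eval σ + 2) * (e₂.eval σ + 2) :=
          o.eval_add_two_le _ _
      _ ≤ (R + 2) ^ e₁.wt * (R + 2) ^ e₂.wt := Nat.mul_le_mul h₁ h₂
      _ = (R + 2) ^ (e₁.wt + e₂.wt) := (pow_add _ _ _).symm

theorem Expr.fits {R W : ℕ} {σ : State} (h : σ.Bdd R) (e : Expr) (hW : (R + 2) ^ e.wt ≤ W) :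
    e.Fits W σ := by
  have hv : e.eval σ ≤ W := by have := e.eval_le h; omega
  induction e with
  | const c => exact hv
  | reg r => exact hv
  | get a i ih =>
    have hi : (R + 2) ^ i.wt ≤ W := (Nat.pow_le_pow_right (by omega) (by simp [Expr.wt])).trans hW
    exact ⟨ih hi (by have := i.eval_le h; omega), hv⟩
  | op o e₁ e₂ h₁ h₂ =>
    have hi₁ : (R + 2) ^ e₁.wt ≤ W :=
      (Nat.pow_le_pow_right (by omega) (by simp [Expr.wt])).trans hW
    have hi₂ : (R + 2) ^ e₂.wt ≤ W :=
      (Nat.pow_le_pow_right (by omega) (by simp [Expr.wt])).trans hW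
    exact ⟨h₁ hi₁ (by have := e₁.eval_le h; omega), h₂ hi₂ (by have := e₂.eval_le h; omega), hv⟩

/-! ### Specifications of programs -/

/-- The sum of the sizes of the expressions of a program. -/
def Program.wt : Program → ℕ
  | .skip => 0
  | .assign _ e => e.wt
  | .store _ i e => i.wt + e.wt
  | .seq p q => p.wt + q.wt
  | .branch b p q => b.wt + p.wt + q.wt
  | .loop b p => b.wt + p.wt

/-- The constant factor in the running time of a program. -/
def Program.time : Program → ℕ
  | .skip => 1
  | .assign _ e => e.cost + 1
  | .store _ i e => i.cost + e.cost + 1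
  | .seq p q => p.time + q.time
  | .branch b p q => b.cost + 1 + p.time + q.time
  | .loop b p => 2 * (b.cost + 1 + p.time)

/-- From a memory with `P`, the program `p` leads to a memory with `Q` in time `O(b ^ e)`.
The numbers computed fit into words bounded by `W`, if this is large enough in comparison with the
bound `R` for the numbers stored. -/
def Spec (R W b : ℕ) (P : State → Prop) (p : Program) (Q : State → Prop) (e : ℕ) : Prop :=
  (R + 2) ^ p.wt ≤ W → ∀ σ, P σ → ∃ σ' t, Exec W p σ σ' t ∧ t ≤ p.time * b ^ e ∧ Q σ'

theorem pow_wt_le {R W m m' : ℕ} (h : m ≤ m') (hW : (R + 2) ^ m' ≤ W) : (R + 2) ^ m ≤ W :=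
  (Nat.pow_le_pow_right (by omega) h).trans hW

/-- Run `p` for each value of register `r` below `x`. -/
def forLoop (r : ℕ) (x : Expr) (p : Program) : Program :=
  .seq (.assign r (.const 0)) (.loop (.lt (.reg r) x)
    (.seq p (.assign r (.op .add (.reg r) (.const 1)))))

/-- Run `p 0, …, p (m - 1)` one after the other. -/
def seqN (m : ℕ) (p : ℕ → Program) : Program := m.rec .skip fun i q => .seq q (p i)

namespace Spec

variable {R W b e e' : ℕ} {P P' Q Q' S : State → Prop} {p q : Program}

theorem mono (h : Spec R W b P p Q e) (hP : ∀ σ, P' σ → P σ) (hQ : ∀ σ, Q σ → Q' σ) :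
    Spec R W b P' p Q' e := fun hW σ hσ =>
  let ⟨σ', t, h1, h2, h3⟩ := h hW σ (hP σ hσ)
  ⟨σ', t, h1, h2, hQ σ' h3⟩

theorem mono_time (h : Spec R W b P p Q e) (hb : 1 ≤ b) (he : e ≤ e') :
    Spec R W b P p Q e' := fun hW σ hσ =>
  let ⟨σ', t, h1, h2, h3⟩ := h hW σ hσ
  ⟨σ', t, h1, h2.trans (Nat.mul_le_mul_left _ (Nat.pow_le_pow_right hb he)), h3⟩

theorem skip (hb : 1 ≤ b) (h : ∀ σ, P σ → Q σ) : Spec R W b P .skip Q e :=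
  fun _ σ hσ => ⟨σ, 1, .skip σ, by simpa [Program.time] using Nat.one_le_pow _ _ hb, h σ hσ⟩

theorem assign {r : ℕ} {x : Expr} (hb : 1 ≤ b) (hR : ∀ σ, P σ → σ.Bdd R)
    (h : ∀ σ, P σ → Q (σ.setReg r (x.eval σ))) :
    Spec R W b P (.assign r x) Q e := fun hW σ hσ =>
  ⟨_, _, .assign σ r x (x.fits (hR σ hσ) hW), Nat.le_mul_of_pos_right _ (Nat.one_le_pow _ _ hb),
    h σ hσ⟩

theorem store {a : ℕ} {i x : Expr} (hb : 1 ≤ b) (hR : ∀ σ, P σ → σ.Bdd R)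
    (h : ∀ σ, P σ → Q (σ.setArr a (i.eval σ) (x.eval σ))) :
    Spec R W b P (.store a i x) Q e := fun hW σ hσ =>
  ⟨_, _, .store σ a i x (i.fits (hR σ hσ) (pow_wt_le (by simp [Program.wt]) hW))
    (x.fits (hR σ hσ) (pow_wt_le (by simp [Program.wt]) hW)),
    Nat.le_mul_of_pos_right _ (Nat.one_le_pow _ _ hb), h σ hσ⟩

theorem seq (h₁ : Spec R W b P p Q e) (h₂ : Spec R W b Q q S e) :
    Spec R W b P (.seq p q) S e := fun hW σ hσ =>
  let ⟨σ', t, a1, a2, a3⟩ := h₁ (pow_wt_le (by simp [Program.wt]) hW) σ hσ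
  let ⟨σ'', t', b1, b2, b3⟩ := h₂ (pow_wt_le (by simp [Program.wt]) hW) σ' a3
  ⟨σ'', t + t', .seq a1 b1, by rw [Program.time, add_mul]; omega, b3⟩

theorem branch {x : Expr} (hb : 1 ≤ b) (hR : ∀ σ, P σ → σ.Bdd R)
    (h₁ : Spec R W b (fun σ => P σ ∧ x.Holds σ) p Q e)
    (h₂ : Spec R W b (fun σ => P σ ∧ ¬ x.Holds σ) q Q e) :
    Spec R W b P (.branch x p q) Q e := by
  intro hW σ hσ
  have hx := x.fits (hR σ hσ) (pow_wt_le (by simp [Program.wt]; omega) hW)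
  have hbe : x.cost + 1 ≤ (x.cost + 1) * b ^ e :=
    Nat.le_mul_of_pos_right _ (Nat.one_le_pow _ _ hb)
  by_cases hv : x.Holds σ
  · obtain ⟨σ', t, a1, a2, a3⟩ := h₁ (pow_wt_le (by simp [Program.wt]; omega) hW) σ ⟨hσ, hv⟩
    exact ⟨σ', _, .branchTrue hx hv a1, by rw [Program.time, add_mul, add_mul _ p.time]; omega, a3⟩
  · obtain ⟨σ', t, a1, a2, a3⟩ := h₂ (pow_wt_le (by simp [Program.wt]) hW) σ ⟨hσ, hv⟩
    exact ⟨σ', _, .branchFalse hx (not_not.1 hv) a1,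
      by rw [Program.time, add_mul, add_mul _ p.time]; omega, a3⟩

/-- The invariant holds at the head of the loop with the counter equal to `j`, and the bound `x`
keeps its value `N` throughout. The factor `2` in `Program.time` pays for the tests and increments.
-/
theorem forLoop {r N f : ℕ} {x : Expr} (Inv : ℕ → State → Prop) (hN : N ≤ b ^ f) (hb : 1 ≤ b)
    (hP : ∀ σ, P σ → σ.Bdd R ∧ Inv 0 (σ.setReg r 0))
    (hI : ∀ j σ, Inv j σ → σ.Bdd R ∧ σ.reg r = j ∧ x.eval σ = N)
    (h : ∀ j < N, Spec R W b (Inv j) p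
      (fun σ => σ.Bdd R ∧ σ.reg r = j ∧ Inv (j + 1) (σ.setReg r (j + 1))) e) :
    Spec R W b P (forLoop r x p) (Inv N) (f + e) := by
  intro hW σ hσ
  have hbe : 1 ≤ b ^ e := Nat.one_le_pow _ _ hb
  obtain ⟨hR, h0⟩ := hP σ hσ
  have hwt : (DisjointPaths.forLoop r x p).wt = 2 + (1 + x.wt + (p.wt + (1 + 3))) := rfl
  have loop : ∀ m j, j + m = N → ∀ σ, Inv j σ → ∃ σ' t,
      Exec W (.loop (.lt (.reg r) x) (.seq p (.assign r (.op .add (.reg r) (.const 1))))) σ σ' t ∧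
      t ≤ m * (p.time * b ^ e + x.cost + 7) + (x.cost + 3) ∧ Inv N σ' := by
    intro m
    induction m with
    | zero =>
      rintro j rfl σ hσ
      obtain ⟨h1, h2, h3⟩ := hI _ σ hσ
      have hlt : ¬ (Expr.lt (.reg r) x).Holds σ := by
        rw [Expr.holds_lt, h3, Expr.eval_reg, h2]
        omega
      refine ⟨σ, _, .loopDone (Expr.fits h1 _
        (pow_wt_le (by rw [hwt]; simp [Expr.lt, Expr.wt]; omega) hW)) (not_not.1 hlt), ?_, hσ⟩
      simp [Expr.lt, Expr.cost]
      omega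
    | succ m ih =>
      intro j hj σ hσ
      obtain ⟨h1, h2, h3⟩ := hI _ σ hσ
      obtain ⟨σ', t, a1, a2, a3, a4, a5⟩ := h j (by omega) (pow_wt_le (by rw [hwt]; omega) hW) σ hσ
      obtain ⟨σ'', t', b1, b2, b3⟩ := ih (j + 1) (by omega) _ a5
      have hinc : Exec W (.assign r (.op .add (.reg r) (.const 1))) σ' (σ'.setReg r (j + 1)) 4 := by
        have := Exec.assign σ' r (.op .add (.reg r) (.const 1)) (Expr.fits a3 _
          (pow_wt_le (by rw [hwt]; simp [Expr.wt]; omega) hW))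
        simpa [Op.eval, a4, Expr.cost] using this
      have hlt : (Expr.lt (.reg r) x).Holds σ := by
        rw [Expr.holds_lt, h3, Expr.eval_reg, h2]
        omega
      refine ⟨σ'', _, .loopStep (Expr.fits h1 _
        (pow_wt_le (by rw [hwt]; simp [Expr.lt, Expr.wt]; omega) hW)) hlt
        (.seq a1 hinc) b1, ?_, b3⟩
      simp only [Expr.lt, Expr.cost]
      rw [add_mul]
      omega
  obtain ⟨σ', t, a1, a2, a3⟩ := loop N 0 (by omega) _ h0
  refine ⟨σ', _, .seq (.assign σ r (.const 0) (Expr.fits hR _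
    (pow_wt_le (by rw [hwt]; simp [Expr.wt]) hW))) a1, ?_, a3⟩
  have h1 : N * (p.time * b ^ e + x.cost + 7) ≤ b ^ f * ((p.time + x.cost + 7) * b ^ e) := by
    refine Nat.mul_le_mul hN ?_
    nlinarith [Nat.zero_le x.cost]
  have h2 : 1 ≤ b ^ f * b ^ e := Nat.one_le_iff_ne_zero.2 (by positivity)
  have h3 : (2 * (p.time + x.cost + 8)) * b ^ (f + e) =
      b ^ f * ((p.time + x.cost + 7) * b ^ e) + (p.time + x.cost + 9) * (b ^ f * b ^ e) := by
    rw [pow_add]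
    ring
  have h4 : x.cost + 9 ≤ (p.time + x.cost + 9) * (b ^ f * b ^ e) :=
    le_trans (by omega) (Nat.le_mul_of_pos_right _ h2)
  have h5 : (2 * (p.time + x.cost + 8)) * b ^ (f + e) ≤
      (DisjointPaths.forLoop r x p).time * b ^ (f + e) := by
    refine Nat.mul_le_mul_right _ ?_
    simp [DisjointPaths.forLoop, Program.time, Expr.cost, Expr.lt]
    omega
  simp only [Expr.cost]
  omega

theorem seqN {m : ℕ} {p : ℕ → Program} (Inv : ℕ → State → Prop) (hb : 1 ≤ b)
    (h : ∀ i < m, Spec R W b (Inv i) (p i) (Inv (i + 1)) e) :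
    Spec R W b (Inv 0) (seqN m p) (Inv m) e := by
  induction m with
  | zero => exact Spec.skip hb fun _ h => h
  | succ m ih => exact (ih fun i hi => h i (by omega)).seq (h m (by omega))

end Spec

end DisjointPaths

namespace DisjointPaths

/-! ### Digits -/

/-- The `j`-th digit of `q` in base `b`. -/
def digit (b q j : ℕ) : ℕ := q / b ^ j % b

/-- The number with digits `f 0, …, f (S - 1)` in base `b`. -/
def code (b S : ℕ) (f : ℕ → ℕ) : ℕ := ∑ j ∈ Finset.range S, f j * b ^ j

theorem digit_lt {b : ℕ} (hb : 0 < b) (q j : ℕ) : digit b q j < b := Nat.mod_lt _ hb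

theorem code_lt {b S : ℕ} {f : ℕ → ℕ} (h : ∀ j < S, f j < b) : code b S f < b ^ S := by
  induction S with
  | zero => simp [code]
  | succ S ih =>
    have h1 := ih fun j hj => h j (by omega)
    have h2 : (f S + 1) * b ^ S ≤ b * b ^ S := Nat.mul_le_mul_right _ (h S (by omega))
    unfold code at *
    rw [Finset.sum_range_succ, pow_succ']
    nlinarith

theorem digit_code {b S : ℕ} {f : ℕ → ℕ} (h : ∀ j < S, f j < b) {j : ℕ} (hj : j < S) :
    digit b (code b S f) j = f j := by
  have hb : 0 < b := (Nat.zero_le _).trans_lt (h j hj)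
  induction S with
  | zero => omega
  | succ S ih =>
    have hs : code b (S + 1) f = code b S f + f S * b ^ S := Finset.sum_range_succ _ _
    unfold digit at *
    rw [hs]
    rcases Nat.lt_succ_iff_lt_or_eq.1 hj with h1 | rfl
    · obtain ⟨m, rfl⟩ := Nat.exists_eq_add_of_lt h1
      have e : f (j + m + 1) * b ^ (j + m + 1) = b ^ j * (b * (f (j + m + 1) * b ^ m)) := by ring
      rw [e, Nat.add_mul_div_left _ _ (pow_pos hb j), Nat.add_mul_mod_self_left]
      exact ih (fun i hi => h i (by omega)) h1
    · rw [Nat.add_mul_div_right _ _ (pow_pos hb j),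
        Nat.div_eq_of_lt (code_lt fun i hi => h i (by omega)), zero_add, Nat.mod_eq_of_lt (h j hj)]

theorem code_digit (b S q : ℕ) : code b S (digit b q) = q % b ^ S := by
  induction S with
  | zero => simp [code, Nat.mod_one]
  | succ S ih =>
    have hs : code b (S + 1) (digit b q) = code b S (digit b q) + digit b q S * b ^ S :=
      Finset.sum_range_succ _ _
    rw [hs, ih, Nat.mod_pow_succ, digit, mul_comm]

theorem code_congr {b S : ℕ} {f g : ℕ → ℕ} (h : ∀ j < S, f j = g j) : code b S f = code b S g :=
  Finset.sum_congr rfl fun j hj => by rw [h j (Finset.mem_range.1 hj)]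

theorem eq_code {b S q : ℕ} {f : ℕ → ℕ} (hq : q < b ^ S) (h : ∀ j < S, digit b q j = f j) :
    q = code b S f := by
  rw [← code_congr h, code_digit, Nat.mod_eq_of_lt hq]

/-! ### The input in the memory -/

variable {n k : ℕ}

/-- The memory contains the input, and numbers at most `R`. -/
def Instance.Env (I : Instance n k) (R : ℕ) (σ : State) : Prop :=
  σ.Bdd R ∧ σ.reg 0 = n ∧ σ.arr 0 = I.initial.arr 0 ∧ σ.arr 1 = I.initial.arr 1

namespace Expr

/-- The base `n + 1`. -/
def base : Expr := op .add (reg 0) (const 1)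

/-- The power `(n + 1) ^ j`. -/
def powB (j : ℕ) : Expr := j.rec (const 1) fun _ e => op .mul e base

/-- The `j`-th digit in base `n + 1`. -/
def dig (q : Expr) (j : ℕ) : Expr := op .mod (op .div q (powB j)) base

/-- The number with given digits in base `n + 1`. -/
def num (S : ℕ) (f : ℕ → Expr) : Expr :=
  S.rec (const 0) fun j e => op .add e (op .mul (f j) (powB j))

/-- Adjacency of vertices. -/
def adj (u v : Expr) : Expr :=
  and (and (lt u (reg 0)) (lt v (reg 0))) (get 0 (op .add (op .mul (reg 0) u) v))

section Eval

variable {I : Instance n k} {R : ℕ} {σ : State} (h : I.Env R σ)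
include h

theorem eval_base : base.eval σ = n + 1 := by simp [base, Op.eval, h.2.1]

theorem eval_powB (j : ℕ) : (powB j).eval σ = (n + 1) ^ j := by
  induction j with
  | zero => rfl
  | succ j ih =>
    show (powB j).eval σ * base.eval σ = _
    rw [ih, eval_base h, pow_succ]

theorem eval_dig (q : Expr) (j : ℕ) : (dig q j).eval σ = digit (n + 1) (q.eval σ) j := by
  simp [dig, Op.eval, eval_base h, eval_powB h, digit]

theorem eval_num (S : ℕ) (f : ℕ → Expr) :
    (num S f).eval σ = code (n + 1) S fun j => (f j).eval σ := by
  induction S with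
  | zero => rfl
  | succ S ih =>
    show (num S f).eval σ + (f S).eval σ * (powB S).eval σ = _
    rw [ih, eval_powB h, code, code, Finset.sum_range_succ]

/-- Without the range tests the entry `n * u + v` might belong to another pair. The tests also make
the blank `n` adjacent to nothing. -/
theorem holds_adj (u v : Expr) : (adj u v).Holds σ ↔ I.adj (u.eval σ) (v.eval σ) := by
  rw [adj, holds_and, holds_and, holds_lt, holds_lt, Expr.eval_reg, h.2.1]
  simp only [Holds, eval_get, eval_op, Op.eval, eval_reg, h.2.1, h.2.2.1, Instance.initial]
  simp only [if_true, ne_eq, ite_eq_right_iff, one_ne_zero, imp_false, not_not]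
  constructor
  · rintro ⟨⟨hu, hv⟩, u', v', e, ha⟩
    have hn : 0 < n := by omega
    have e1 : v.eval σ = v' := by
      have := congrArg (· % n) e
      simpa [Nat.mod_eq_of_lt hv, Nat.mod_eq_of_lt v'.2] using this
    have e2 : u.eval σ = u' := by
      rw [e1] at e
      exact Nat.eq_of_mul_eq_mul_left hn (by omega)
    refine ⟨hu, hv, ?_⟩
    convert ha
  · rintro ⟨hu, hv, ha⟩
    exact ⟨⟨hu, hv⟩, ⟨_, hu⟩, ⟨_, hv⟩, rfl, ha⟩

theorem eval_src {i : ℕ} (hi : i < k) : (get 1 (const (2 * i))).eval σ = I.src i := by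
  rw [eval_get, h.2.2.2, eval_const, Instance.src, dif_pos hi, Instance.initial]
  simp only [one_ne_zero, if_false, if_true]
  rw [dif_pos (by omega), if_pos (by omega)]
  congr
  omega

theorem eval_tgt {i : ℕ} (hi : i < k) : (get 1 (const (2 * i + 1))).eval σ = I.tgt i := by
  rw [eval_get, h.2.2.2, eval_const, Instance.tgt, dif_pos hi, Instance.initial]
  simp only [one_ne_zero, if_false, if_true]
  rw [dif_pos (by omega), if_neg (by omega)]
  congr
  omega

end Eval

/-! ### The conditions on configurations -/

section Config

variable (d k : ℕ) (D : ℕ → Expr)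

/-- Entry of a window. -/
def win (i j : ℕ) : Expr := D (i * winLen d k + j)

/-- Starting position of a window. -/
def cnt (i : ℕ) : Expr := D (k * winLen d k + i)

/-- Entry of the list of exceptions. -/
def exc (m : ℕ) : Expr := D (k * winLen d k + k + m)

/-- Moving a window. -/
def shift (i : ℕ) (u : Expr) (Y : ℕ → Expr) (x : ℕ) : Expr :=
  if k * winLen d k + k ≤ x then Y (x - (k * winLen d k + k))
  else if x = k * winLen d k + i then op .add (D x) (const 1)
  else if i * winLen d k ≤ x ∧ x + 1 < i * winLen d k + winLen d k then D (x + 1)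
  else if x + 1 = i * winLen d k + winLen d k then u
  else D x

/-- Expression for `Seen`. -/
def seen (v : Expr) : Expr :=
  any k fun i => and (and (lt (win d k D i 0) (reg 0)) (lt (win d k D i (winLen d k - 1)) (reg 0)))
    (and (any (d + 2) fun j => adj (win d k D i j) v)
      (any (d + 2) fun j => adj (win d k D i (d + 2 + j)) v))

/-- Expression for `InBag`. -/
def inBag (v : Expr) : Expr := any k fun i => any (winLen d k) fun j => eq (win d k D i j) v

/-- Expression for `IsExc`. -/
def isExc (v : Expr) : Expr := any (excLen d k) fun m => eq (exc d k D m) v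

/-- Expression for `Past`. -/
def past (v : Expr) : Expr := and (seen d k D v) (and (not (inBag d k D v)) (not (isExc d k D v)))

/-- Expression for `IsInit`. -/
def isInit : Expr :=
  and (all k fun i => and
      (and (eq (cnt d k D i) (const 0))
        (and (eq (win d k D i 0) (reg 0)) (eq (win d k D i 1) (get 1 (const (2 * i))))))
      (all (winLen d k - 2) fun j => or (eq (win d k D i (j + 2)) (reg 0))
        (adj (win d k D i (j + 1)) (win d k D i (j + 2)))))
    (all k fun i => all k fun i' => or (const (if i = i' then 1 else 0))
      (all (winLen d k) fun j => all (winLen d k) fun j' =>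
        or (not (eq (win d k D i j) (win d k D i' j'))) (eq (win d k D i j) (reg 0))))

/-- Expression for the part of `IsMove` without a quantifier over the vertices. -/
def isMove (i : ℕ) (u : Expr) (Y : ℕ → Expr) : Expr :=
  and (and (lt (cnt d k D i) (reg 0)) (adj (win d k D i (winLen d k - 1)) u))
    (and (and (not (inBag d k D u)) (not (past d k D u)))
      (or (eq (win d k D i 0) (reg 0)) (past d k (shift d k D i u Y) (win d k D i 0))))

/-- Expression for the part of `IsMove` about the vertex `v`. -/
def keeps (i : ℕ) (u : Expr) (Y : ℕ → Expr) (v : Expr) : Expr :=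
  or (not (past d k D v)) (past d k (shift d k D i u Y) v)

/-- Expression for `IsFinal`. -/
def isFinal (x : ℕ → Expr) : Expr :=
  all k fun i => any (winLen d k) fun j =>
    and (eq (win d k D i j) (get 1 (const (2 * i + 1))))
      (eq (x i) (op .add (cnt d k D i) (const j)))

end Config

/-- Expression for the order of tuples. -/
def tupLt (k : ℕ) (y x : ℕ → Expr) : Expr :=
  and (all k fun i => not (lt (x i) (y i))) (any k fun i => lt (y i) (x i))

section HoldsConfig

variable {I : Instance n k} {R d : ℕ} {σ : State} {D : ℕ → Expr} {D' : ℕ → ℕ}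
  (h : I.Env R σ) (hD : ∀ x, (D x).eval σ = D' x)
include h hD

omit h in
theorem holds_inBag (v : Expr) : (inBag d k D v).Holds σ ↔ InBag k d D' (v.eval σ) := by
  simp only [inBag, holds_any, holds_eq, win, hD]
  rfl

theorem holds_past (v : Expr) : (past d k D v).Holds σ ↔ Past n k d I.adj D' (v.eval σ) := by
  simp only [past, seen, inBag, isExc, holds_any, holds_and, holds_not, holds_eq, holds_lt, win,
    exc, hD, holds_adj h, eval_reg, h.2.1]
  rfl

omit h in
theorem eval_shift (i : ℕ) (u : Expr) {Y : ℕ → Expr} {Y' : ℕ → ℕ}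
    (hY : ∀ x, (Y x).eval σ = Y' x) (x : ℕ) :
    (shift d k D i u Y x).eval σ = DisjointPaths.shift d k i D' (u.eval σ) Y' x := by
  unfold shift DisjointPaths.shift
  split_ifs <;> simp [hD, hY, Op.eval]

theorem holds_isInit : (isInit d k D).Holds σ ↔ IsInit n k d I.adj I.src D' := by
  simp only [isInit, holds_and, holds_all, holds_or, holds_not, holds_eq, win, cnt, hD,
    holds_adj h, eval_reg, eval_const, h.2.1]
  refine and_congr ?_ ?_
  · refine forall₂_congr fun i hi => ?_
    rw [eval_src h hi]
    rfl
  · refine forall₂_congr fun i hi => forall₂_congr fun i' hi' => ?_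
    by_cases e : i = i'
    · simp [e, Holds]
    · simp only [e, Holds, if_false, eval_const, ne_eq, not_true_eq_false, false_or,
        not_false_eq_true, true_imp_iff, ← imp_iff_not_or]
      rfl

theorem holds_isMove {i : ℕ} {u : Expr} {Y : ℕ → Expr} {Y' : ℕ → ℕ}
    (hY : ∀ x, (Y x).eval σ = Y' x) :
    (isMove d k D i u Y).Holds σ ↔
      ((DisjointPaths.cnt d k D' i < n ∧
          I.adj (DisjointPaths.win d k D' i (winLen d k - 1)) (u.eval σ)) ∧
        (¬ InBag k d D' (u.eval σ) ∧ ¬ Past n k d I.adj D' (u.eval σ)) ∧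
        (DisjointPaths.win d k D' i 0 = n ∨
          Past n k d I.adj (DisjointPaths.shift d k i D' (u.eval σ) Y')
            (DisjointPaths.win d k D' i 0))) := by
  simp only [isMove, holds_and, holds_or, holds_not, holds_eq, holds_lt, holds_inBag hD,
    holds_past h hD, holds_past h (eval_shift hD i u hY), holds_adj h, eval_reg, h.2.1, win, cnt, hD]
  rfl

theorem holds_keeps {i : ℕ} {u : Expr} {Y : ℕ → Expr} {Y' : ℕ → ℕ}
    (hY : ∀ x, (Y x).eval σ = Y' x) (v : Expr) :
    (keeps d k D i u Y v).Holds σ ↔ (Past n k d I.adj D' (v.eval σ) →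
      Past n k d I.adj (DisjointPaths.shift d k i D' (u.eval σ) Y') (v.eval σ)) := by
  simp only [keeps, holds_or, holds_not, holds_past h hD, holds_past h (eval_shift hD i u hY),
    imp_iff_not_or]

theorem holds_isFinal {x : ℕ → Expr} {x' : ℕ → ℕ} (hx : ∀ i, (x i).eval σ = x' i) :
    (isFinal d k D x).Holds σ ↔ IsFinal k d I.tgt D' x' := by
  simp only [isFinal, holds_all, holds_any, holds_and, holds_eq, win, cnt, hD, hx, eval_op, Op.eval,
    eval_const]
  refine forall₂_congr fun i hi => ?_
  rw [eval_tgt h hi]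
  rfl

end HoldsConfig

theorem holds_tupLt {σ : State} {x y : ℕ → Expr} {x' y' : ℕ → ℕ} (hx : ∀ i, (x i).eval σ = x' i)
    (hy : ∀ i, (y i).eval σ = y' i) :
    (tupLt k y x).Holds σ ↔ (fun i : Fin k => y' i) < fun i : Fin k => x' i := by
  simp only [tupLt, holds_and, holds_all, holds_any, holds_not, holds_lt, hx, hy, not_lt]
  rw [Pi.lt_def]
  refine and_congr ⟨fun h i => h i i.2, fun h i hi => h ⟨i, hi⟩⟩
    ⟨fun ⟨i, hi, h⟩ => ⟨⟨i, hi⟩, h⟩, fun ⟨i, h⟩ => ⟨i, i.2, h⟩⟩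

end Expr

end DisjointPaths

namespace DisjointPaths

/-! ### Updates of the memory -/

section Updates

variable {σ : State}

@[simp] theorem State.setReg_reg (r v r' : ℕ) :
    (σ.setReg r v).reg r' = if r' = r then v else σ.reg r' := by
  simp [State.setReg, Function.update_apply]

@[simp] theorem State.setReg_arr (r v : ℕ) : (σ.setReg r v).arr = σ.arr := rfl

@[simp] theorem State.setArr_reg (a i v : ℕ) : (σ.setArr a i v).reg = σ.reg := rfl

@[simp] theorem State.setArr_arr (a i v a' i' : ℕ) :
    (σ.setArr a i v).arr a' i' = if a' = a ∧ i' = i then v else σ.arr a' i' := by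
  unfold State.setArr
  by_cases h : a' = a
  · subst h
    simp [Function.update_apply]
  · simp [h]

theorem State.setArr_arr_of_ne {a a' : ℕ} (h : a' ≠ a) (i v : ℕ) :
    (σ.setArr a i v).arr a' = σ.arr a' := by
  funext i'
  simp [h]

theorem State.setReg_setReg (r v w : ℕ) : (σ.setReg r v).setReg r w = σ.setReg r w := by
  simp [State.setReg]

theorem State.setReg_comm {r s : ℕ} (h : r ≠ s) (v w : ℕ) :
    (σ.setReg r v).setReg s w = (σ.setReg s w).setReg r v := by
  simp [State.setReg, Function.update_comm h]

end Updates

variable {n k d R W : ℕ} {I : Instance n k} {σ : State}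

theorem Instance.Env.setReg (h : I.Env R σ) {r v : ℕ} (hr : r ≠ 0) (hv : v ≤ R) :
    I.Env R (σ.setReg r v) :=
  ⟨h.1.setReg hv, by simp [hr.symm, h.2.1], h.2.2⟩

theorem Instance.Env.setArr (h : I.Env R σ) {a i v : ℕ} (ha : 2 ≤ a) (hv : v ≤ R) :
    I.Env R (σ.setArr a i v) := by
  refine ⟨h.1.setArr hv, h.2.1, ?_, ?_⟩
  · rw [State.setArr_arr_of_ne (by omega), h.2.2.1]
  · rw [State.setArr_arr_of_ne (by omega), h.2.2.2]

/-! ### Loops -/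

/-- This fixes the initial memory, so that intermediate assertions can refer to it. -/
theorem Spec.of_forall {b e : ℕ} {P Q : State → Prop} {p : Program}
    (h : ∀ σ₀, P σ₀ → Spec R W b (· = σ₀) p Q e) : Spec R W b P p Q e :=
  fun hW σ hσ => h σ hσ hW σ rfl

/-- The program contains an assignment to register `r`. -/
def Program.Writes (r : ℕ) : Program → Prop
  | .skip => False
  | .assign s _ => s = r
  | .store _ _ _ => False
  | .seq p q => p.Writes r ∨ q.Writes r
  | .branch _ p q => p.Writes r ∨ q.Writes r
  | .loop _ p => p.Writes r

theorem Exec.reg_eq {p : Program} {σ σ' : State} {t r : ℕ} (h : Exec W p σ σ' t)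
    (hr : ¬ p.Writes r) : σ'.reg r = σ.reg r := by
  induction h with
  | skip => rfl
  | assign σ s e _ =>
    rw [State.setReg_reg, if_neg (Ne.symm hr)]
  | store => rfl
  | seq _ _ h₁ h₂ => exact (h₂ fun h => hr (.inr h)).trans (h₁ fun h => hr (.inl h))
  | branchTrue _ _ _ h => exact h fun h => hr (.inl h)
  | branchFalse _ _ _ h => exact h fun h => hr (.inr h)
  | loopDone => rfl
  | loopStep _ _ _ _ h₁ h₂ => exact (h₂ hr).trans (h₁ hr)

/-- Carries the counter of an enclosing loop through a body whose specification does not mention it.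
-/
theorem Spec.frame {b e r c : ℕ} {P Q : State → Prop} {p : Program} (h : Spec R W b P p Q e)
    (hr : ¬ p.Writes r) :
    Spec R W b (fun σ => P σ ∧ σ.reg r = c) p (fun σ => Q σ ∧ σ.reg r = c) e :=
  fun hW σ hσ =>
    let ⟨σ', t, h1, h2, h3⟩ := h hW σ hσ.1
    ⟨σ', t, h1, h2, h3, (h1.reg_eq hr).trans hσ.2⟩

theorem Spec.forEach {P : State → Prop} {p : Program} {e r N f : ℕ} {x : Expr}
    (J : ℕ → State → Prop) (hN : N ≤ (n + 1) ^ f) (hNR : N ≤ R)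
    (hx : ∀ σ, I.Env R σ → x.eval σ = N) (hE : ∀ j σ, J j σ → I.Env R σ)
    (hJ : ∀ j v σ, v ≤ R → J j σ → J j (σ.setReg r v)) (hP : ∀ σ, P σ → J 0 σ)
    (h : ∀ j < N, Spec R W (n + 1) (fun σ => J j σ ∧ σ.reg r = j) p
      (fun σ => J (j + 1) σ ∧ σ.reg r = j) e) :
    Spec R W (n + 1) P (DisjointPaths.forLoop r x p) (J N) (f + e) := by
  refine (Spec.forLoop (fun j σ => J j σ ∧ σ.reg r = j) hN (by omega) (fun σ hσ => ?_)
    (fun j σ hσ => ?_) fun j hj => ?_).mono (fun _ => id) fun σ hσ => hσ.1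
  · exact ⟨(hE _ _ (hP σ hσ)).1, hJ _ _ _ (by omega) (hP σ hσ), by simp⟩
  · exact ⟨(hE _ _ hσ.1).1, hσ.2, hx σ (hE _ _ hσ.1)⟩
  · refine (h j hj).mono (fun _ => id) fun σ hσ => ⟨(hE _ _ hσ.1).1, hσ.2, ?_⟩
    exact ⟨hJ _ _ _ (by omega) hσ.1, by simp⟩

/-- Set register `10` to `1` if `init` holds and `φ` holds for all values of register `r` below `x`,
and to `0` otherwise. -/
def checkAll (r : ℕ) (x init φ : Expr) : Program :=
  .seq (.assign 10 (.lt (.const 0) init))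
    (forLoop r x (.assign 10 (.lt (.const 0) (.and (.reg 10) φ))))

/-- Truth values are sums and products and may exceed `R`; comparing with `0` reduces them to `0` or
`1` before they are stored. The final memory is given exactly, so everything else is known to be
unchanged. -/
theorem spec_checkAll (h : I.Env R σ) {r N f : ℕ} (hr : r ≠ 0) (hr' : r ≠ 10) {x init φ : Expr}
    (hN : N ≤ (n + 1) ^ f) (hNR : N ≤ R) (hR : 1 ≤ R) (hx : ∀ σ, I.Env R σ → x.eval σ = N)
    {Φ : ℕ → Prop} (hφ : ∀ v < N, ∀ w ≤ 1, φ.Holds ((σ.setReg 10 w).setReg r v) ↔ Φ v) :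
    Spec R W (n + 1) (· = σ) (checkAll r x init φ)
      (fun τ => ∃ w ≤ 1, τ = (σ.setReg 10 w).setReg r N ∧
        (w ≠ 0 ↔ init.Holds σ ∧ ∀ v < N, Φ v)) f := by
  have hE : ∀ w ≤ 1, ∀ v ≤ R, I.Env R ((σ.setReg 10 w).setReg r v) := fun w hw v hv =>
    (h.setReg (by omega) (by omega)).setReg hr hv
  have hlt : ∀ (τ : State) (y : Expr), (Expr.lt (.const 0) y).eval τ ≤ 1 := fun τ y => by
    simp only [Expr.lt, Expr.eval_op, Op.eval]
    split_ifs <;> omega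
  have hlt' : ∀ (τ : State) (y : Expr), (Expr.lt (.const 0) y).eval τ ≠ 0 ↔ y.Holds τ :=
    fun τ y => Expr.holds_lt.trans Nat.pos_iff_ne_zero
  refine Spec.seq (Q := fun τ => ∃ w ≤ 1, τ = σ.setReg 10 w ∧ (w ≠ 0 ↔ init.Holds σ))
    (Spec.assign (by omega) (by rintro _ rfl; exact h.1) ?_) ?_
  · rintro _ rfl
    exact ⟨_, hlt _ _, rfl, hlt' _ _⟩
  · refine (Spec.forLoop (e := 0) (fun j τ => j ≤ N ∧ ∃ w ≤ 1, τ = (σ.setReg 10 w).setReg r j ∧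
      (w ≠ 0 ↔ init.Holds σ ∧ ∀ v < j, Φ v)) hN (by omega) ?_ ?_ fun j hj => ?_).mono
      (fun _ => id) fun τ hτ => hτ.2
    · rintro _ ⟨w, hw, rfl, hi⟩
      exact ⟨(h.setReg (by omega) (by omega)).1, by omega, w, hw, rfl, by simpa using hi⟩
    · rintro j _ ⟨hj, w, hw, rfl, hi⟩
      exact ⟨(hE w hw j (by omega)).1, by simp, hx _ (hE w hw j (by omega))⟩
    · refine Spec.assign (by omega) ?_ ?_
      · rintro _ ⟨hj, w, hw, rfl, hi⟩
        exact (hE w hw j (by omega)).1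
      · rintro _ ⟨hj', w, hw, rfl, hi⟩
        have h1 : ∀ v, (((σ.setReg 10 w).setReg r j).setReg 10 v) = (σ.setReg 10 v).setReg r j :=
          fun v => by rw [State.setReg_comm hr', State.setReg_setReg]
        rw [h1]
        have hle := hlt ((σ.setReg 10 w).setReg r j) (.and (.reg 10) φ)
        refine ⟨(hE _ hle _ (by omega)).1, by simp, by omega, _, hle, ?_, ?_⟩
        · rw [State.setReg_setReg]
        · rw [hlt', Expr.holds_and, hφ j hj w hw]
          have : (Expr.reg 10).Holds ((σ.setReg 10 w).setReg r j) ↔ w ≠ 0 := by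
            simp [Expr.Holds, hr'.symm]
          rw [this, hi]
          simp only [Nat.lt_succ_iff_lt_or_eq, or_imp, forall_and, forall_eq, and_assoc]

/-! ### The search -/

/-- The tuple with code `x` is at least some quality. -/
def Instance.Dominated (I : Instance n k) (x : ℕ) : Prop :=
  ∃ y, I.IsQuality y ∧ ∀ i : Fin k, y i ≤ digit (n + 1) x i

/-- During the search array `3` marks configurations, among them those in `V`, and array `4` marks
tuples, among them those in `U`. -/
def Instance.Inv (I : Instance n k) (d R : ℕ) (V U : Set ℕ) (σ : State) : Prop :=
  (I.Env R σ ∧ σ.reg 1 = 0) ∧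
    ((∀ q, σ.arr 3 q ≠ 0 → IsSound n k d I.adj I.src (digit (n + 1) q)) ∧ ∀ q ∈ V, σ.arr 3 q ≠ 0) ∧
    (∀ x, σ.arr 4 x ≠ 0 → I.Dominated x) ∧ ∀ x ∈ U, σ.arr 4 x ≠ 0

variable {V U : Set ℕ}

/-- The sets are only lower bounds for what is marked. Additional marks do no harm, since every mark
is sound. -/
theorem Instance.Inv.anti (h : I.Inv d R V U σ) {V' U' : Set ℕ} (hV : V' ⊆ V) (hU : U' ⊆ U) :
    I.Inv d R V' U' σ :=
  ⟨h.1, ⟨h.2.1.1, fun q hq => h.2.1.2 q (hV hq)⟩, h.2.2.1, fun x hx => h.2.2.2 x (hU hx)⟩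

theorem Instance.Inv.setReg (h : I.Inv d R V U σ) {r v : ℕ} (hr : 2 ≤ r) (hv : v ≤ R) :
    I.Inv d R V U (σ.setReg r v) :=
  ⟨⟨h.1.1.setReg (by omega) hv, by simp [h.1.2]; omega⟩, h.2⟩

theorem Instance.Inv.mark (h : I.Inv d R V U σ) (hR : 1 ≤ R) {q : ℕ}
    (hq : IsSound n k d I.adj I.src (digit (n + 1) q)) :
    I.Inv d R (insert q V) U (σ.setArr 3 q 1) := by
  refine ⟨⟨h.1.1.setArr (by omega) hR, h.1.2⟩, ⟨fun q' => ?_, fun q' hq' => ?_⟩, ?_⟩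
  · by_cases e : q' = q
    · subst e
      exact fun _ => hq
    · simpa [e] using h.2.1.1 q'
  · by_cases e : q' = q
    · simp [e]
    · simpa [e] using h.2.1.2 q' (hq'.resolve_left e)
  · rw [State.setArr_arr_of_ne (by omega)]
    exact h.2.2

theorem Instance.Inv.markTuple (h : I.Inv d R V U σ) (hR : 1 ≤ R) {x : ℕ} (hx : I.Dominated x) :
    I.Inv d R V (insert x U) (σ.setArr 4 x 1) := by
  refine ⟨⟨h.1.1.setArr (by omega) hR, h.1.2⟩, ?_, fun q' => ?_, fun q' hq' => ?_⟩
  · rw [State.setArr_arr_of_ne (by omega)]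
    exact h.2.1
  · by_cases e : q' = x
    · subst e
      exact fun _ => hx
    · simpa [e] using h.2.2.1 q'
  · by_cases e : q' = x
    · simp [e]
    · simpa [e] using h.2.2.2 q' (hq'.resolve_left e)

/-- Mark the configurations at the start. -/
def markInit (d k : ℕ) : Program :=
  forLoop 7 (.powB (confLen d k)) (.branch (.isInit d k (.dig (.reg 7)))
    (.store 3 (.reg 7) (.const 1)) .skip)

theorem spec_markInit (hR : (n + 1) ^ confLen d k ≤ R) :
    Spec R W (n + 1) (I.Inv d R ∅ ∅) (markInit d k)
      (I.Inv d R {q | q < (n + 1) ^ confLen d k ∧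
        IsInit n k d I.adj I.src (digit (n + 1) q)} ∅) (confLen d k) := by
  have hR1 : 1 ≤ R := (Nat.one_le_pow _ _ (by omega)).trans hR
  refine Spec.forEach (I := I) (e := 0) (fun j => I.Inv d R {q | q < j ∧
      IsInit n k d I.adj I.src (digit (n + 1) q)} ∅) le_rfl hR
    (fun σ h => Expr.eval_powB h _) (fun j σ h => h.1.1) (fun j v σ hv h => h.setReg (by omega) hv)
    (fun σ h => h.anti (fun q hq => absurd hq.1 (by omega)) subset_rfl) fun j hj => ?_
  refine Spec.branch (by omega) (fun σ h => h.1.1.1.1) ?_ ?_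
  · refine Spec.store (by omega) (fun σ h => h.1.1.1.1.1) ?_
    rintro σ ⟨⟨h, rfl⟩, hh⟩
    rw [Expr.holds_isInit h.1.1 fun x => Expr.eval_dig h.1.1 _ x] at hh
    refine ⟨(h.mark hR1 hh.isSound).anti ?_ subset_rfl, rfl⟩
    rintro q ⟨hq, hq'⟩
    rcases Nat.lt_succ_iff_lt_or_eq.1 hq with h1 | h1
    · exact Or.inr ⟨h1, hq'⟩
    · exact Or.inl h1
  · refine Spec.skip (by omega) ?_
    rintro σ ⟨⟨h, rfl⟩, hh⟩
    rw [Expr.holds_isInit h.1.1 fun x => Expr.eval_dig h.1.1 _ x] at hh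
    refine ⟨h.anti ?_ subset_rfl, rfl⟩
    rintro q ⟨hq, hq'⟩
    rcases Nat.lt_succ_iff_lt_or_eq.1 hq with h1 | h1
    · exact ⟨h1, hq'⟩
    · subst h1
      exact absurd hq' hh

/-- The window `i` of the configuration with code `q` may be moved as described by `c`. -/
def Instance.Moves (I : Instance n k) (d i q c : ℕ) : Prop :=
  IsMove n k d I.adj i (digit (n + 1) q) (digit (n + 1) c 0) fun m => digit (n + 1) c (1 + m)

/-- The code of the configuration after such a move. -/
def next (n d k i q c : ℕ) : ℕ :=
  code (n + 1) (confLen d k)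
    (shift d k i (digit (n + 1) q) (digit (n + 1) c 0) fun m => digit (n + 1) c (1 + m))

theorem shift_le {D Y : ℕ → ℕ} {i u : ℕ} (hD : ∀ x, D x ≤ n) (hY : ∀ x, Y x ≤ n) (hu : u ≤ n)
    (hc : cnt d k D i < n) (x : ℕ) : shift d k i D u Y x ≤ n := by
  unfold shift
  split_ifs with h1 h2
  · exact hY _
  · subst h2
    exact hc
  · exact hD _
  · exact hu
  · exact hD _

theorem digit_le (n q j : ℕ) : digit (n + 1) q j ≤ n := Nat.lt_succ_iff.1 (digit_lt (by omega) q j)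

theorem Instance.Moves.digit_next {i q c : ℕ} (h : I.Moves d i q c) {x : ℕ} (hx : x < confLen d k) :
    digit (n + 1) (next n d k i q c) x = shift d k i (digit (n + 1) q) (digit (n + 1) c 0)
      (fun m => digit (n + 1) c (1 + m)) x :=
  digit_code (fun x _ => Nat.lt_succ_iff.2 (shift_le (digit_le n q) (fun _ => digit_le n c _)
    (digit_le n c 0) h.1.1.1 x)) hx

theorem Instance.Moves.isSound {i q c : ℕ} (h : I.Moves d i q c) (hi : i < k)
    (hq : IsSound n k d I.adj I.src (digit (n + 1) q)) :
    IsSound n k d I.adj I.src (digit (n + 1) (next n d k i q c)) :=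
  (IsMove.isSound I.adj_lt hi hq h).congr fun _ hx => (h.digit_next hx).symm

/-- Try the move of window `i` described by the registers `7` and `8`. -/
def tryMove (d k i : ℕ) : Program :=
  .seq (checkAll 9 (.reg 0) (.const 1) (.keeps d k (.dig (.reg 7)) i (.dig (.reg 8) 0)
      (fun m => .dig (.reg 8) (1 + m)) (.reg 9)))
    (.branch (.and (.reg 10) (.isMove d k (.dig (.reg 7)) i (.dig (.reg 8) 0)
        fun m => .dig (.reg 8) (1 + m)))
      (.store 3 (.num (confLen d k) (.shift d k (.dig (.reg 7)) i (.dig (.reg 8) 0)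
        fun m => .dig (.reg 8) (1 + m))) (.const 1)) .skip)

/-- Only the preservation of past vertices needs a loop over all vertices, hence the exponent `1`;
the rest of `IsMove` is an expression of constant size. -/
theorem spec_tryMove (hR : n + 1 ≤ R) {i q c : ℕ} (hi : i < k) :
    Spec R W (n + 1) (fun σ => (I.Inv d R V U σ ∧ σ.reg 7 = q ∧ σ.arr 3 q ≠ 0) ∧ σ.reg 8 = c)
      (tryMove d k i)
      (fun σ => (I.Inv d R (V ∪ {g | I.Moves d i q c ∧ g = next n d k i q c}) U σ ∧ σ.reg 7 = q ∧
        σ.arr 3 q ≠ 0) ∧ σ.reg 8 = c) 1 := by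
  refine Spec.of_forall fun σ ⟨⟨hI, h7, h3⟩, h8⟩ => ?_
  have dig7 : ∀ {τ}, I.Env R τ → τ.reg 7 = q → ∀ x,
      (Expr.dig (.reg 7) x).eval τ = digit (n + 1) q x := fun hτ h x => by
    rw [Expr.eval_dig hτ, Expr.eval_reg, h]
  have dig8 : ∀ {τ}, I.Env R τ → τ.reg 8 = c → ∀ x,
      (Expr.dig (.reg 8) x).eval τ = digit (n + 1) c x := fun hτ h x => by
    rw [Expr.eval_dig hτ, Expr.eval_reg, h]
  refine Spec.seq (spec_checkAll hI.1.1 (x := .reg 0) (N := n) (f := 1) (by omega) (by omega)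
    (by simp) (by omega) (by omega) (fun τ h => h.2.1)
    (Φ := fun v => Past n k d I.adj (digit (n + 1) q) v →
      Past n k d I.adj (shift d k i (digit (n + 1) q) (digit (n + 1) c 0)
        fun m => digit (n + 1) c (1 + m)) v) ?_) ?_
  · intro v hv w hw
    have hE : I.Env R ((σ.setReg 10 w).setReg 9 v) :=
      (hI.1.1.setReg (by omega) (by omega)).setReg (by omega) (by omega)
    have e7 : ((σ.setReg 10 w).setReg 9 v).reg 7 = q := by simp [h7]
    have e8 : ((σ.setReg 10 w).setReg 9 v).reg 8 = c := by simp [h8]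
    rw [Expr.holds_keeps hE (dig7 hE e7) (fun m => dig8 hE e8 (1 + m)), dig8 hE e8]
    simp
  · have key : ∀ τ, (∃ w ≤ 1, τ = (σ.setReg 10 w).setReg 9 n ∧
        (w ≠ 0 ↔ (Expr.const 1).Holds σ ∧ ∀ v < n, Past n k d I.adj (digit (n + 1) q) v →
          Past n k d I.adj (shift d k i (digit (n + 1) q) (digit (n + 1) c 0)
            fun m => digit (n + 1) c (1 + m)) v)) →
        ((I.Inv d R V U τ ∧ τ.reg 7 = q ∧ τ.arr 3 q ≠ 0) ∧ τ.reg 8 = c) ∧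
          ((Expr.and (.reg 10) (.isMove d k (.dig (.reg 7)) i (.dig (.reg 8) 0)
            fun m => .dig (.reg 8) (1 + m))).Holds τ ↔ I.Moves d i q c) := by
      rintro τ ⟨w, hw, rfl, hw'⟩
      have hE : I.Inv d R V U ((σ.setReg 10 w).setReg 9 n) :=
        (hI.setReg (by omega) (by omega)).setReg (by omega) (by omega)
      have e7 : ((σ.setReg 10 w).setReg 9 n).reg 7 = q := by simp [h7]
      have e8 : ((σ.setReg 10 w).setReg 9 n).reg 8 = c := by simp [h8]
      refine ⟨⟨⟨hE, e7, h3⟩, e8⟩, ?_⟩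
      rw [Expr.holds_and, Expr.holds_isMove hE.1.1 (dig7 hE.1.1 e7)
        (fun m => dig8 hE.1.1 e8 (1 + m)), dig8 hE.1.1 e8]
      have : (Expr.reg 10).Holds ((σ.setReg 10 w).setReg 9 n) ↔ w ≠ 0 := by simp [Expr.Holds]
      rw [this, hw', and_iff_right Expr.holds_one]
      exact and_comm
    refine Spec.branch (by omega) (fun τ h => (key τ h).1.1.1.1.1.1) ?_ ?_
    · refine Spec.store (by omega) (fun τ h => (key τ h.1).1.1.1.1.1.1) ?_
      rintro τ ⟨h, hh⟩
      obtain ⟨⟨⟨hE, e7, e3⟩, e8⟩, hm⟩ := key τ h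
      have hM := hm.1 hh
      have hnum : (Expr.num (confLen d k) (.shift d k (.dig (.reg 7)) i (.dig (.reg 8) 0)
          fun m => .dig (.reg 8) (1 + m))).eval τ = next n d k i q c := by
        rw [Expr.eval_num hE.1.1, next]
        refine code_congr fun x _ => ?_
        rw [Expr.eval_shift (dig7 hE.1.1 e7) i _ (fun m => dig8 hE.1.1 e8 (1 + m)), dig8 hE.1.1 e8]
      rw [hnum]
      refine ⟨⟨(hE.mark (by omega) (hM.isSound hi (hE.2.1.1 q e3))).anti ?_ subset_rfl, e7, ?_⟩, e8⟩
      · rintro g (hg | ⟨-, rfl⟩)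
        · exact Or.inr hg
        · exact Or.inl rfl
      · rw [State.setArr_arr]
        split_ifs
        · simp
        · exact e3
    · refine Spec.skip (by omega) ?_
      rintro τ ⟨h, hh⟩
      obtain ⟨⟨⟨hE, e7, e3⟩, e8⟩, hm⟩ := key τ h
      refine ⟨⟨hE.anti ?_ subset_rfl, e7, e3⟩, e8⟩
      rintro g (hg | ⟨hg, -⟩)
      · exact hg
      · exact absurd (hm.2 hg) hh

/-- Mark the configurations which arise from marked ones by moving window `i`. -/
def scan (d k i : ℕ) : Program :=
  forLoop 7 (.powB (confLen d k)) (.branch (.get 3 (.reg 7))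
    (forLoop 8 (.powB (1 + excLen d k)) (tryMove d k i)) .skip)

/-- Codes of the configurations which arise from those in `V` by moving window `i`. -/
def Instance.nexts (I : Instance n k) (d i : ℕ) (V : Set ℕ) : Set ℕ :=
  {g | ∃ q < (n + 1) ^ confLen d k, q ∈ V ∧ ∃ c < (n + 1) ^ (1 + excLen d k),
    I.Moves d i q c ∧ g = next n d k i q c}

/-- A move has `1 + excLen d k` digits: the new vertex and the guessed exceptions. Configurations
marked during the pass may or may not be treated in it; only those in `V` are promised. -/
theorem spec_scan (hR : (n + 1) ^ confLen d k ≤ R) (hR' : (n + 1) ^ (1 + excLen d k) ≤ R) {i : ℕ}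
    (hi : i < k) :
    Spec R W (n + 1) (I.Inv d R V U) (scan d k i) (I.Inv d R (V ∪ I.nexts d i V) U)
      (confLen d k + ((1 + excLen d k) + 1)) := by
  have hR1 : n + 1 ≤ R := (Nat.le_self_pow (by omega) _).trans hR'
  refine Spec.forEach (I := I) (fun j => I.Inv d R (V ∪ {g | ∃ q < j, q ∈ V ∧
      ∃ c < (n + 1) ^ (1 + excLen d k), I.Moves d i q c ∧ g = next n d k i q c}) U)
    le_rfl hR (fun σ h => Expr.eval_powB h _) (fun j σ h => h.1.1)
    (fun j v σ hv h => h.setReg (by omega) hv) (fun σ h => h.anti ?_ subset_rfl)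
    fun q hq => ?_
  · rintro g (hg | ⟨q, hq, -⟩)
    · exact hg
    · omega
  refine Spec.branch (by omega) (fun σ h => h.1.1.1.1) ?_ ?_
  · set V' := V ∪ {g | ∃ q' < q, q' ∈ V ∧ ∃ c < (n + 1) ^ (1 + excLen d k),
      I.Moves d i q' c ∧ g = next n d k i q' c} with hV'
    refine (Spec.forEach (I := I) (fun j σ => I.Inv d R (V' ∪ {g | ∃ c < j,
        I.Moves d i q c ∧ g = next n d k i q c}) U σ ∧ σ.reg 7 = q ∧ σ.arr 3 q ≠ 0)
      le_rfl hR' (fun σ h => Expr.eval_powB h _) (fun j σ h => h.1.1.1) ?_ ?_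
      fun c hc => ?_).mono (fun _ => id) ?_
    · rintro j v σ hv ⟨h1, h2, h3⟩
      exact ⟨h1.setReg (by omega) hv, by simpa using h2, h3⟩
    · rintro σ ⟨⟨h1, h2⟩, h3⟩
      refine ⟨h1.anti ?_ subset_rfl, h2, ?_⟩
      · rintro g (hg | ⟨c, hc, -⟩)
        · exact hg
        · omega
      · rw [← h2]
        exact h3
    · refine (spec_tryMove hR1 hi).mono (fun _ => id) ?_
      rintro σ ⟨⟨h1, h2⟩, h3⟩
      refine ⟨⟨h1.anti ?_ subset_rfl, h2⟩, h3⟩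
      rintro g (hg | ⟨c', hc', hg⟩)
      · exact Or.inl (Or.inl hg)
      · rcases Nat.lt_succ_iff_lt_or_eq.1 hc' with h | rfl
        · exact Or.inl (Or.inr ⟨c', h, hg⟩)
        · exact Or.inr hg
    · rintro σ ⟨h1, h2, -⟩
      refine ⟨h1.anti ?_ subset_rfl, h2⟩
      rintro g (hg | ⟨q', hq', hg⟩)
      · exact Or.inl (Or.inl hg)
      · rcases Nat.lt_succ_iff_lt_or_eq.1 hq' with h | rfl
        · exact Or.inl (Or.inr ⟨q', h, hg⟩)
        · exact Or.inr hg.2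
  · refine Spec.skip (by omega) ?_
    rintro σ ⟨⟨h1, h2⟩, h3⟩
    refine ⟨h1.anti ?_ subset_rfl, h2⟩
    rintro g (hg | ⟨q', hq', hg⟩)
    · exact Or.inl hg
    · rcases Nat.lt_succ_iff_lt_or_eq.1 hq' with h | rfl
      · exact Or.inr ⟨q', h, hg⟩
      · subst h2
        exact absurd (h1.2.1.2 _ (Or.inl hg.1)) h3

/-- Mark the configurations which are reached by at most `n` moves. -/
def search (d k : ℕ) : Program :=
  .seq (markInit d k) (forLoop 6 (.reg 0) (seqN k (scan d k)))

/-- Codes of the configurations which are reached by at most `m` moves. -/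
def Instance.reached (I : Instance n k) (d m : ℕ) : Set ℕ :=
  {q | q < (n + 1) ^ confLen d k ∧
    ∃ m' ≤ m, ∃ D, Reach d I m' D ∧ ∀ x < confLen d k, digit (n + 1) q x = D x}

theorem Reach.le {m : ℕ} {D : ℕ → ℕ} (h : Reach d I m D) (x : ℕ) : D x ≤ n := by
  induction h generalizing x with
  | init hD _ => exact hD x
  | step _ _ hu hY h ih => exact shift_le ih hY hu.le h.1.1.1 x

/-- The last move of a run is coded with `u` as digit `0` of `c` and the relevant part of `Y` as the
further digits. -/
theorem reached_succ_subset (m : ℕ) :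
    I.reached d (m + 1) ⊆ I.reached d m ∪ ⋃ i < k, I.nexts d i (I.reached d m) := by
  rintro q ⟨hq, m', hm', D, hD, hqD⟩
  rcases Nat.le_succ_iff.1 hm' with hm | rfl
  · exact Or.inl ⟨hq, m', hm, D, hD, hqD⟩
  · cases hD with
    | @step _ D Y i u hr hi hu hY h =>
      have e1 : ∀ x < confLen d k, digit (n + 1) (code (n + 1) (confLen d k) D) x = D x :=
        fun x hx => digit_code (fun x _ => Nat.lt_succ_iff.2 (hr.le x)) hx
      have hc : ∀ x, (if x = 0 then u else Y (x - 1)) < n + 1 := fun x => by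
        split_ifs
        · omega
        · exact Nat.lt_succ_iff.2 (hY _)
      have e2 : ∀ x < 1 + excLen d k, digit (n + 1) (code (n + 1) (1 + excLen d k)
          fun x => if x = 0 then u else Y (x - 1)) x = if x = 0 then u else Y (x - 1) :=
        fun x hx => digit_code (fun x _ => hc x) hx
      set q' := code (n + 1) (confLen d k) D
      set c := code (n + 1) (1 + excLen d k) fun x => if x = 0 then u else Y (x - 1)
      have e3 : digit (n + 1) c 0 = u := by rw [e2 0 (by omega), if_pos rfl]
      have e4 : ∀ m < excLen d k, Y m = digit (n + 1) c (1 + m) := fun m hm => by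
        rw [e2 _ (by omega), if_neg (by omega), Nat.add_sub_cancel_left]
      have hM : I.Moves d i q' c := by
        unfold Instance.Moves
        rw [e3]
        exact h.congr (fun x hx => (e1 x hx).symm) hi e4
      refine Or.inr (Set.mem_iUnion₂.2 ⟨i, hi, q', code_lt fun x _ => Nat.lt_succ_iff.2 (hr.le x),
        ⟨code_lt fun x _ => Nat.lt_succ_iff.2 (hr.le x), m, le_rfl, D, hr, e1⟩,
        c, code_lt fun x _ => hc x, hM, ?_⟩)
      refine eq_code hq fun x hx => ?_
      rw [hqD x hx, e3, ← shift_congr_exc e4 x hx]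
      exact shift_congr (fun x hx => (e1 x hx).symm) hi x hx

theorem spec_search (hR : (n + 1) ^ confLen d k ≤ R) (hR' : (n + 1) ^ (1 + excLen d k) ≤ R) :
    Spec R W (n + 1) (I.Inv d R ∅ ∅) (search d k) (I.Inv d R (I.reached d n) ∅)
      (1 + (confLen d k + ((1 + excLen d k) + 1))) := by
  have hR1 : n + 1 ≤ R := (Nat.le_self_pow (by omega) _).trans hR'
  refine Spec.seq ((spec_markInit hR).mono_time (by omega) (by omega)) ?_
  refine Spec.forEach (I := I) (fun m => I.Inv d R (I.reached d m) ∅) (by simp)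
    (by omega) (fun σ h => h.2.1) (fun j σ h => h.1.1) (fun j v σ hv h => h.setReg (by omega) hv)
    (fun σ h => h.anti ?_ subset_rfl) fun m hm => ?_
  · rintro q ⟨hq, m', hm', D, hD, hqD⟩
    obtain rfl : m' = 0 := by omega
    cases hD with
    | init h1 h2 => exact ⟨hq, h2.congr fun x hx => (hqD x hx).symm⟩
  · have hpass : Spec R W (n + 1) (I.Inv d R (I.reached d m) ∅) (seqN k (scan d k))
        (I.Inv d R (I.reached d (m + 1)) ∅) (confLen d k + ((1 + excLen d k) + 1)) := by
      refine (Spec.seqN (fun j => I.Inv d R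
          (I.reached d m ∪ ⋃ i < j, I.nexts d i (I.reached d m)) ∅) (by omega)
        fun i hi => (spec_scan hR hR' hi).mono (fun _ => id) fun σ h =>
          h.anti ?_ subset_rfl).mono (fun σ h => h.anti (by simp) subset_rfl)
          fun σ h => h.anti (reached_succ_subset m) subset_rfl
      rintro g (hg | hg)
      · exact Or.inl (Or.inl hg)
      · obtain ⟨i', hi', hg'⟩ := Set.mem_iUnion₂.1 hg
        rcases Nat.lt_succ_iff_lt_or_eq.1 hi' with h | rfl
        · exact Or.inl (Or.inr (Set.mem_iUnion₂.2 ⟨i', h, hg'⟩))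
        · obtain ⟨q, hq, hqV, h⟩ := hg'
          exact Or.inr ⟨q, hq, Or.inl hqV, h⟩
    refine hpass.frame ?_
    have hw : ∀ j, ¬ (seqN j (scan d k)).Writes 6 := by
      intro j
      induction j with
      | zero => exact id
      | succ j ih => exact fun h => h.elim ih (by
          simp [scan, tryMove, checkAll, DisjointPaths.forLoop, Program.Writes])
    exact hw k

/-- Mark the tuples which belong to marked configurations. -/
def markFinal (d k : ℕ) : Program :=
  forLoop 7 (.powB (confLen d k)) (.branch (.get 3 (.reg 7))
    (forLoop 11 (.powB k) (.branch (.isFinal d k (.dig (.reg 7)) (.dig (.reg 11)))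
      (.store 4 (.reg 11) (.const 1)) .skip)) .skip)

theorem spec_markFinal (hR : (n + 1) ^ confLen d k ≤ R) (hR' : (n + 1) ^ k ≤ R) :
    Spec R W (n + 1) (I.Inv d R V ∅) (markFinal d k)
      (I.Inv d R V {x | ∃ q < (n + 1) ^ confLen d k, q ∈ V ∧ ∃ x' < (n + 1) ^ k,
        IsFinal k d I.tgt (digit (n + 1) q) (digit (n + 1) x') ∧ x = x'}) (confLen d k + k) := by
  have hR1 : 1 ≤ R := (Nat.one_le_pow _ _ (by omega)).trans hR
  refine Spec.forEach (I := I) (fun j => I.Inv d R V {x | ∃ q < j, q ∈ V ∧ ∃ x' < (n + 1) ^ k,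
      IsFinal k d I.tgt (digit (n + 1) q) (digit (n + 1) x') ∧ x = x'})
    le_rfl hR (fun σ h => Expr.eval_powB h _) (fun j σ h => h.1.1)
    (fun j v σ hv h => h.setReg (by omega) hv) (fun σ h => h.anti subset_rfl ?_) fun q hq => ?_
  · rintro x ⟨q, hq, -⟩
    omega
  refine Spec.branch (by omega) (fun σ h => h.1.1.1.1) ?_ ?_
  · set U' := {x | ∃ q' < q, q' ∈ V ∧ ∃ x' < (n + 1) ^ k,
      IsFinal k d I.tgt (digit (n + 1) q') (digit (n + 1) x') ∧ x = x'} with hU'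
    refine (Spec.forEach (I := I) (e := 0) (fun j σ => I.Inv d R V (U' ∪ {x | ∃ x' < j,
        IsFinal k d I.tgt (digit (n + 1) q) (digit (n + 1) x') ∧ x = x'}) σ ∧ σ.reg 7 = q ∧
          σ.arr 3 q ≠ 0)
      le_rfl hR' (fun σ h => Expr.eval_powB h _) (fun j σ h => h.1.1.1) ?_ ?_
      fun c hc => ?_).mono (fun _ => id) ?_
    · rintro j v σ hv ⟨h1, h2, h3⟩
      exact ⟨h1.setReg (by omega) hv, by simpa using h2, h3⟩
    · rintro σ ⟨⟨h1, h2⟩, h3⟩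
      refine ⟨h1.anti subset_rfl ?_, h2, ?_⟩
      · rintro g (hg | ⟨c, hc, -⟩)
        · exact hg
        · omega
      · rw [← h2]
        exact h3
    · have key : ∀ σ, I.Env R σ → σ.reg 7 = q → σ.reg 11 = c →
          ((Expr.isFinal d k (.dig (.reg 7)) (.dig (.reg 11))).Holds σ ↔
            IsFinal k d I.tgt (digit (n + 1) q) (digit (n + 1) c)) := fun σ h h7 h11 =>
        Expr.holds_isFinal h (fun x => by rw [Expr.eval_dig h, Expr.eval_reg, h7])
          fun x => by rw [Expr.eval_dig h, Expr.eval_reg, h11]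
      refine Spec.branch (by omega) (fun σ h => h.1.1.1.1.1) ?_ ?_
      · refine Spec.store (by omega) (fun σ h => h.1.1.1.1.1.1) ?_
        rintro σ ⟨⟨⟨h1, h7, h3⟩, h11⟩, hh⟩
        rw [key σ h1.1.1 h7 h11] at hh
        -- Only sound configurations are marked, so an accepted tuple lies above a quality even if
        -- the configuration does not come from a tight system.
        have hdom : I.Dominated c := (h1.2.1.1 q h3).exists_quality hh
        rw [Expr.eval_reg, h11]
        refine ⟨⟨(h1.markTuple hR1 hdom).anti subset_rfl ?_, h7, ?_⟩, h11⟩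
        · rintro x (hx | ⟨x', hx', hf, rfl⟩)
          · exact Or.inr (Or.inl hx)
          · rcases Nat.lt_succ_iff_lt_or_eq.1 hx' with h | rfl
            · exact Or.inr (Or.inr ⟨_, h, hf, rfl⟩)
            · exact Or.inl rfl
        · rwa [State.setArr_arr_of_ne (by omega)]
      · refine Spec.skip (by omega) ?_
        rintro σ ⟨⟨⟨h1, h7, h3⟩, h11⟩, hh⟩
        rw [key σ h1.1.1 h7 h11] at hh
        refine ⟨⟨h1.anti subset_rfl ?_, h7, h3⟩, h11⟩
        rintro x (hx | ⟨x', hx', hf, rfl⟩)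
        · exact Or.inl hx
        · rcases Nat.lt_succ_iff_lt_or_eq.1 hx' with h | rfl
          · exact Or.inr ⟨_, h, hf, rfl⟩
          · exact absurd hf hh
    · rintro σ ⟨h1, h2, -⟩
      refine ⟨h1.anti subset_rfl ?_, h2⟩
      rintro g ⟨q', hq', hg⟩
      rcases Nat.lt_succ_iff_lt_or_eq.1 hq' with h | rfl
      · exact Or.inl ⟨q', h, hg⟩
      · exact Or.inr hg.2
  · refine Spec.skip (by omega) ?_
    rintro σ ⟨⟨h1, h2⟩, h3⟩
    refine ⟨h1.anti subset_rfl ?_, h2⟩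
    rintro g ⟨q', hq', hg⟩
    rcases Nat.lt_succ_iff_lt_or_eq.1 hq' with h | rfl
    · exact ⟨q', h, hg⟩
    · subst h2
      exact absurd (h1.2.1.2 _ hg.1) h3

end DisjointPaths

namespace DisjointPaths

/-! ### The output -/

variable {n k d R W : ℕ} {I : Instance n k} {σ : State}

/-- The tuple with code `x`. -/
def tuple (n k x : ℕ) (i : Fin k) : ℕ := digit (n + 1) x i

/-- The tuples marked in `F` which are minimal, with code below `j`. -/
def minimals (n k : ℕ) (F : ℕ → ℕ) (j : ℕ) : Set ℕ :=
  {x | x < j ∧ F x ≠ 0 ∧ ∀ y < (n + 1) ^ k, ¬ (F y ≠ 0 ∧ tuple n k y < tuple n k x)}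

/-- The minimal tuples with code below `j` have been written. -/
def Instance.Written (I : Instance n k) (R : ℕ) (F : ℕ → ℕ) (j : ℕ) (σ : State) : Prop :=
  (I.Env R σ ∧ σ.arr 4 = F) ∧ σ.reg 1 ≤ j ∧
    ∃ e : ℕ → ℕ, Set.BijOn e (Set.Iio (σ.reg 1)) (minimals n k F j) ∧
      ∀ m < σ.reg 1, ∀ i < k, σ.arr 2 (k * m + i) = digit (n + 1) (e m) i

theorem Instance.Written.setReg {F : ℕ → ℕ} {j r v : ℕ} (h : I.Written R F j σ) (hr : 2 ≤ r)
    (hv : v ≤ R) : I.Written R F j (σ.setReg r v) := by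
  have h1 : (σ.setReg r v).reg 1 = σ.reg 1 := by
    rw [State.setReg_reg, if_neg (by omega)]
  unfold Instance.Written at *
  rw [h1]
  exact ⟨⟨h.1.1.setReg (by omega) hv, h.1.2⟩, h.2⟩

/-- Write the tuple with code in register `11` to the output. -/
def write (k : ℕ) : Program :=
  .seq (seqN k fun i => .store 2 (.op .add (.op .mul (.const k) (.reg 1)) (.const i))
    (.dig (.reg 11) i)) (.assign 1 (.op .add (.reg 1) (.const 1)))

theorem spec_write {F : ℕ → ℕ} {j : ℕ} (hj : j < R) (hR : n ≤ R) (hm : j ∈ minimals n k F (j + 1)) :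
    Spec R W (n + 1) (fun σ => I.Written R F j σ ∧ σ.reg 11 = j) (write k)
      (fun σ => I.Written R F (j + 1) σ ∧ σ.reg 11 = j) 0 := by
  refine Spec.seq (Spec.mono (Spec.seqN (fun i σ => (I.Written R F j σ ∧ σ.reg 11 = j) ∧
    ∀ i' < i, σ.arr 2 (k * σ.reg 1 + i') = digit (n + 1) j i') (by omega) fun i hi => ?_)
      (fun σ h => ⟨h, fun i hi => absurd hi (by omega)⟩) fun σ => id)
    (Spec.assign (by omega) (fun σ h => h.1.1.1.1.1) ?_)
  · refine Spec.store (by omega) (fun σ h => h.1.1.1.1.1) ?_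
    rintro σ ⟨⟨⟨⟨hE, hF⟩, h1, e, he, h2⟩, h11⟩, hi'⟩
    rw [Expr.eval_dig hE, Expr.eval_reg, h11]
    simp only [Expr.eval_op, Op.eval, Expr.eval_const, Expr.eval_reg]
    refine ⟨⟨⟨⟨hE.setArr le_rfl ((digit_le n j i).trans hR), ?_⟩, h1, e, he, fun m hm i' hi => ?_⟩,
      h11⟩, fun i' hlt => ?_⟩
    · rw [State.setArr_arr_of_ne (by omega), hF]
    -- Earlier members occupy positions below `k * σ.reg 1`, so they are not overwritten.
    · have : k * (m + 1) ≤ k * σ.reg 1 := Nat.mul_le_mul_left _ hm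
      rw [State.setArr_arr, if_neg (by rw [mul_add] at this; omega)]
      exact h2 m hm i' hi
    · rw [State.setArr_arr, State.setArr_reg]
      by_cases hii : i' = i
      · subst hii
        simp
      · rw [if_neg (by omega)]
        exact hi' i' (by omega)
  · rintro σ ⟨⟨⟨⟨hE, hF⟩, h1, e, he, h2⟩, h11⟩, hi'⟩
    simp only [Expr.eval_op, Op.eval, Expr.eval_const, Expr.eval_reg]
    refine ⟨⟨⟨hE.setReg (by omega) (by omega), hF⟩, by simpa using h1,
      Function.update e (σ.reg 1) j, ?_, ?_⟩, by simpa using h11⟩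
    · rw [State.setReg_reg, if_pos rfl]
      have e1 : Set.Iio (σ.reg 1 + 1) = insert (σ.reg 1) (Set.Iio (σ.reg 1)) := by
        ext m
        simp only [Set.mem_Iio, Set.mem_insert_iff]
        omega
      have e2 : minimals n k F (j + 1) = insert j (minimals n k F j) := by
        ext x
        constructor
        · rintro ⟨hx, hx'⟩
          rcases Nat.lt_succ_iff_lt_or_eq.1 hx with h | h
          · exact Or.inr ⟨h, hx'⟩
          · exact Or.inl h
        · rintro (rfl | ⟨hx, hx'⟩)
          · exact hm
          · exact ⟨by omega, hx'⟩
      have he' : Set.BijOn (Function.update e (σ.reg 1) j) (Set.Iio (σ.reg 1)) (minimals n k F j) :=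
        he.congr fun m hm => (Function.update_of_ne (ne_of_lt hm) _ _).symm
      rw [e1, e2]
      have := he'.insert (a := σ.reg 1) (by
        rw [Function.update_self]
        exact fun h => lt_irrefl _ h.1)
      rwa [Function.update_self] at this
    · rw [State.setReg_reg, if_pos rfl]
      intro m hm i hi
      rcases Nat.lt_succ_iff_lt_or_eq.1 hm with h | rfl
      · rw [Function.update_of_ne (by omega)]
        exact h2 m h i hi
      · rw [Function.update_self]
        exact hi' i hi

/-- Write the minimal ones of the marked tuples to the output. -/
def output (k : ℕ) : Program :=
  forLoop 11 (.powB k) (.seq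
    (checkAll 12 (.powB k) (.get 4 (.reg 11)) (.not (.and (.get 4 (.reg 12))
      (.tupLt k (.dig (.reg 12)) (.dig (.reg 11))))))
    (.branch (.reg 10) (write k) .skip))

theorem spec_output (hR : (n + 1) ^ k ≤ R) (hR' : n + 1 ≤ R) {F : ℕ → ℕ} :
    Spec R W (n + 1) (fun σ => (I.Env R σ ∧ σ.arr 4 = F) ∧ σ.reg 1 = 0) (output k)
      (I.Written R F ((n + 1) ^ k)) (k + k) := by
  refine Spec.forEach (I := I) (I.Written R F) le_rfl hR (fun σ h => Expr.eval_powB h _)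
    (fun j σ h => h.1.1) (fun j v σ hv h => h.setReg (by omega) hv) ?_ fun j hj => ?_
  · rintro σ ⟨h1, h2⟩
    refine ⟨h1, by omega, id, ?_, fun m hm => by omega⟩
    have : minimals n k F 0 = Set.Iio (σ.reg 1) := by
      ext x
      simp [minimals, h2]
    rw [this]
    exact Set.bijOn_id _
  · refine Spec.of_forall fun σ ⟨h, h11⟩ => ?_
    refine Spec.seq (spec_checkAll h.1.1 (Φ := fun y => ¬ (F y ≠ 0 ∧ tuple n k y < tuple n k j))
      (by omega) (by omega) le_rfl hR (by omega) (fun τ h => Expr.eval_powB h _) ?_) ?_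
    · intro y hy w hw
      have hE : I.Written R F j ((σ.setReg 10 w).setReg 12 y) :=
        (h.setReg (by omega) (by omega)).setReg (by omega) (by omega)
      rw [Expr.holds_not, Expr.holds_and, Expr.holds_tupLt (x' := digit (n + 1) j)
        (y' := digit (n + 1) y), Expr.Holds, Expr.eval_get, hE.1.2]
      · simp
        rfl
      · intro i
        rw [Expr.eval_dig hE.1.1]
        simp [h11]
      · intro i
        rw [Expr.eval_dig hE.1.1]
        simp
    · have key : ∀ τ, (∃ w ≤ 1, τ = (σ.setReg 10 w).setReg 12 ((n + 1) ^ k) ∧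
          (w ≠ 0 ↔ (Expr.get 4 (.reg 11)).Holds σ ∧
            ∀ y < (n + 1) ^ k, ¬ (F y ≠ 0 ∧ tuple n k y < tuple n k j))) →
          (I.Written R F j τ ∧ τ.reg 11 = j) ∧
            ((Expr.reg 10).Holds τ ↔ j ∈ minimals n k F (j + 1)) := by
        rintro τ ⟨w, hw, rfl, hw'⟩
        refine ⟨⟨(h.setReg (by omega) (by omega)).setReg (by omega) hR, by simpa using h11⟩, ?_⟩
        have e1 : (Expr.reg 10).Holds ((σ.setReg 10 w).setReg 12 ((n + 1) ^ k)) ↔ w ≠ 0 := by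
          simp [Expr.Holds]
        rw [e1, hw', Expr.Holds, Expr.eval_get, Expr.eval_reg, h.1.2, h11]
        exact ⟨fun hh => ⟨by omega, hh⟩, fun hh => hh.2⟩
      refine Spec.branch (by omega) (fun τ h => (key τ h).1.1.1.1.1) ?_ ?_
      · by_cases hm : j ∈ minimals n k F (j + 1)
        · exact ((spec_write (by omega) (by omega) hm).mono_time (by omega) (by omega)).mono
            (fun τ h => (key τ h.1).1) fun τ => id
        · exact fun _ τ h => absurd ((key τ h.1).2.1 h.2) hm
      · refine Spec.skip (by omega) ?_
        rintro τ ⟨hτ, hh⟩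
        obtain ⟨⟨hW, h11'⟩, hm⟩ := key τ hτ
        refine ⟨?_, h11'⟩
        have e2 : minimals n k F (j + 1) = minimals n k F j := by
          ext x
          constructor
          · intro hx
            rcases Nat.lt_succ_iff_lt_or_eq.1 hx.1 with h | rfl
            · exact ⟨h, hx.2⟩
            · exact absurd (hm.2 hx) hh
          · rintro ⟨hx, hx'⟩
            exact ⟨by omega, hx'⟩
        obtain ⟨a, b, c⟩ := hW
        rw [← e2] at c
        exact ⟨a, by omega, c⟩

/-! ### The algorithm -/

theorem Instance.IsQuality.exists_key {y : Fin k → ℕ} (hy : I.IsQuality y) :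
    ∃ z ≤ y, I.IsKeyQuality z := by
  obtain ⟨z, ⟨hz, hzy⟩, hmin⟩ := wellFounded_lt.has_min {z | I.IsQuality z ∧ z ≤ y} ⟨y, hy, le_rfl⟩
  exact ⟨z, hzy, hz, fun w hw hwz => hmin w ⟨hw, hwz.le.trans hzy⟩ hwz⟩

theorem tuple_code {x : Fin k → ℕ} (hx : ∀ i, x i ≤ n) :
    tuple n k (code (n + 1) k fun i => if h : i < k then x ⟨i, h⟩ else 0) = x := by
  funext i
  rw [tuple, digit_code _ i.2, dif_pos i.2]
  intro j hj
  rw [dif_pos hj]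
  exact Nat.lt_succ_iff.2 (hx _)

/-- A minimal marked tuple lies above a quality, hence above a key quality, which is marked itself;
minimality forces equality. Conversely a marked tuple below a key quality would lie above a still
smaller quality. Codes below `(n + 1) ^ k` are determined by their digits. -/
theorem Instance.bijOn_minimals {F : ℕ → ℕ} (h1 : ∀ x, F x ≠ 0 → I.Dominated x)
    (h2 : ∀ x, I.IsKeyQuality x → ∃ c < (n + 1) ^ k, F c ≠ 0 ∧ tuple n k c = x) :
    Set.BijOn (tuple n k) (minimals n k F ((n + 1) ^ k)) {x | I.IsKeyQuality x} := by
  refine ⟨?_, ?_, ?_⟩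
  · rintro c ⟨hc, hF, hmin⟩
    obtain ⟨y, hy, hyc⟩ := h1 c hF
    obtain ⟨z, hzy, hz⟩ := hy.exists_key
    obtain ⟨c', hc', hF', rfl⟩ := h2 z hz
    have hle : tuple n k c' ≤ tuple n k c := hzy.trans hyc
    rcases hle.eq_or_lt with h | h
    · rwa [h] at hz
    · exact absurd ⟨hF', h⟩ (hmin c' hc')
  · rintro c ⟨hc, -⟩ c' ⟨hc', -⟩ e
    rw [eq_code hc fun j hj => congrFun e ⟨j, hj⟩, code_digit, Nat.mod_eq_of_lt hc']
  · rintro x hx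
    obtain ⟨c, hc, hF, rfl⟩ := h2 x hx
    refine ⟨c, ⟨hc, hF, fun y hy ⟨hFy, hlt⟩ => ?_⟩, rfl⟩
    obtain ⟨z, hz, hzy⟩ := h1 y hFy
    exact hx.2 z hz (lt_of_le_of_lt hzy hlt)

/-- The algorithm. -/
def keyQualities (d k : ℕ) : Program := .seq (search d k) (.seq (markFinal d k) (output k))

theorem Instance.inv_initial (I : Instance n k) (hR : n + 1 ≤ R) : I.Inv d R ∅ ∅ I.initial := by
  refine ⟨⟨⟨⟨fun r => ?_, fun a i => ?_⟩, by simp [Instance.initial], rfl, rfl⟩,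
    by simp [Instance.initial]⟩, ⟨fun q h => absurd ?_ h, fun q h => h.elim⟩,
    fun q h => absurd ?_ h, fun q h => h.elim⟩
  · simp only [Instance.initial]
    split_ifs <;> omega
  · simp only [Instance.initial]
    split_ifs <;> omega
  · simp [Instance.initial]
  · simp [Instance.initial]

theorem spec_keyQualities (hd1 : 1 ≤ d) (hd : IsPathDominant I.graph d)
    (hR : (n + 1) ^ confLen d k ≤ R) (hR' : (n + 1) ^ (1 + excLen d k) ≤ R)
    (hR'' : (n + 1) ^ k ≤ R) :
    Spec R W (n + 1) (I.Inv d R ∅ ∅) (keyQualities d k) (fun σ => σ.Lists {x | I.IsKeyQuality x})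
      (1 + (confLen d k + ((1 + excLen d k) + 1))) := by
  have hR1 : n + 1 ≤ R := (Nat.le_self_pow (by omega) _).trans hR'
  have hk : k ≤ confLen d k := by
    unfold confLen
    omega
  -- With this, the search dominates the time for collecting and writing the tuples; it uses `d ≥
  -- 1`.
  have hk' : k ≤ excLen d k := by
    rcases Nat.eq_zero_or_pos k with h | h
    · omega
    · exact Nat.le_mul_of_pos_right k (Nat.mul_pos h hd1)
  refine (spec_search hR hR').seq (Spec.seq
    ((spec_markFinal hR hR'').mono_time (by omega) (by omega)) (Spec.of_forall fun σ h =>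
    ((spec_output (I := I) (F := σ.arr 4) hR'' hR1).mono_time (by omega) (by omega)).mono ?_ ?_))
  · rintro _ rfl
    exact ⟨⟨h.1.1, rfl⟩, h.1.2⟩
  · rintro τ ⟨-, -, e, he, hτ⟩
    have hbij := (I.bijOn_minimals h.2.2.1 fun x hx => ?_).comp he
    · exact hbij.congr fun m hm => funext fun i => (hτ m hm i i.2).symm
    · obtain ⟨hxn, m, hm, D, hD, hDn, hfin⟩ := hx.exists_reach hd hd1
      have hdig : ∀ y < confLen d k, digit (n + 1) (code (n + 1) (confLen d k) D) y = D y :=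
        fun y hy => digit_code (fun y _ => Nat.lt_succ_iff.2 (hDn y)) hy
      have hlt : code (n + 1) (confLen d k) D < (n + 1) ^ confLen d k :=
        code_lt fun y _ => Nat.lt_succ_iff.2 (hDn y)
      have hlt' : ∀ j < k, (if h : j < k then x ⟨j, h⟩ else 0) < n + 1 := fun j hj => by
        rw [dif_pos hj]
        exact Nat.lt_succ_iff.2 (hxn _)
      refine ⟨_, code_lt hlt', h.2.2.2 _ ⟨_, hlt, ⟨hlt, m, hm, D, hD, hdig⟩, _, code_lt hlt', ?_,
        rfl⟩, tuple_code hxn⟩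
      intro i hi
      obtain ⟨j, hj, h1, h2⟩ := hfin i hi
      refine ⟨j, hj, ?_, ?_⟩
      · rw [win_congr hdig hi hj, h1]
      · rw [digit_code hlt' hi, cnt_congr hdig hi]
        exact h2

/-- The left side is `6k²d + 3kd + 9k + 3`. Since `k + d ≥ 2`, the right side has a further `6k²d`,
which covers `3kd`, and the spare `4k` covers `3`. -/
theorem exponent_le (hd : 1 ≤ d) (hk : 1 ≤ k) :
    1 + (confLen d k + ((1 + excLen d k) + 1)) ≤ 6 * k ^ 2 * d * (k + d) + 13 * k := by
  have h : 1 + (confLen d k + ((1 + excLen d k) + 1)) =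
      6 * (k ^ 2 * d) + 3 * (k * d) + 9 * k + 3 := by
    unfold confLen excLen winLen
    ring
  have h1 : k * d ≤ k ^ 2 * d := Nat.mul_le_mul_right _ (Nat.le_self_pow (by omega) _)
  have h2 : k ^ 2 * d * 2 ≤ k ^ 2 * d * (k + d) := Nat.mul_le_mul_left _ (by omega)
  rw [h]
  nlinarith

/-- For fixed `d` and `k`, the key qualities can be listed in polynomial time. -/
theorem exists_program (d k : ℕ) (hd : 1 ≤ d) :
    ∃ (p : Program) (C c : ℕ), ∀ (n : ℕ) (I : Instance n k), IsPathDominant I.graph d →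
      ∃ (σ : State) (T : ℕ), Exec (C * (n + 1) ^ c) p I.initial σ T ∧
        T ≤ C * n ^ (6 * k ^ 2 * d * (k + d) + 13 * k) ∧
        σ.Lists {x : Fin k → ℕ | I.IsKeyQuality x} := by
  rcases Nat.eq_zero_or_pos k with rfl | hk
  -- Without terminals the exponent is `0`, so constant time is required, and `n` may be `0`. The
  -- empty tuple is the only one, and it is key.
  · refine ⟨.assign 1 (.const 1), 2, 0, fun n I _ =>
      ⟨_, _, .assign _ 1 (.const 1) (by simp [Expr.Fits]), by simp [Expr.cost], ?_⟩⟩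
    have hkey : ∀ x, I.IsKeyQuality x := fun x =>
      ⟨⟨fun i => i.elim0, ⟨fun i => i.elim0, fun i => i.elim0⟩, fun i => i.elim0⟩,
        fun y _ h => h.ne (Subsingleton.elim _ _)⟩
    refine ⟨fun _ _ => hkey _, fun a ha b hb _ => ?_, fun x _ => ⟨0, ?_, Subsingleton.elim _ _⟩⟩
    · simp at ha hb
      omega
    · simp
  · set E := confLen d k + (1 + excLen d k) + k with hE
    set p := keyQualities d k
    set f := 1 + (confLen d k + ((1 + excLen d k) + 1)) with hf
    refine ⟨p, 3 ^ p.wt + p.time * 2 ^ f, E * p.wt, fun n I hI => ?_⟩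
    -- A terminal exists, so `n + 1 ≤ 2 * n`, which turns a bound in powers of `n + 1` into one in
    -- powers of `n`.
    have hn : 1 ≤ n := (Nat.zero_le _).trans_lt (I.s ⟨0, hk⟩).2
    have hpow : ∀ m ≤ E, (n + 1) ^ m ≤ (n + 1) ^ E := fun m hm => Nat.pow_le_pow_right (by omega) hm
    have hW : ((n + 1) ^ E + 2) ^ p.wt ≤
        (3 ^ p.wt + p.time * 2 ^ f) * (n + 1) ^ (E * p.wt) := by
      have h1 : (n + 1) ^ E + 2 ≤ 3 * (n + 1) ^ E := by
        have := Nat.one_le_pow E (n + 1) (by omega)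
        omega
      calc ((n + 1) ^ E + 2) ^ p.wt ≤ (3 * (n + 1) ^ E) ^ p.wt := Nat.pow_le_pow_left h1 _
        _ = 3 ^ p.wt * (n + 1) ^ (E * p.wt) := by rw [mul_pow, pow_mul]
        _ ≤ _ := Nat.mul_le_mul_right _ (Nat.le_add_right _ _)
    obtain ⟨σ, T, hex, hT, hl⟩ := spec_keyQualities hd hI (hpow _ (by omega)) (hpow _ (by omega))
      (hpow _ (by omega)) hW I.initial (I.inv_initial (by simpa using hpow 1 (by omega)))
    refine ⟨σ, T, hex, ?_, hl⟩
    calc T ≤ p.time * (n + 1) ^ f := hT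
      _ ≤ p.time * (2 * n) ^ f := Nat.mul_le_mul_left _ (Nat.pow_le_pow_left (by omega) _)
      _ = p.time * 2 ^ f * n ^ f := by rw [mul_pow, mul_assoc]
      _ ≤ _ := Nat.mul_le_mul (Nat.le_add_left _ _) (Nat.pow_le_pow_right hn (exponent_le hd hk))

end DisjointPaths

theorem theorem1p4 (d k : ℕ) (hd : 1 ≤ d) :
    ∃ (p : DisjointPaths.Program) (C c : ℕ),
      ∀ (n : ℕ) (I : DisjointPaths.Instance n k), DisjointPaths.IsPathDominant I.graph d →
        ∃ (σ : DisjointPaths.State) (T : ℕ),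
          DisjointPaths.Exec (C * (n + 1) ^ c) p I.initial σ T ∧
          T ≤ C * n ^ (6 * k ^ 2 * d * (k + d) + 13 * k) ∧
          σ.Lists {x : Fin k → ℕ | I.IsKeyQuality x} :=
  DisjointPaths.exists_program d k hd
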